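/- Let $d\ge 2$. For $n\ge 0$ let $h_n(t)=(2^n n!\sqrt\pi)^{-1/2}H_n(t)e^{-t^2/2}$ be the $L^2(\mathbb R)$-normalized Hermite function, where $H_n(t)=(-1)^n e^{t^2}\frac{d^n}{dt^n}e^{-t^2}$, and for $\alpha\in\mathbb N_0^d$ put $\Phi_\alpha(x)=\prod_{i=1}^d h_{\alpha_i}(x_i)$ and $|\alpha|=\alpha_1+\dots+\alpha_d$. For $\lambda\in 2\mathbb N_0+d$, let $$\Pi_\lambda f=\sum_{\alpha:\ d+2|\alpha|=\lambda}\Big(\int_{\mathbb R^d} f\,\Phi_\alpha\,dy\Big)\Phi_\alpha$$ be the spectral projection of the Hermite operator $-\Delta+|x|^2$ on $\mathbb R^d$ to the eigenvalue $\lambda$. Write $\|T\|_{p\to q}=\sup\{\|Tf\|_{L^q}: f\in\mathcal S(\mathbb R^d),\ \|f\|_{L^p}\le 1\}$. For $X=(a,b)\in\mathbb R^2$ let $X'=(1-b,1-a)$, and for $d\ge 3$ set $$\mathfrak E=\Big(\frac{d+2}{2d},\frac12\Big),\qquad \mathfrak F=\Big(\frac{d^2+2d-4}{2d(d-1)},\frac{d-2}{2(d-1)}\Big).$$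 Let $\mathcal P$ be the closed pentagon with vertices $\mathfrak E,\mathfrak E',\mathfrak F,\mathfrak F',(\frac12,\frac12)$, from which the two vertices $\mathfrak F,\mathfrak F'$ are removed. (i) Let $d\ge 3$ and $(1/p,1/q)\in\mathcal P$. Then there is a constant $C=C(d,p,q)$ such that $\|\Pi_\lambda\|_{p\to q}\le C$ for all $\lambda\in 2\mathbb N_0+d$. (ii) Let $d\ge 3$. There is a constant $C$ depending only on $d$ such that, if $(1/p,1/q)=\mathfrak F$ or $(1/p,1/q)=\mathfrak F'$, then $\|\Pi_\lambda f\|_{L^{q,\infty}}\le C\|f\|_{L^{p,1}}$ for all $\lambda\in 2\mathbb N_0+d$ and all $f\in L^{p,1}(\mathbb R^d)$, where $\|f\|_{L^{p,1}}=p\int_0^\infty |\{|f|>s\}|^{1/p}\,ds$ and $\|g\|_{L^{q,\infty}}=\sup_{s>0}s\,|\{|g|>s\}|^{1/q}$ are the Lorentz (quasi-)norms. (iii) Let $d=2$ and $1\le p\le 2\le q\le\infty$. Then there is a constant $C=C(p,q)$ such that $\|\Pi_\lambda\|_{p\to q}\le C$ for all $\lambda\in 2\mathbb N_0+2$. -/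

import Mathlib

open MeasureTheory Set
open scoped ENNReal NNReal SchwartzMap

noncomputable section

/-- The `n`-th `L²(ℝ)`-normalized Hermite function
`h_n(t) = (2 ^ n n! √π)^(-1/2) H_n(t) exp (-t² / 2)`. Here `H_n` is the physicists' Hermite
polynomial, `H_n(t) = 2 ^ (n / 2) He_n(√2 t)`, and `He_n = Polynomial.hermite n`. -/
def hermiteFun (n : ℕ) (t : ℝ) : ℝ :=
  (Real.sqrt (n.factorial * Real.sqrt Real.pi))⁻¹ *
    Polynomial.aeval (Real.sqrt 2 * t) (Polynomial.hermite n) * Real.exp (-t ^ 2 / 2)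

/-- The Hermite function `Φ_α(x) = ∏ i, h_{α i}(x i)` on `ℝ^d`. -/
def hermitePhi {d : ℕ} (α : Fin d → ℕ) (x : EuclideanSpace ℝ (Fin d)) : ℝ :=
  ∏ i, hermiteFun (α i) (x i)

/-- The spectrum `2 ℕ₀ + d` of the Hermite operator `|x|² - Δ` on `ℝ^d`. -/
def hermiteSpectrum (d : ℕ) : Set ℕ := {lam | ∃ k : ℕ, lam = 2 * k + d}

/-- The finite set of multi-indices `α` with `d + 2 |α| = lam`. -/
def hermiteIndex (d lam : ℕ) : Finset (Fin d → ℕ) :=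
  (Fintype.piFinset fun _ : Fin d => Finset.range (lam + 1)).filter
    fun α => d + 2 * ∑ i, α i = lam

theorem mem_hermiteIndex {d lam : ℕ} {α : Fin d → ℕ} :
    α ∈ hermiteIndex d lam ↔ d + 2 * ∑ i, α i = lam := by
  simp only [hermiteIndex, Finset.mem_filter, Fintype.mem_piFinset, Finset.mem_range,
    and_iff_right_iff_imp]
  intro h i
  have := Finset.single_le_sum (f := α) (fun j _ => Nat.zero_le _) (Finset.mem_univ i)
  omega

/-- The spectral projection `Π_lam f = ∑_{d + 2 |α| = lam} ⟨f, Φ_α⟩ Φ_α`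
(`Φ_α` is real valued). -/
def hermiteProj (d lam : ℕ) (f : EuclideanSpace ℝ (Fin d) → ℂ) :
    EuclideanSpace ℝ (Fin d) → ℂ := fun x =>
  ∑ α ∈ hermiteIndex d lam, (∫ y, f y * (hermitePhi α y : ℂ)) * (hermitePhi α x : ℂ)

/-- `‖T‖_{p → q} = sup {‖T f‖_q : ‖f‖_p ≤ 1, f ∈ 𝓢(ℝ^d)}`. -/
def opNormLp {d : ℕ}
    (T : (EuclideanSpace ℝ (Fin d) → ℂ) → EuclideanSpace ℝ (Fin d) → ℂ) (p q : ℝ≥0∞) : ℝ≥0∞ :=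
  ⨆ (f : 𝓢(EuclideanSpace ℝ (Fin d), ℂ)) (_ : eLpNorm f p volume ≤ 1),
    eLpNorm (T f) q volume

/-- The distribution function `s ↦ |{x : |f x| > s}|`. -/
def distribFun {d : ℕ} (f : EuclideanSpace ℝ (Fin d) → ℂ) (s : ℝ) : ℝ≥0∞ :=
  volume {x | s < ‖f x‖}

/-- The (quasi-)norm of the Lorentz space `L^{p,r}(ℝ^d)`, for `0 < p < ∞` and `0 < r ≤ ∞`:
`p ^ (1/r) (∫_0^∞ (s |{|f| > s}| ^ (1/p)) ^ r ds/s) ^ (1/r)` for `r < ∞`, and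
`sup_{s > 0} s |{|f| > s}| ^ (1/p)` for `r = ∞`. -/
def lorentzNorm {d : ℕ} (f : EuclideanSpace ℝ (Fin d) → ℂ) (p r : ℝ≥0∞) : ℝ≥0∞ :=
  if r = ∞ then
    ⨆ (s : ℝ) (_ : 0 < s), ENNReal.ofReal s * distribFun f s ^ (1 / p.toReal)
  else
    p ^ (1 / r.toReal) *
      (∫⁻ s in Ioi (0 : ℝ),
        (ENNReal.ofReal s * distribFun f s ^ (1 / p.toReal)) ^ r.toReal / ENNReal.ofReal s) ^
          (1 / r.toReal)

/-- The exponent pair `(1/p, 1/q)`, with `1/∞ = 0`. -/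
def exponentPoint (p q : ℝ≥0∞) : ℝ × ℝ := (p⁻¹.toReal, q⁻¹.toReal)

/-- The dual point `X' = (1 - b, 1 - a)` of `X = (a, b)`. -/
def dualPoint (X : ℝ × ℝ) : ℝ × ℝ := (1 - X.2, 1 - X.1)

/-- The point `𝔈(d)`. -/
def pointE (d : ℕ) : ℝ × ℝ := (((d : ℝ) + 2) / (2 * d), 1 / 2)

/-- The point `𝔉(d)`. -/
def pointF (d : ℕ) : ℝ × ℝ :=
  (((d : ℝ) ^ 2 + 2 * d - 4) / (2 * d * (d - 1)), ((d : ℝ) - 2) / (2 * (d - 1)))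

/-- The closed pentagon with vertices `𝔈, 𝔈', 𝔉, 𝔉', (1/2, 1/2)`, from which the vertices
`𝔉, 𝔉'` are removed. -/
def pentagon (d : ℕ) : Set (ℝ × ℝ) :=
  convexHull ℝ {pointE d, dualPoint (pointE d), pointF d, dualPoint (pointF d), (1 / 2, 1 / 2)} \
    {pointF d, dualPoint (pointF d)}

end

open MeasureTheory Set
open scoped ENNReal NNReal SchwartzMap

/-! Everything starts from Mehler's formula (`hasSum_mehler`): on the unit disc, ∑ r^|α|
Φ_α(x)Φ_α(y) is an explicit Gaussian whose exponent has nonpositive real part, so it is bounded by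
(π|1 - r²|)^(-d/2). Abel summation carries this to r = e^{iθ}, where it reads: the bilinear series ∑
e^{i|α|θ} f_α g_α is at most (2π|sin θ|)^(-d/2) |A||B| when |f| ≤ 1_A and |g| ≤ 1_B. The projection
is recovered as a Fourier coefficient in θ.

Dimension d ≥ 3. Put s = d/2 > 1, a = |A|, b = |B| and cut the θ-integral at |sin θ| = δ. Away from
the zeros of sin the pointwise bound gives ab δ^(1-s). Near them, Cauchy–Schwarz in α separates g,
whose coefficients satisfy Bessel's inequality, from f weighted by the Fourier coefficients of the
window. The square of the weighted norm is a double integral over the window of ∑ |f_α|²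
e^{i|α|(θ-t)}, hence at most δ times the L¹ norm of that series over a period. This L¹ norm is
O(a^(1+1/s)), because the series is bounded both by a and by a²|sin θ|^(-s). Balancing √(δ a^(1+1/s)
b) against ab δ^(1-s) gives a restricted weak type bound exactly at 𝔉 (`norm_tsum_ite_le`,
`restrictedBound_F`). The pairing is symmetric, so the bound at 𝔉' is free. Dyadic level sets of f
and testing against the phase of Π f on a superlevel set turn these into the Lorentz bounds.

The strong bounds are geometry in the coordinates (1/p, 1/q'), where duality is the swap. Bilinear
real interpolation (`exists_strongBound_of_restrictedBound`) covers the open segment 𝔉𝔉', including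
its midpoint (1/2 + 1/d, 1/2 + 1/d); interpolating that with the L² bound covers the diagonal below
it. Since ⟨Π f, f̄⟩ is a positive form, Cauchy–Schwarz (`StrongBound.of_diagonal`) spreads diagonal
bounds over the whole square [1/2, 1/2 + 1/d]², one corner of which is 𝔈. Segments from 𝔈 to the
side of 𝔉 fill a triangle, and the pentagon is the square with this triangle and its mirror image.

Dimension d = 2. Here s = 1 and the integral of |sin θ|^(-s) diverges logarithmically. Instead the
diagonal ∑_{|α| = k} Φ_α(x)² of the kernel is shown to be uniformly bounded (`hermiteDensity_le`),
which gives L² → L^q for q ≥ 2, the dual bounds, and their composition. Comparing generating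
functions, this density is π⁻¹E(2|x|²), where E is e^{-x/2} times an alternating Laguerre sum. With
K = k + 1 and p = xE', one has p'' = -(K/x - 1/4)p, with a turning point at x = 4K. Three quantities
control E: a Sonin energy near 0, a corrected adiabatic invariant up to distance about K^(1/3) from
the turning point, and G = 4p' + (4K - x)E, whose derivative is -E ≤ 0 because E is a sum of
squares. Past the turning point E decreases. -/

/-! ### Hermite polynomials as complex Gaussian moments -/

theorem derivative_hermite_succ (n : ℕ) :
    (Polynomial.hermite (n + 1)).derivative = ((n : Polynomial ℤ) + 1) * Polynomial.hermite n := by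
  induction n with
  | zero => simp
  | succ n ih =>
    rw [Polynomial.hermite_succ (n + 1), Polynomial.derivative_sub, Polynomial.derivative_mul, ih]
    have h := Polynomial.hermite_succ n
    simp only [Polynomial.derivative_mul, Polynomial.derivative_X, Polynomial.derivative_add,
      Polynomial.derivative_natCast, Polynomial.derivative_one]
    push_cast
    linear_combination (-(n + 1 : Polynomial ℤ)) * h

theorem hermite_succ_succ (n : ℕ) :
    Polynomial.hermite (n + 2) =
      Polynomial.X * Polynomial.hermite (n + 1) - ((n : Polynomial ℤ) + 1) * Polynomial.hermite n := by
  rw [Polynomial.hermite_succ (n + 1), derivative_hermite_succ]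

/-- Lets growth exp |u| be swallowed by half of the Gaussian exp(-u²/2). -/
theorem abs_le_one_add_sq_div (u : ℝ) : |u| ≤ 1 + u ^ 2 / 4 := by
  rw [← sq_abs u]; nlinarith [sq_nonneg (|u| - 2)]

theorem norm_add_mul_I_pow_le (x u : ℝ) (n : ℕ) :
    ‖((x : ℂ) + u * Complex.I) ^ n‖ ≤ n.factorial * Real.exp (|x| + |u|) := by
  rw [norm_pow]
  have h1 : ‖(x : ℂ) + u * Complex.I‖ ≤ |x| + |u| := by
    refine (norm_add_le _ _).trans ?_
    simp
  have h2 := Real.pow_div_factorial_le_exp (|x| + |u|) (by positivity) n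
  rw [div_le_iff₀ (by positivity)] at h2
  calc _ ≤ (|x| + |u|) ^ n := by gcongr
    _ ≤ _ := by linarith

theorem integrable_add_mul_I_pow_mul_gaussian (x : ℝ) (n : ℕ) :
    Integrable fun u : ℝ => ((x : ℂ) + u * Complex.I) ^ n * Real.exp (-u ^ 2 / 2) := by
  have hi := (integrable_exp_neg_mul_sq (b := 1 / 4) (by norm_num)).const_mul
    (n.factorial * Real.exp (|x| + 1))
  refine hi.mono' (by fun_prop) (Filter.Eventually.of_forall fun u => ?_)
  rw [norm_mul, Complex.norm_real, Real.norm_eq_abs, Real.abs_exp]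
  calc _ ≤ n.factorial * Real.exp (|x| + |u|) * Real.exp (-u ^ 2 / 2) := by
        gcongr; exact norm_add_mul_I_pow_le x u n
    _ = n.factorial * Real.exp (|x| + |u| + -u ^ 2 / 2) := by rw [mul_assoc, ← Real.exp_add]
    _ ≤ n.factorial * Real.exp (|x| + 1 + -(1 / 4) * u ^ 2) := by
        refine mul_le_mul_of_nonneg_left (Real.exp_le_exp.2 ?_) (by positivity)
        linarith [abs_le_one_add_sq_div u]
    _ = _ := by rw [mul_assoc, ← Real.exp_add]

theorem integral_gaussian_eq : ∫ u : ℝ, Real.exp (-u ^ 2 / 2) = Real.sqrt (2 * Real.pi) := by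
  have h := integral_gaussian (1 / 2)
  rw [show Real.pi / (1 / 2) = 2 * Real.pi by ring] at h
  rw [← h]
  congr 1; ext u; congr 1; ring

theorem hasDerivAt_neg_sq_div_two (u : ℝ) : HasDerivAt (fun u : ℝ => -u ^ 2 / 2) (-u) u := by
  have h := ((hasDerivAt_id' u).pow 2).neg.div_const 2
  refine h.congr_deriv ?_
  push_cast
  ring

/-- Since -u = i((x + iu) - x), differentiating (x + iu)^(n+1) e^{-u²/2} gives i times a combination
of the three neighbouring integrands, and this derivative integrates to 0. The result is the
three-term recurrence of He_n. -/
theorem integral_add_mul_I_pow_succ_succ (x : ℝ) (n : ℕ) :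
    (∫ u : ℝ, ((x : ℂ) + u * Complex.I) ^ (n + 2) * Real.exp (-u ^ 2 / 2)) =
      x * (∫ u : ℝ, ((x : ℂ) + u * Complex.I) ^ (n + 1) * Real.exp (-u ^ 2 / 2)) -
        (n + 1) * ∫ u : ℝ, ((x : ℂ) + u * Complex.I) ^ n * Real.exp (-u ^ 2 / 2) := by
  have hd : ∀ u : ℝ, HasDerivAt
      (fun u : ℝ => ((x : ℂ) + u * Complex.I) ^ (n + 1) * Real.exp (-u ^ 2 / 2))
      (Complex.I * ((n + 1) * (((x : ℂ) + u * Complex.I) ^ n * Real.exp (-u ^ 2 / 2)) +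
        (((x : ℂ) + u * Complex.I) ^ (n + 2) * Real.exp (-u ^ 2 / 2) -
        x * (((x : ℂ) + u * Complex.I) ^ (n + 1) * Real.exp (-u ^ 2 / 2))))) u := by
    intro u
    have h1 : HasDerivAt (fun u : ℝ => (x : ℂ) + u * Complex.I) Complex.I u := by
      simpa using ((Complex.ofRealCLM.hasDerivAt (x := u)).mul_const Complex.I).const_add (x : ℂ)
    have h2 := hasDerivAt_neg_sq_div_two u
    have h3 := (h1.pow (n + 1)).mul (h2.exp.ofReal_comp)
    refine h3.congr_deriv ?_
    simp only [Pi.pow_apply, add_tsub_cancel_right]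
    push_cast
    linear_combination (-(u * ((x : ℂ) + u * Complex.I) ^ (n + 1) * Complex.exp (-u ^ 2 / 2))) *
      Complex.I_sq
  have i0 := integrable_add_mul_I_pow_mul_gaussian x n
  have i1 := integrable_add_mul_I_pow_mul_gaussian x (n + 1)
  have i2 := integrable_add_mul_I_pow_mul_gaussian x (n + 2)
  have h := integral_eq_zero_of_hasDerivAt_of_integrable hd
    (((i0.const_mul _).add (i2.sub (i1.const_mul _))).const_mul _) i1
  rw [integral_const_mul, integral_add (i0.const_mul _) (by exact i2.sub (i1.const_mul _)),
    integral_sub i2 (i1.const_mul _), integral_const_mul, integral_const_mul] at h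
  have h' := (mul_eq_zero.mp h).resolve_left Complex.I_ne_zero
  linear_combination h'

/-- The moment representation of the (probabilists') Hermite polynomials. -/
theorem integral_add_mul_I_pow (x : ℝ) (n : ℕ) :
    (∫ u : ℝ, ((x : ℂ) + u * Complex.I) ^ n * Real.exp (-u ^ 2 / 2)) =
      Real.sqrt (2 * Real.pi) * (Polynomial.aeval x (Polynomial.hermite n) : ℝ) := by
  have h0 : (∫ u : ℝ, ((x : ℂ) + u * Complex.I) ^ 0 * Real.exp (-u ^ 2 / 2)) =
      Real.sqrt (2 * Real.pi) * (Polynomial.aeval x (Polynomial.hermite 0) : ℝ) := by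
    simp only [pow_zero, one_mul]
    rw [integral_complex_ofReal, integral_gaussian_eq]
    simp
  induction n using Nat.twoStepInduction with
  | zero => exact h0
  | one =>
    have i0 := integrable_add_mul_I_pow_mul_gaussian x 0
    have i1 := integrable_add_mul_I_pow_mul_gaussian x 1
    have hd : ∀ u : ℝ, HasDerivAt (fun u : ℝ => ((x : ℂ) + u * Complex.I) ^ 0 *
        (Real.exp (-u ^ 2 / 2) : ℂ))
        (Complex.I * (((x : ℂ) + u * Complex.I) ^ 1 * Real.exp (-u ^ 2 / 2) -
        x * (((x : ℂ) + u * Complex.I) ^ 0 * Real.exp (-u ^ 2 / 2)))) u := by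
      intro u
      have h2 := hasDerivAt_neg_sq_div_two u
      simp only [pow_zero, one_mul]
      convert (h2.exp.ofReal_comp) using 1
      push_cast
      ring_nf
      simp only [Complex.I_sq]
      ring
    have h := integral_eq_zero_of_hasDerivAt_of_integrable hd
      ((i1.sub (i0.const_mul _)).const_mul _) i0
    rw [integral_const_mul, integral_sub i1 (i0.const_mul _), integral_const_mul, h0] at h
    have h' := (mul_eq_zero.mp h).resolve_left Complex.I_ne_zero
    rw [Polynomial.hermite_zero, map_one, map_one, Complex.ofReal_one] at h'
    rw [Polynomial.hermite_one, Polynomial.aeval_X]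
    linear_combination h'
  | more n ih0 ih1 =>
    rw [integral_add_mul_I_pow_succ_succ, ih0, ih1, hermite_succ_succ]
    simp only [map_sub, map_mul, Polynomial.aeval_X, map_add, map_natCast, map_one]
    push_cast
    ring

/-! ### Mehler's formula and the sup bound for its kernel -/

theorem HasSum.of_eq {ι E : Type*} [AddCommMonoid E] [TopologicalSpace E] {f g : ι → E} {a b : E}
    (h : HasSum f a) (hfg : ∀ i, g i = f i) (hab : b = a) : HasSum g b := by
  rw [hab, funext hfg]; exact h

theorem norm_mul_add_mul_I_mul_le (r : ℂ) (x y u v : ℝ) :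
    ‖r * (((x : ℂ) + u * Complex.I) * ((y : ℂ) + v * Complex.I))‖ ≤
      ‖r‖ * ((|x| + |u|) * (|y| + |v|)) := by
  have h : ∀ a b : ℝ, ‖(a : ℂ) + b * Complex.I‖ ≤ |a| + |b| := fun a b =>
    (norm_add_le _ _).trans (by simp)
  rw [norm_mul, norm_mul]
  gcongr
  · exact h x u
  · exact h y v

/-- Gaussian domination of the exponential of a product of two affine factors. -/
theorem mul_add_abs_sub_le {q : ℝ} (hq0 : 0 ≤ q) (hq : q < 1) (x y u v : ℝ) :
    q * ((|x| + |u|) * (|y| + |v|)) + -u ^ 2 / 2 + -v ^ 2 / 2 ≤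
      (|x| * |y| + (x ^ 2 + y ^ 2) / (1 - q)) + -((1 - q) / 4) * u ^ 2 + -((1 - q) / 4) * v ^ 2 := by
  have h1q : 0 < 1 - q := by linarith
  have hx := abs_nonneg x
  have hy := abs_nonneg y
  have hu := abs_nonneg u
  have hv := abs_nonneg v
  -- AM–GM with weight 1 - q. The uv term uses up the fraction q of each Gaussian, leaving (1 -
  -- q)/2; half of the remainder pays for the mixed terms xv and yu.
  have key : ∀ a b : ℝ, 0 ≤ a → 0 ≤ b → q * (a * b) ≤ a ^ 2 / (1 - q) + (1 - q) / 4 * b ^ 2 := by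
    intro a b ha hb
    have h2 : a * b ≤ a ^ 2 / (1 - q) + (1 - q) / 4 * b ^ 2 := by
      have h3 : a ^ 2 / (1 - q) + (1 - q) / 4 * b ^ 2 - a * b =
          (a - (1 - q) / 2 * b) ^ 2 / (1 - q) := by field_simp; ring
      have : 0 ≤ (a - (1 - q) / 2 * b) ^ 2 / (1 - q) := by positivity
      linarith
    nlinarith [mul_nonneg ha hb]
  have k1 := key |x| |v| hx hv
  have k2 := key |y| |u| hy hu
  have k3 : q * (|u| * |v|) ≤ q * (u ^ 2 + v ^ 2) / 2 := by
    rw [← sq_abs u, ← sq_abs v]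
    nlinarith [mul_nonneg hq0 (sq_nonneg (|u| - |v|))]
  have k4 : q * (|x| * |y|) ≤ |x| * |y| := by nlinarith [mul_nonneg hx hy]
  simp only [sq_abs] at k1 k2
  have : (x ^ 2 + y ^ 2) / (1 - q) = x ^ 2 / (1 - q) + y ^ 2 / (1 - q) := add_div _ _ _
  rw [this]
  nlinarith

/-- The Mehler kernel. -/
noncomputable def mehlerKernel (r : ℂ) (x y : ℝ) : ℂ :=
  ((Real.sqrt 2 * Real.pi : ℝ) : ℂ)⁻¹ * (Real.pi / ((1 - r ^ 2) / 2)) ^ (1 / 2 : ℂ) *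
    Complex.exp (-((1 - r) / (1 + r) * (x + y) ^ 2 + (1 + r) / (1 - r) * (x - y) ^ 2) / 4)

theorem re_one_sub_sq_pos {r : ℂ} (hr : ‖r‖ < 1) : 0 < (1 - r ^ 2).re := by
  have h1 : (r ^ 2).re ≤ ‖r ^ 2‖ := Complex.re_le_norm _
  have h2 : ‖r ^ 2‖ < 1 := by rw [norm_pow]; exact pow_lt_one₀ (norm_nonneg _) hr (by norm_num)
  simp only [Complex.sub_re, Complex.one_re]
  linarith

theorem one_add_ne_zero_of_norm {r : ℂ} (hr : ‖r‖ < 1) : 1 + r ≠ 0 := by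
  intro h
  have : r = -1 := by linear_combination h
  rw [this] at hr; simp at hr

theorem one_sub_ne_zero_of_norm {r : ℂ} (hr : ‖r‖ < 1) : 1 - r ≠ 0 := by
  intro h
  have : r = 1 := by linear_combination -h
  rw [this] at hr; simp at hr

/-- Both factors are replaced by their moment integrals, and the exponential series of r(x + iu)(y +
iv) is summed under the double integral. The condition |r| < 1 is what keeps this exponential
dominated by the two Gaussians. -/
theorem hasSum_hermite_mul_hermite_integral {r : ℂ} (hr : ‖r‖ < 1) (x y : ℝ) :
    HasSum (fun n : ℕ => r ^ n / n.factorial * ((2 * Real.pi : ℝ) : ℂ) *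
      ((Polynomial.aeval x (Polynomial.hermite n) * Polynomial.aeval y (Polynomial.hermite n) : ℝ) : ℂ))
      (∫ u : ℝ, ∫ v : ℝ, Complex.exp (r * (((x : ℂ) + u * Complex.I) * ((y : ℂ) + v * Complex.I)) +
        (-u ^ 2 / 2 : ℝ) + (-v ^ 2 / 2 : ℝ))) := by
  set F : ℕ → ℝ × ℝ → ℂ := fun n z => r ^ n / n.factorial *
    ((((x : ℂ) + z.1 * Complex.I) ^ n * Real.exp (-z.1 ^ 2 / 2)) *
      (((y : ℂ) + z.2 * Complex.I) ^ n * Real.exp (-z.2 ^ 2 / 2))) with hF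
  have hFe : ∀ n z, F n z = (r * (((x : ℂ) + z.1 * Complex.I) * ((y : ℂ) + z.2 * Complex.I))) ^ n /
      n.factorial * (Real.exp (-z.1 ^ 2 / 2) * Real.exp (-z.2 ^ 2 / 2)) := by
    intro n z; simp only [hF]; rw [mul_pow, mul_pow]; ring
  have hFn : ∀ n z, ‖F n z‖ = ‖r * (((x : ℂ) + z.1 * Complex.I) * ((y : ℂ) + z.2 * Complex.I))‖ ^ n /
      n.factorial * (Real.exp (-z.1 ^ 2 / 2) * Real.exp (-z.2 ^ 2 / 2)) := by
    intro n z
    rw [hFe, norm_mul, norm_div, norm_pow, ← Complex.ofReal_mul, Complex.norm_real,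
      Real.norm_of_nonneg (by positivity), Complex.norm_natCast]
  have hsumn : ∀ z, HasSum (fun n => ‖F n z‖)
      (Real.exp ‖r * (((x : ℂ) + z.1 * Complex.I) * ((y : ℂ) + z.2 * Complex.I))‖ *
        (Real.exp (-z.1 ^ 2 / 2) * Real.exp (-z.2 ^ 2 / 2))) := by
    intro z
    simp_rw [hFn]
    refine HasSum.mul_right _ ?_
    rw [Real.exp_eq_exp_ℝ]
    exact NormedSpace.expSeries_div_hasSum_exp _
  have hint : Integrable fun z : ℝ × ℝ => Real.exp (|x| * |y| + (x ^ 2 + y ^ 2) / (1 - ‖r‖)) *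
      (Real.exp (-((1 - ‖r‖) / 4) * z.1 ^ 2) * Real.exp (-((1 - ‖r‖) / 4) * z.2 ^ 2)) :=
    ((integrable_exp_neg_mul_sq (by linarith)).mul_prod
      (integrable_exp_neg_mul_sq (by linarith))).const_mul _
  have hle : ∀ z : ℝ × ℝ, Real.exp ‖r * (((x : ℂ) + z.1 * Complex.I) * ((y : ℂ) + z.2 * Complex.I))‖ *
        (Real.exp (-z.1 ^ 2 / 2) * Real.exp (-z.2 ^ 2 / 2)) ≤
      Real.exp (|x| * |y| + (x ^ 2 + y ^ 2) / (1 - ‖r‖)) *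
      (Real.exp (-((1 - ‖r‖) / 4) * z.1 ^ 2) * Real.exp (-((1 - ‖r‖) / 4) * z.2 ^ 2)) := by
    intro z
    simp only [← Real.exp_add]
    apply Real.exp_le_exp.2
    have h1 := norm_mul_add_mul_I_mul_le r x y z.1 z.2
    have h2 := mul_add_abs_sub_le (norm_nonneg r) hr x y z.1 z.2
    linarith
  have hFc : ∀ n, Continuous (F n) := fun n => by simp only [hF]; fun_prop
  have hsum : ∀ z, HasSum (fun n => F n z) (Complex.exp (r * (((x : ℂ) + z.1 * Complex.I) *
      ((y : ℂ) + z.2 * Complex.I)) + (-z.1 ^ 2 / 2 : ℝ) + (-z.2 ^ 2 / 2 : ℝ))) := by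
    intro z
    simp_rw [hFe]
    rw [Complex.exp_add, Complex.exp_add, mul_assoc, ← Complex.ofReal_exp, ← Complex.ofReal_exp]
    refine HasSum.mul_right _ ?_
    rw [Complex.exp_eq_exp_ℂ]
    exact NormedSpace.expSeries_div_hasSum_exp _
  have hmain := hasSum_integral_of_dominated_convergence (μ := (volume : Measure (ℝ × ℝ)))
    (fun n z => ‖F n z‖) (fun n => (hFc n).aestronglyMeasurable)
    (fun n => Filter.Eventually.of_forall fun z => le_rfl)
    (Filter.Eventually.of_forall fun z => (hsumn z).summable)
    (by
      simp_rw [fun z => (hsumn z).tsum_eq]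
      refine hint.mono' (by fun_prop) (Filter.Eventually.of_forall fun z => ?_)
      rw [Real.norm_of_nonneg (by positivity)]
      exact hle z)
    (Filter.Eventually.of_forall hsum)
  have hci : Integrable (fun z : ℝ × ℝ => Complex.exp (r * (((x : ℂ) + z.1 * Complex.I) *
      ((y : ℂ) + z.2 * Complex.I)) + (-z.1 ^ 2 / 2 : ℝ) + (-z.2 ^ 2 / 2 : ℝ)))
      (volume.prod volume) := by
    refine hint.mono' (by fun_prop) (Filter.Eventually.of_forall fun z => ?_)
    rw [← (hsum z).tsum_eq]
    exact (norm_tsum_le_tsum_norm (hsumn z).summable).trans ((hsumn z).tsum_eq ▸ hle z)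
  rw [Measure.volume_eq_prod, integral_prod _ hci] at hmain
  refine hmain.of_eq (fun n => ?_) rfl
  simp only [hF]
  rw [integral_const_mul, integral_prod_mul
    (fun u : ℝ => ((x : ℂ) + u * Complex.I) ^ n * (Real.exp (-u ^ 2 / 2) : ℂ))
    (fun v : ℝ => ((y : ℂ) + v * Complex.I) ^ n * (Real.exp (-v ^ 2 / 2) : ℂ)),
    integral_add_mul_I_pow, integral_add_mul_I_pow]
  have h : ((2 * Real.pi : ℝ) : ℂ) = Real.sqrt (2 * Real.pi) * Real.sqrt (2 * Real.pi) := by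
    rw [← Complex.ofReal_mul, Real.mul_self_sqrt (by positivity)]
  rw [h]
  push_cast
  ring

/-- Two successive complex Gaussian integrals: integrating in v leaves a Gaussian in u with
quadratic coefficient (1 - r²)/2, of positive real part. This also fixes the branch of the square
root. -/
theorem integral_integral_cexp_mehler {r : ℂ} (hr : ‖r‖ < 1) (x y : ℝ) :
    (∫ u : ℝ, ∫ v : ℝ, Complex.exp (r * (((x : ℂ) + u * Complex.I) * ((y : ℂ) + v * Complex.I)) +
        (-u ^ 2 / 2 : ℝ) + (-v ^ 2 / 2 : ℝ))) =
      Real.sqrt (2 * Real.pi) * ((Real.pi / ((1 - r ^ 2) / 2)) ^ (1 / 2 : ℂ) *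
        Complex.exp (-(r ^ 2 * (x ^ 2 + y ^ 2) - 2 * r * x * y) / (2 * (1 - r ^ 2)))) := by
  have hre := re_one_sub_sq_pos hr
  have hne : 1 - r ^ 2 ≠ 0 := by
    intro h; rw [h] at hre; simp at hre
  have hin : ∀ u : ℝ, (∫ v : ℝ, Complex.exp (r * (((x : ℂ) + u * Complex.I) *
      ((y : ℂ) + v * Complex.I)) + (-u ^ 2 / 2 : ℝ) + (-v ^ 2 / 2 : ℝ))) =
      Real.sqrt (2 * Real.pi) * Complex.exp (-((1 - r ^ 2) / 2) * u ^ 2 +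
        Complex.I * (r * y - r ^ 2 * x) * u + (r * x * y - r ^ 2 * x ^ 2 / 2)) := by
    intro u
    have h := integral_cexp_quadratic (b := -(1 / 2)) (by simp)
      (r * (x + u * Complex.I) * Complex.I) (r * (x + u * Complex.I) * y - u ^ 2 / 2)
    have hs : ((Real.pi : ℂ) / -(-(1 / 2))) ^ (1 / 2 : ℂ) = Real.sqrt (2 * Real.pi) := by
      rw [Real.sqrt_eq_rpow, Complex.ofReal_cpow (by positivity)]
      push_cast
      congr 1
      ring
    rw [hs] at h
    refine Eq.trans ?_ (h.trans ?_)
    · congr 1; ext v; congr 1; push_cast; ring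
    congr 2
    ring_nf
    simp only [Complex.I_sq, Complex.I_pow_four, Complex.I_pow_three]
    ring
  simp_rw [hin]
  rw [integral_const_mul, integral_cexp_quadratic (by
    rw [Complex.neg_re, Complex.div_ofNat_re]; linarith), neg_neg]
  congr 3
  field_simp
  ring_nf
  simp only [Complex.I_sq]
  ring

/-- **Mehler's formula**. -/
theorem hasSum_mehler {r : ℂ} (hr : ‖r‖ < 1) (x y : ℝ) :
    HasSum (fun n : ℕ => r ^ n * ((hermiteFun n x * hermiteFun n y : ℝ) : ℂ))
      (mehlerKernel r x y) := by
  have h := hasSum_hermite_mul_hermite_integral hr (Real.sqrt 2 * x) (Real.sqrt 2 * y)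
  rw [integral_integral_cexp_mehler hr] at h
  have h2 := h.mul_left (((2 * Real.pi : ℝ) : ℂ)⁻¹ * (Real.sqrt Real.pi : ℂ)⁻¹ *
    Complex.exp (-(x ^ 2 + y ^ 2) / 2))
  have h2pi : ((2 * Real.pi : ℝ) : ℂ) ≠ 0 := by
    rw [Complex.ofReal_ne_zero]; positivity
  have hpi : ((Real.sqrt Real.pi : ℝ) : ℂ) ≠ 0 := by
    rw [Complex.ofReal_ne_zero]; positivity
  refine h2.of_eq (fun n => ?_) ?_
  · have hs : (Real.sqrt (n.factorial * Real.sqrt Real.pi))⁻¹ *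
        (Real.sqrt (n.factorial * Real.sqrt Real.pi))⁻¹ =
        (n.factorial : ℝ)⁻¹ * (Real.sqrt Real.pi)⁻¹ := by
      rw [← mul_inv, Real.mul_self_sqrt (by positivity), mul_inv]
    have he : Real.exp (-x ^ 2 / 2) * Real.exp (-y ^ 2 / 2) = Real.exp (-(x ^ 2 + y ^ 2) / 2) := by
      rw [← Real.exp_add]; congr 1; ring
    have hh : hermiteFun n x * hermiteFun n y = (n.factorial : ℝ)⁻¹ * (Real.sqrt Real.pi)⁻¹ *
        (Polynomial.aeval (Real.sqrt 2 * x) (Polynomial.hermite n) *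
          Polynomial.aeval (Real.sqrt 2 * y) (Polynomial.hermite n)) *
          Real.exp (-(x ^ 2 + y ^ 2) / 2) := by
      rw [← hs, ← he]; simp only [hermiteFun]; ring
    rw [hh, Complex.ofReal_mul (_ * _), Complex.ofReal_mul (_ * _), Complex.ofReal_mul (_)⁻¹]
    push_cast
    field_simp
  · have h1p := one_add_ne_zero_of_norm hr
    have h1m := one_sub_ne_zero_of_norm hr
    have h12 : 1 - r ^ 2 ≠ 0 := by
      rw [show 1 - r ^ 2 = (1 - r) * (1 + r) by ring]; exact mul_ne_zero h1m h1p
    have hc : ((Real.sqrt 2 * Real.pi : ℝ) : ℂ)⁻¹ = ((2 * Real.pi : ℝ) : ℂ)⁻¹ *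
        (Real.sqrt Real.pi : ℂ)⁻¹ * Real.sqrt (2 * Real.pi) := by
      norm_cast
      have e1 : Real.sqrt (2 * Real.pi) = Real.sqrt 2 * Real.sqrt Real.pi :=
        Real.sqrt_mul (by norm_num) _
      have e2 := Real.mul_self_sqrt (show (0 : ℝ) ≤ 2 by norm_num)
      rw [e1]
      field_simp
      linarith
    have hs2 : ((Real.sqrt 2 : ℝ) : ℂ) ^ 2 = 2 := by
      rw [← Complex.ofReal_pow, Real.sq_sqrt (by norm_num)]; norm_num
    have hexp : -((1 - r) / (1 + r) * ((x : ℂ) + y) ^ 2 + (1 + r) / (1 - r) * ((x : ℂ) - y) ^ 2) / 4 =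
        -((x : ℂ) ^ 2 + y ^ 2) / 2 + -(r ^ 2 * (((Real.sqrt 2 * x : ℝ) : ℂ) ^ 2 +
          ((Real.sqrt 2 * y : ℝ) : ℂ) ^ 2) - 2 * r * (Real.sqrt 2 * x : ℝ) * (Real.sqrt 2 * y : ℝ)) /
          (2 * (1 - r ^ 2)) := by
      push_cast
      rw [mul_pow, mul_pow, hs2, show 2 * r * (Real.sqrt 2 * (x : ℂ)) * (Real.sqrt 2 * (y : ℂ)) =
        2 * r * (Real.sqrt 2 : ℂ) ^ 2 * x * y by ring, hs2,
        show 1 - r ^ 2 = (1 - r) * (1 + r) by ring]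
      field_simp
      ring
    rw [mehlerKernel, hexp, Complex.exp_add, hc]
    ring

/-- For |r| < 1 both (1 - r)/(1 + r) and its inverse have nonnegative real part, so the exponential
has modulus at most 1 and only the prefactor survives. -/
theorem norm_mehlerKernel_le {r : ℂ} (hr : ‖r‖ < 1) (x y : ℝ) :
    ‖mehlerKernel r x y‖ ≤ (Real.pi * ‖1 - r ^ 2‖) ^ (-(1 / 2) : ℝ) := by
  have hre := re_one_sub_sq_pos hr
  have hne : 0 < ‖1 - r ^ 2‖ := hre.trans_le (Complex.re_le_norm _)
  have h1p := one_add_ne_zero_of_norm hr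
  have h1m := one_sub_ne_zero_of_norm hr
  have hsq : ‖r‖ ^ 2 = r.re ^ 2 + r.im ^ 2 := by
    rw [← Complex.normSq_eq_norm_sq, Complex.normSq_apply]; ring
  have hlt : r.re ^ 2 + r.im ^ 2 < 1 := by
    rw [← hsq]; exact pow_lt_one₀ (norm_nonneg _) hr (by norm_num)
  have hz : ∀ a b : ℝ, 0 ≤ ((1 - r) / (1 + r) * ((a : ℂ)) ^ 2 + (1 + r) / (1 - r) * (b : ℂ) ^ 2).re := by
    intro a b
    have e1 : 0 ≤ ((1 - r) / (1 + r)).re := by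
      rw [Complex.div_re, ← add_div]
      apply div_nonneg _ (Complex.normSq_nonneg _)
      simp
      nlinarith
    have e2 : 0 ≤ ((1 + r) / (1 - r)).re := by
      rw [Complex.div_re, ← add_div]
      apply div_nonneg _ (Complex.normSq_nonneg _)
      simp
      nlinarith
    rw [← Complex.ofReal_pow, ← Complex.ofReal_pow, Complex.add_re, Complex.re_mul_ofReal,
      Complex.re_mul_ofReal]
    positivity
  have hexp : ‖Complex.exp (-((1 - r) / (1 + r) * ((x : ℂ) + y) ^ 2 +
      (1 + r) / (1 - r) * ((x : ℂ) - y) ^ 2) / 4)‖ ≤ 1 := by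
    rw [Complex.norm_exp, Real.exp_le_one_iff]
    have := hz (x + y) (x - y)
    push_cast at this
    rw [neg_div, Complex.neg_re, Complex.div_ofNat_re]
    linarith
  have hA : ‖((Real.sqrt 2 * Real.pi : ℝ) : ℂ)⁻¹ * (Real.pi / ((1 - r ^ 2) / 2)) ^ (1 / 2 : ℂ)‖ =
      (Real.pi * ‖1 - r ^ 2‖) ^ (-(1 / 2) : ℝ) := by
    rw [norm_mul, show (1 / 2 : ℂ) = ((1 / 2 : ℝ) : ℂ) by norm_num, Complex.norm_cpow_real,
      norm_inv, Complex.norm_real, Real.norm_of_nonneg (by positivity), norm_div, norm_div,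
      Complex.norm_real, Real.norm_of_nonneg Real.pi_pos.le, Complex.norm_ofNat, Real.rpow_neg
      (by positivity), ← Real.sqrt_eq_rpow, ← Real.sqrt_eq_rpow]
    rw [show Real.pi / (‖1 - r ^ 2‖ / 2) = 2 * Real.pi ^ 2 / (Real.pi * ‖1 - r ^ 2‖) by
      field_simp, Real.sqrt_div (by positivity), Real.sqrt_mul (by norm_num),
      Real.sqrt_sq Real.pi_pos.le]
    field_simp
  rw [mehlerKernel, norm_mul, hA]
  exact mul_le_of_le_one_right (by positivity) hexp

/-! ### Hermite functions: decay, ladder relations, orthonormality -/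

/-- The moment representation bounds He_n(x) by a multiple of e^|x|, which costs only part of the
factor exp(-t²/2). -/
theorem exists_abs_hermiteFun_le (n : ℕ) :
    ∃ C : ℝ, 0 ≤ C ∧ ∀ t, |hermiteFun n t| ≤ C * Real.exp (-(1 / 4) * t ^ 2) := by
  set J := ∫ u : ℝ, Real.exp (-(1 / 4) * u ^ 2) with hJ
  have hJ0 : 0 ≤ J := integral_nonneg fun u => (Real.exp_pos _).le
  have hs : 0 < Real.sqrt (2 * Real.pi) := by positivity
  have hHe : ∀ x : ℝ, |Polynomial.aeval x (Polynomial.hermite n)| ≤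
      (Real.sqrt (2 * Real.pi))⁻¹ * (n.factorial * Real.exp 1 * J) * Real.exp |x| := by
    intro x
    have h1 := integral_add_mul_I_pow x n
    have h2 : ‖∫ u : ℝ, ((x : ℂ) + u * Complex.I) ^ n * Real.exp (-u ^ 2 / 2)‖ ≤
        ∫ u : ℝ, n.factorial * Real.exp (|x| + 1) * Real.exp (-(1 / 4) * u ^ 2) := by
      refine norm_integral_le_of_norm_le
        ((integrable_exp_neg_mul_sq (b := 1 / 4) (by norm_num)).const_mul _)
        (Filter.Eventually.of_forall fun u => ?_)
      rw [norm_mul, Complex.norm_real, Real.norm_eq_abs, Real.abs_exp]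
      calc _ ≤ n.factorial * Real.exp (|x| + |u|) * Real.exp (-u ^ 2 / 2) := by
            gcongr; exact norm_add_mul_I_pow_le x u n
        _ = n.factorial * Real.exp (|x| + |u| + -u ^ 2 / 2) := by rw [mul_assoc, ← Real.exp_add]
        _ ≤ n.factorial * Real.exp (|x| + 1 + -(1 / 4) * u ^ 2) := by
            refine mul_le_mul_of_nonneg_left (Real.exp_le_exp.2 ?_) (by positivity)
            linarith [abs_le_one_add_sq_div u]
        _ = _ := by rw [mul_assoc, ← Real.exp_add]
    rw [h1, norm_mul, Complex.norm_real, Complex.norm_real, Real.norm_of_nonneg hs.le,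
      Real.norm_eq_abs, integral_const_mul, Real.exp_add] at h2
    rw [mul_assoc, ← div_eq_inv_mul, le_div_iff₀ hs]
    linarith
  refine ⟨(Real.sqrt (n.factorial * Real.sqrt Real.pi))⁻¹ *
    ((Real.sqrt (2 * Real.pi))⁻¹ * (n.factorial * Real.exp 1 * J)) * Real.exp 2, by positivity,
    fun t => ?_⟩
  rw [hermiteFun, abs_mul, abs_mul, Real.abs_exp, abs_of_nonneg (by positivity)]
  have hx : |Real.sqrt 2 * t| + -t ^ 2 / 2 ≤ 2 + -(1 / 4) * t ^ 2 := by
    rw [abs_mul, abs_of_nonneg (Real.sqrt_nonneg 2), ← sq_abs t]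
    nlinarith [sq_nonneg (|t| / 2 - Real.sqrt 2), Real.sq_sqrt (show (0 : ℝ) ≤ 2 by norm_num)]
  calc _ ≤ (Real.sqrt (n.factorial * Real.sqrt Real.pi))⁻¹ *
      ((Real.sqrt (2 * Real.pi))⁻¹ * (n.factorial * Real.exp 1 * J) * Real.exp |Real.sqrt 2 * t|) *
      Real.exp (-t ^ 2 / 2) := by gcongr; exact hHe _
    _ = (Real.sqrt (n.factorial * Real.sqrt Real.pi))⁻¹ *
      ((Real.sqrt (2 * Real.pi))⁻¹ * (n.factorial * Real.exp 1 * J)) *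
      Real.exp (|Real.sqrt 2 * t| + -t ^ 2 / 2) := by rw [Real.exp_add]; ring
    _ ≤ (Real.sqrt (n.factorial * Real.sqrt Real.pi))⁻¹ *
      ((Real.sqrt (2 * Real.pi))⁻¹ * (n.factorial * Real.exp 1 * J)) *
      Real.exp (2 + -(1 / 4) * t ^ 2) := by
        exact mul_le_mul_of_nonneg_left (Real.exp_le_exp.2 hx) (by positivity)
    _ = _ := by rw [Real.exp_add]; ring

theorem continuous_hermiteFun (n : ℕ) : Continuous (hermiteFun n) := by
  have h : Continuous fun t : ℝ => Polynomial.aeval (Real.sqrt 2 * t) (Polynomial.hermite n) :=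
    (Polynomial.continuous_aeval _).comp (continuous_const.mul continuous_id)
  unfold hermiteFun
  fun_prop

theorem integrable_hermiteFun (n : ℕ) : Integrable (hermiteFun n) := by
  obtain ⟨C, -, hC⟩ := exists_abs_hermiteFun_le n
  exact ((integrable_exp_neg_mul_sq (b := 1 / 4) (by norm_num)).const_mul C).mono'
    (continuous_hermiteFun n).aestronglyMeasurable (Filter.Eventually.of_forall hC)

theorem exists_abs_hermiteFun_le_const (n : ℕ) : ∃ C : ℝ, 0 ≤ C ∧ ∀ t, |hermiteFun n t| ≤ C := by
  obtain ⟨C, hC0, hC⟩ := exists_abs_hermiteFun_le n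
  refine ⟨C, hC0, fun t => (hC t).trans ?_⟩
  refine mul_le_of_le_one_right hC0 (Real.exp_le_one_iff.2 ?_)
  nlinarith [sq_nonneg t]

theorem integrable_hermiteFun_mul (m n : ℕ) :
    Integrable fun t => hermiteFun m t * hermiteFun n t := by
  obtain ⟨C, -, hC⟩ := exists_abs_hermiteFun_le_const m
  exact (integrable_hermiteFun n).bdd_mul (c := C) (continuous_hermiteFun m).aestronglyMeasurable
    (Filter.Eventually.of_forall hC)

/-- The normalizing constant of `hermiteFun`. -/
noncomputable def hermiteConst (n : ℕ) : ℝ := Real.sqrt (n.factorial * Real.sqrt Real.pi)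

theorem hermiteConst_pos (n : ℕ) : 0 < hermiteConst n := by
  unfold hermiteConst; positivity

theorem hermiteConst_succ (n : ℕ) : hermiteConst (n + 1) = Real.sqrt (n + 1) * hermiteConst n := by
  unfold hermiteConst
  rw [← Real.sqrt_mul (by positivity), Nat.factorial_succ]
  push_cast
  congr 1; ring

theorem hasDerivAt_hermite_comp (n : ℕ) (t : ℝ) :
    HasDerivAt (fun t : ℝ => Polynomial.aeval (Real.sqrt 2 * t) (Polynomial.hermite n))
      (Real.sqrt 2 * Polynomial.aeval (Real.sqrt 2 * t) (Polynomial.hermite n).derivative) t := by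
  have h1 := Polynomial.hasDerivAt_aeval (Polynomial.hermite n) (Real.sqrt 2 * t)
  have h2 : HasDerivAt (fun t : ℝ => Real.sqrt 2 * t) (Real.sqrt 2) t := by
    simpa using (hasDerivAt_id t).const_mul (Real.sqrt 2)
  exact (h1.comp t h2).congr_deriv (mul_comm _ _)

/-- The raising relation `h_n' = t h_n - √(2(n+1)) h_{n+1}`. -/
theorem hasDerivAt_hermiteFun (n : ℕ) (t : ℝ) :
    HasDerivAt (hermiteFun n)
      (t * hermiteFun n t - Real.sqrt 2 * Real.sqrt (n + 1) * hermiteFun (n + 1) t) t := by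
  have h := ((hasDerivAt_hermite_comp n t).const_mul (hermiteConst n)⁻¹).mul
    (hasDerivAt_neg_sq_div_two t).exp
  refine h.congr_deriv ?_
  have hc := hermiteConst_succ n
  have hp := hermiteConst_pos n
  have hn : 0 < Real.sqrt ((n : ℝ) + 1) := by positivity
  have e0 : hermiteFun n t = (hermiteConst n)⁻¹ *
    Polynomial.aeval (Real.sqrt 2 * t) (Polynomial.hermite n) * Real.exp (-t ^ 2 / 2) := rfl
  have e1 : hermiteFun (n + 1) t = (hermiteConst (n + 1))⁻¹ *
    Polynomial.aeval (Real.sqrt 2 * t) (Polynomial.hermite (n + 1)) * Real.exp (-t ^ 2 / 2) := rfl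
  rw [e0, e1, hc, Polynomial.hermite_succ, map_sub, map_mul, Polynomial.aeval_X, mul_inv]
  have h2 := Real.mul_self_sqrt (show (0 : ℝ) ≤ 2 by norm_num)
  field_simp
  linear_combination (t * Polynomial.aeval (Real.sqrt 2 * t) (Polynomial.hermite n)) * h2

/-- The lowering relation `h_{n+1}' = √(2(n+1)) h_n - t h_{n+1}`. -/
theorem hasDerivAt_hermiteFun_succ (n : ℕ) (t : ℝ) :
    HasDerivAt (hermiteFun (n + 1))
      (Real.sqrt 2 * Real.sqrt (n + 1) * hermiteFun n t - t * hermiteFun (n + 1) t) t := by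
  have h := ((hasDerivAt_hermite_comp (n + 1) t).const_mul (hermiteConst (n + 1))⁻¹).mul
    (hasDerivAt_neg_sq_div_two t).exp
  refine h.congr_deriv ?_
  have hc := hermiteConst_succ n
  have hp := hermiteConst_pos n
  have hn : 0 < Real.sqrt ((n : ℝ) + 1) := by positivity
  have e0 : hermiteFun n t = (hermiteConst n)⁻¹ *
    Polynomial.aeval (Real.sqrt 2 * t) (Polynomial.hermite n) * Real.exp (-t ^ 2 / 2) := rfl
  have e1 : hermiteFun (n + 1) t = (hermiteConst (n + 1))⁻¹ *
    Polynomial.aeval (Real.sqrt 2 * t) (Polynomial.hermite (n + 1)) * Real.exp (-t ^ 2 / 2) := rfl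
  rw [e0, e1, hc, derivative_hermite_succ, map_mul, map_add, map_natCast, map_one, mul_inv]
  have h2 := Real.mul_self_sqrt (show (0 : ℝ) ≤ n + 1 by positivity)
  field_simp
  linear_combination (-(Real.sqrt 2 * Polynomial.aeval (Real.sqrt 2 * t) (Polynomial.hermite n))) * h2

theorem hasDerivAt_hermiteFun_zero (t : ℝ) :
    HasDerivAt (hermiteFun 0) (-t * hermiteFun 0 t) t := by
  have h := (hasDerivAt_neg_sq_div_two t).exp.const_mul (hermiteConst 0)⁻¹
  have e : hermiteFun 0 = fun t => (hermiteConst 0)⁻¹ * Real.exp (-t ^ 2 / 2) := by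
    ext t; simp [hermiteFun, hermiteConst]
  rw [e]
  exact h.congr_deriv (by ring)

theorem integral_hermiteFun_zero_mul_succ (n : ℕ) :
    ∫ t, hermiteFun 0 t * hermiteFun (n + 1) t = 0 := by
  have hd : ∀ t, HasDerivAt (fun t => hermiteFun 0 t * hermiteFun n t)
      (-(Real.sqrt 2 * Real.sqrt (n + 1)) * (hermiteFun 0 t * hermiteFun (n + 1) t)) t := by
    intro t
    exact ((hasDerivAt_hermiteFun_zero t).mul (hasDerivAt_hermiteFun n t)).congr_deriv (by ring)
  have h := integral_eq_zero_of_hasDerivAt_of_integrable hd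
    ((integrable_hermiteFun_mul 0 (n + 1)).const_mul _) (integrable_hermiteFun_mul 0 n)
  rw [integral_const_mul] at h
  refine (mul_eq_zero.1 h).resolve_left ?_
  exact neg_ne_zero.2 (by positivity)

/-- In (h_{m+1} h_n)' use the lowering relation on the first factor and the raising relation on the
second: the terms containing t cancel, and the total derivative integrates to 0. -/
theorem sqrt_mul_integral_hermiteFun_succ (m n : ℕ) :
    Real.sqrt (n + 1) * ∫ t, hermiteFun (m + 1) t * hermiteFun (n + 1) t =
      Real.sqrt (m + 1) * ∫ t, hermiteFun m t * hermiteFun n t := by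
  have hd : ∀ t, HasDerivAt (fun t => hermiteFun (m + 1) t * hermiteFun n t)
      (Real.sqrt 2 * (Real.sqrt (m + 1) * (hermiteFun m t * hermiteFun n t) -
        Real.sqrt (n + 1) * (hermiteFun (m + 1) t * hermiteFun (n + 1) t))) t := by
    intro t
    exact ((hasDerivAt_hermiteFun_succ m t).mul (hasDerivAt_hermiteFun n t)).congr_deriv (by ring)
  have i1 := (integrable_hermiteFun_mul m n).const_mul (Real.sqrt (m + 1))
  have i2 := (integrable_hermiteFun_mul (m + 1) (n + 1)).const_mul (Real.sqrt (n + 1))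
  have h := integral_eq_zero_of_hasDerivAt_of_integrable hd ((i1.sub i2).const_mul _)
    (integrable_hermiteFun_mul (m + 1) n)
  rw [integral_const_mul, integral_sub i1 i2, integral_const_mul, integral_const_mul] at h
  have := (mul_eq_zero.1 h).resolve_left (by positivity)
  linarith

/-- The Hermite functions are orthonormal. -/
theorem integral_hermiteFun_mul (m n : ℕ) :
    ∫ t, hermiteFun m t * hermiteFun n t = if m = n then 1 else 0 := by
  induction m generalizing n with
  | zero =>
    cases n with
    | zero =>
      have e : ∀ t, hermiteFun 0 t * hermiteFun 0 t = (Real.sqrt Real.pi)⁻¹ * Real.exp (-1 * t ^ 2) := by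
        intro t
        have hs : (Real.sqrt (Real.sqrt Real.pi))⁻¹ * (Real.sqrt (Real.sqrt Real.pi))⁻¹ =
          (Real.sqrt Real.pi)⁻¹ := by rw [← mul_inv, Real.mul_self_sqrt (by positivity)]
        have he : Real.exp (-1 * t ^ 2) = Real.exp (-t ^ 2 / 2) * Real.exp (-t ^ 2 / 2) := by
          rw [← Real.exp_add]; congr 1; ring
        rw [← hs, he]
        simp [hermiteFun]
        ring
      simp_rw [e]
      rw [integral_const_mul, integral_gaussian, div_one, if_pos trivial]
      exact inv_mul_cancel₀ (by positivity)
    | succ n => rw [integral_hermiteFun_zero_mul_succ, if_neg (by omega)]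
  | succ m ih =>
    cases n with
    | zero =>
      simp_rw [mul_comm (hermiteFun (m + 1) _)]
      rw [integral_hermiteFun_zero_mul_succ, if_neg (by omega)]
    | succ n =>
      have h := sqrt_mul_integral_hermiteFun_succ m n
      rw [ih n] at h
      have hp : Real.sqrt ((n : ℝ) + 1) ≠ 0 := by positivity
      by_cases hmn : m = n
      · subst hmn
        rw [if_pos rfl] at h ⊢
        exact mul_left_cancel₀ hp h
      · rw [if_neg hmn, mul_zero] at h
        rw [if_neg (by omega)]
        exact (mul_eq_zero.1 h).resolve_left hp

/-! ### Tools: L^p membership of bounded integrable functions, products of series -/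

theorem lintegral_enorm_rpow_le_of_bounded {X : Type*} [MeasurableSpace X] {μ : Measure X} {f : X → ℂ}
    {M : ℝ≥0∞} (hM : M ≠ ∞) (hf : ∀ x, ‖f x‖ₑ ≤ M) {p q : ℝ} (hp : 0 ≤ p) (hpq : p ≤ q) :
    ∫⁻ x, ‖f x‖ₑ ^ q ∂μ ≤ M ^ (q - p) * ∫⁻ x, ‖f x‖ₑ ^ p ∂μ := by
  rw [← lintegral_const_mul' _ _ (ENNReal.rpow_ne_top_of_nonneg (by linarith) hM)]
  refine lintegral_mono fun x => ?_
  calc ‖f x‖ₑ ^ q = ‖f x‖ₑ ^ (q - p) * ‖f x‖ₑ ^ p := by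
        rw [← ENNReal.rpow_add_of_nonneg _ _ (by linarith) hp, sub_add_cancel]
    _ ≤ _ := by gcongr; exact hf x

theorem memLp_of_integrable_of_bounded {X : Type*} [MeasurableSpace X] {μ : Measure X} {f : X → ℂ}
    (hf : Integrable f μ) {M : ℝ} (hM : ∀ x, ‖f x‖ ≤ M) {p : ℝ≥0∞} (hp : 1 ≤ p) : MemLp f p μ := by
  rcases eq_or_ne p ∞ with rfl | hpt
  · exact memLp_top_of_bound hf.1 M (Filter.Eventually.of_forall hM)
  · refine ⟨hf.1, ?_⟩
    have hp0 : p ≠ 0 := fun h => by simp [h] at hp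
    have hp1 : 1 ≤ p.toReal := by
      rw [← ENNReal.toReal_one]; exact (ENNReal.toReal_le_toReal (by simp) hpt).2 hp
    rw [eLpNorm_lt_top_iff_lintegral_rpow_enorm_lt_top hp0 hpt]
    have h1 := lintegral_enorm_rpow_le_of_bounded (μ := μ) (M := ENNReal.ofReal M)
      ENNReal.ofReal_ne_top (fun x => by
        rw [← ofReal_norm]; exact ENNReal.ofReal_le_ofReal (hM x)) zero_le_one hp1
    refine h1.trans_lt (ENNReal.mul_lt_top ?_ ?_)
    · exact ENNReal.rpow_lt_top_of_nonneg (by linarith) ENNReal.ofReal_ne_top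
    · simp only [ENNReal.rpow_one]; exact hf.2

theorem HasSum.mul_complex {ι κ : Type*} {f : ι → ℂ} {g : κ → ℂ} {a b : ℂ} (hf : HasSum f a)
    (hg : HasSum g b) : HasSum (fun x : ι × κ => f x.1 * g x.2) (a * b) := by
  have hf' : Summable fun i => ‖f i‖ := summable_norm_iff.2 hf.summable
  have hg' : Summable fun i => ‖g i‖ := summable_norm_iff.2 hg.summable
  exact hf.mul hg (summable_mul_of_summable_norm hf' hg')

theorem hasSum_prod_pi {d : ℕ} {f : Fin d → ℕ → ℂ} {S : Fin d → ℂ} (h : ∀ i, HasSum (f i) (S i)) :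
    HasSum (fun α : Fin d → ℕ => ∏ i, f i (α i)) (∏ i, S i) := by
  induction d with
  | zero =>
    simp only [Finset.univ_eq_empty, Finset.prod_empty]
    exact hasSum_unique (fun _ : Fin 0 → ℕ => (1 : ℂ))
  | succ d ih =>
    have h1 := ih (f := fun i => f i.succ) (S := fun i => S i.succ) fun i => h i.succ
    have h2 := (h 0).mul_complex h1
    rw [← (Fin.consEquiv fun _ : Fin (d + 1) => ℕ).hasSum_iff, Fin.prod_univ_succ]
    refine h2.of_eq (fun x => ?_) rfl
    simp [Fin.prod_univ_succ, Fin.consEquiv]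

/-! ### Tensor products: Bessel's inequality and the dispersive bound on the disc -/

section HermitePhi

variable {d : ℕ}

theorem continuous_hermitePhi (α : Fin d → ℕ) : Continuous (hermitePhi α) := by
  unfold hermitePhi
  exact continuous_finsetProd _ fun i _ => (continuous_hermiteFun _).comp (by fun_prop)

theorem exists_abs_hermitePhi_le (α : Fin d → ℕ) : ∃ C : ℝ, 0 ≤ C ∧ ∀ x, |hermitePhi α x| ≤ C := by
  choose C hC0 hC using fun i => exists_abs_hermiteFun_le_const (α i)
  refine ⟨∏ i, C i, Finset.prod_nonneg fun i _ => hC0 i, fun x => ?_⟩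
  rw [hermitePhi, Finset.abs_prod]
  exact Finset.prod_le_prod (fun i _ => abs_nonneg _) fun i _ => hC i _

theorem integral_hermitePhi_mul (α β : Fin d → ℕ) :
    ∫ x, hermitePhi α x * hermitePhi β x = if α = β then 1 else 0 := by
  have h := (EuclideanSpace.volume_preserving_symm_measurableEquiv_toLp (Fin d)).integral_comp'
    (fun z : Fin d → ℝ => ∏ i, hermiteFun (α i) (z i) * hermiteFun (β i) (z i))
  have e : ∀ x : EuclideanSpace ℝ (Fin d), hermitePhi α x * hermitePhi β x =
    ∏ i, hermiteFun (α i) (x i) * hermiteFun (β i) (x i) := fun x => by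
      rw [Finset.prod_mul_distrib]; rfl
  simp_rw [e]
  refine h.trans ?_
  rw [integral_fintype_prod_volume_eq_prod (fun i t => hermiteFun (α i) t * hermiteFun (β i) t)]
  simp_rw [integral_hermiteFun_mul]
  split_ifs with hab
  · subst hab; simp
  · obtain ⟨i, hi⟩ := Function.ne_iff.1 hab
    exact Finset.prod_eq_zero (Finset.mem_univ i) (if_neg hi)

theorem integrable_hermitePhi (α : Fin d → ℕ) : Integrable (hermitePhi α) := by
  have h := (EuclideanSpace.volume_preserving_symm_measurableEquiv_toLp (Fin d)).integrable_comp_emb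
    (MeasurableEquiv.measurableEmbedding _)
    (g := fun z : Fin d → ℝ => ∏ i, hermiteFun (α i) (z i))
  exact h.2 (Integrable.fintype_prod fun i => integrable_hermiteFun (α i))

theorem memLp_hermitePhi (α : Fin d → ℕ) {p : ℝ≥0∞} (hp : 1 ≤ p) :
    MemLp (fun x => (hermitePhi α x : ℂ)) p := by
  obtain ⟨C, -, hC⟩ := exists_abs_hermitePhi_le α
  refine memLp_of_integrable_of_bounded (integrable_hermitePhi α).ofReal (M := C) (fun x => ?_) hp
  simpa using hC x

/-- The Hermite coefficient `⟨f, Φ_α⟩`. -/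
noncomputable def hermiteCoeff (f : EuclideanSpace ℝ (Fin d) → ℂ) (α : Fin d → ℕ) : ℂ :=
  ∫ y, f y * (hermitePhi α y : ℂ)

/-- `Φ_α` as an element of `L²`. -/
noncomputable def hermiteLp (α : Fin d → ℕ) : Lp ℂ 2 (volume : Measure (EuclideanSpace ℝ (Fin d))) :=
  (memLp_hermitePhi α (by norm_num : (1 : ℝ≥0∞) ≤ 2)).toLp _

theorem coeFn_hermiteLp (α : Fin d → ℕ) : hermiteLp α =ᵐ[volume] fun x => (hermitePhi α x : ℂ) :=
  MemLp.coeFn_toLp _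

theorem orthonormal_hermiteLp : Orthonormal ℂ (hermiteLp (d := d)) := by
  rw [orthonormal_iff_ite]
  intro α β
  rw [L2.inner_def]
  have e : (fun a => inner ℂ ((hermiteLp α : EuclideanSpace ℝ (Fin d) → ℂ) a)
      ((hermiteLp β : EuclideanSpace ℝ (Fin d) → ℂ) a)) =ᵐ[volume]
      fun x => ((hermitePhi α x * hermitePhi β x : ℝ) : ℂ) := by
    filter_upwards [coeFn_hermiteLp α, coeFn_hermiteLp β] with x h1 h2
    rw [h1, h2, RCLike.inner_apply, Complex.conj_ofReal]
    push_cast; ring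
  rw [integral_congr_ae e, integral_complex_ofReal, integral_hermitePhi_mul]
  split_ifs <;> simp

theorem inner_hermiteLp_toLp (α : Fin d → ℕ) {f : EuclideanSpace ℝ (Fin d) → ℂ} (hf : MemLp f 2) :
    inner ℂ (hermiteLp α) (hf.toLp f) = hermiteCoeff f α := by
  rw [L2.inner_def]
  refine integral_congr_ae ?_
  filter_upwards [coeFn_hermiteLp α, hf.coeFn_toLp] with x h1 h2
  rw [h1, h2, RCLike.inner_apply, Complex.conj_ofReal]

/-- Bessel's inequality for the Hermite functions. -/
theorem summable_norm_hermiteCoeff_sq {f : EuclideanSpace ℝ (Fin d) → ℂ} (hf : MemLp f 2) :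
    Summable fun α => ‖hermiteCoeff f α‖ ^ 2 := by
  simp_rw [← fun α => inner_hermiteLp_toLp α hf]
  exact orthonormal_hermiteLp.inner_products_summable _

theorem norm_toLp_sq {f : EuclideanSpace ℝ (Fin d) → ℂ} (hf : MemLp f 2) :
    ‖hf.toLp f‖ ^ 2 = ∫ x, ‖f x‖ ^ 2 := by
  have h := inner_self_eq_norm_sq_to_K (𝕜 := ℂ) (hf.toLp f)
  rw [L2.inner_def] at h
  have e : (fun a => inner ℂ ((hf.toLp f : EuclideanSpace ℝ (Fin d) → ℂ) a)
      ((hf.toLp f : EuclideanSpace ℝ (Fin d) → ℂ) a)) =ᵐ[volume]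
      fun x => ((‖f x‖ ^ 2 : ℝ) : ℂ) := by
    filter_upwards [hf.coeFn_toLp] with x h2
    rw [h2, inner_self_eq_norm_sq_to_K]
    norm_cast
  rw [integral_congr_ae e, integral_complex_ofReal] at h
  exact Complex.ofReal_injective (by simpa using h.symm)

theorem tsum_norm_hermiteCoeff_sq_le {f : EuclideanSpace ℝ (Fin d) → ℂ} (hf : MemLp f 2) :
    ∑' α, ‖hermiteCoeff f α‖ ^ 2 ≤ ∫ x, ‖f x‖ ^ 2 := by
  simp_rw [← fun α => inner_hermiteLp_toLp α hf]
  rw [← norm_toLp_sq hf]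
  exact orthonormal_hermiteLp.tsum_inner_products_le _

theorem hasSum_mehler_pi {r : ℂ} (hr : ‖r‖ < 1) (x y : EuclideanSpace ℝ (Fin d)) :
    HasSum (fun α : Fin d → ℕ => r ^ (∑ i, α i) * ((hermitePhi α x * hermitePhi α y : ℝ) : ℂ))
      (∏ i, mehlerKernel r (x i) (y i)) := by
  refine (hasSum_prod_pi fun i => hasSum_mehler hr (x i) (y i)).of_eq (fun α => ?_) rfl
  rw [Finset.prod_mul_distrib, Finset.prod_pow_eq_pow_sum, ← Complex.ofReal_prod,
    Finset.prod_mul_distrib]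
  rfl

theorem norm_prod_mehlerKernel_le {r : ℂ} (hr : ‖r‖ < 1) (x y : EuclideanSpace ℝ (Fin d)) :
    ‖∏ i, mehlerKernel r (x i) (y i)‖ ≤ (Real.pi * ‖1 - r ^ 2‖) ^ (-(d / 2) : ℝ) := by
  rw [norm_prod]
  calc _ ≤ ∏ _i : Fin d, (Real.pi * ‖1 - r ^ 2‖) ^ (-(1 / 2) : ℝ) :=
        Finset.prod_le_prod (fun _ _ => norm_nonneg _) fun i _ => norm_mehlerKernel_le hr _ _
    _ = _ := by
        rw [Finset.prod_const, Finset.card_univ, Fintype.card_fin, ← Real.rpow_natCast,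
          ← Real.rpow_mul (by positivity)]
        congr 1; ring

theorem summable_pow_sum {q : ℝ} (hq0 : 0 ≤ q) (hq : q < 1) :
    Summable fun α : Fin d → ℕ => q ^ (∑ i, α i) := by
  have h : HasSum (fun n : ℕ => (q : ℂ) ^ n) (1 - (q : ℂ))⁻¹ :=
    hasSum_geometric_of_norm_lt_one (by rwa [Complex.norm_real, Real.norm_of_nonneg hq0])
  have h2 := (hasSum_prod_pi (d := d) fun _ => h).summable
  simp_rw [Finset.prod_pow_eq_pow_sum] at h2
  exact_mod_cast h2

/-- `f` is a measurable function dominated by the indicator function of a set of finite measure. -/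
structure DominatedBySet (f : EuclideanSpace ℝ (Fin d) → ℂ) (A : Set (EuclideanSpace ℝ (Fin d))) :
    Prop where
  measurable : Measurable f
  measurableSet : MeasurableSet A
  volume_ne_top : volume A ≠ ∞
  norm_le : ∀ x, ‖f x‖ ≤ A.indicator 1 x

namespace DominatedBySet

variable {f g : EuclideanSpace ℝ (Fin d) → ℂ} {A B : Set (EuclideanSpace ℝ (Fin d))}

theorem integrable_indicator (hf : DominatedBySet f A) :
    Integrable (A.indicator (1 : EuclideanSpace ℝ (Fin d) → ℝ)) :=
  (integrable_indicator_iff hf.measurableSet).2 (integrableOn_const hf.volume_ne_top)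

theorem integrable (hf : DominatedBySet f A) : Integrable f :=
  hf.integrable_indicator.mono' hf.measurable.aestronglyMeasurable
    (Filter.Eventually.of_forall hf.norm_le)

theorem norm_le_one (hf : DominatedBySet f A) (x : EuclideanSpace ℝ (Fin d)) : ‖f x‖ ≤ 1 :=
  (hf.norm_le x).trans (indicator_le_self' (fun _ _ => zero_le_one) x)

theorem memLp (hf : DominatedBySet f A) {p : ℝ≥0∞} (hp : 1 ≤ p) : MemLp f p :=
  memLp_of_integrable_of_bounded hf.integrable hf.norm_le_one hp

theorem integral_norm_le (hf : DominatedBySet f A) : ∫ x, ‖f x‖ ≤ volume.real A := by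
  rw [← integral_indicator_one hf.measurableSet]
  exact integral_mono hf.integrable.norm hf.integrable_indicator hf.norm_le

theorem integral_norm_sq_le (hf : DominatedBySet f A) : ∫ x, ‖f x‖ ^ 2 ≤ volume.real A := by
  refine le_trans (integral_mono ((memLp_two_iff_integrable_sq_norm
    hf.measurable.aestronglyMeasurable).1 (hf.memLp (by norm_num))) hf.integrable.norm
    fun x => ?_) hf.integral_norm_le
  have h := hf.norm_le_one x
  dsimp only
  nlinarith [norm_nonneg (f x)]

theorem tsum_norm_hermiteCoeff_sq_le (hf : DominatedBySet f A) :
    ∑' α, ‖hermiteCoeff f α‖ ^ 2 ≤ volume.real A :=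
  (_root_.tsum_norm_hermiteCoeff_sq_le (hf.memLp (by norm_num))).trans hf.integral_norm_sq_le

theorem summable_norm_hermiteCoeff_sq (hf : DominatedBySet f A) :
    Summable fun α => ‖hermiteCoeff f α‖ ^ 2 :=
  _root_.summable_norm_hermiteCoeff_sq (hf.memLp (by norm_num))

theorem integrable_mul_hermitePhi (hf : DominatedBySet f A) (α : Fin d → ℕ) :
    Integrable fun x => f x * (hermitePhi α x : ℂ) :=
  (integrable_hermitePhi α).ofReal.bdd_mul (c := 1) hf.measurable.aestronglyMeasurable
    (Filter.Eventually.of_forall hf.norm_le_one)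

/-- Pointwise |fΦ_α| ≤ 1_A + Φ_α², which gives a bound independent of α; this justifies exchanging
the Mehler series with the integral against f ⊗ g. -/
theorem integral_norm_mul_hermitePhi_le (hf : DominatedBySet f A) (α : Fin d → ℕ) :
    ∫ x, ‖f x * (hermitePhi α x : ℂ)‖ ≤ volume.real A + 1 := by
  have h2 : Integrable fun x => hermitePhi α x * hermitePhi α x := by
    by_contra h
    have := integral_hermitePhi_mul α α
    rw [integral_undef h, if_pos rfl] at this
    norm_num at this
  calc ∫ x, ‖f x * (hermitePhi α x : ℂ)‖ ≤
      ∫ x, (A.indicator 1 x + hermitePhi α x * hermitePhi α x) := by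
        refine integral_mono (hf.integrable_mul_hermitePhi α).norm
          (hf.integrable_indicator.add h2) fun x => ?_
        dsimp only
        rw [norm_mul, Complex.norm_real, Real.norm_eq_abs, ← abs_mul_abs_self (hermitePhi α x)]
        have h1 := hf.norm_le x
        have h3 := hf.norm_le_one x
        nlinarith [norm_nonneg (f x), sq_nonneg (‖f x‖ - |hermitePhi α x|),
          abs_nonneg (hermitePhi α x)]
    _ = volume.real A + 1 := by
        rw [integral_add hf.integrable_indicator h2, integral_indicator_one hf.measurableSet,
          integral_hermitePhi_mul, if_pos rfl]

/-- The left side is the Mehler kernel integrated against f ⊗ g, so the sup bound of the kernel acts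
as an L¹ → L^∞ estimate. The pairing is bilinear, without conjugation. -/
theorem norm_tsum_pow_mul_hermiteCoeff_le (hf : DominatedBySet f A) (hg : DominatedBySet g B)
    {r : ℂ} (hr : ‖r‖ < 1) :
    ‖∑' α, r ^ (∑ i, α i) * (hermiteCoeff f α * hermiteCoeff g α)‖ ≤
      (Real.pi * ‖1 - r ^ 2‖) ^ (-(d / 2) : ℝ) * (volume.real A * volume.real B) := by
  set F : (Fin d → ℕ) → EuclideanSpace ℝ (Fin d) × EuclideanSpace ℝ (Fin d) → ℂ := fun α z =>
    r ^ (∑ i, α i) * ((f z.1 * (hermitePhi α z.1 : ℂ)) * (g z.2 * (hermitePhi α z.2 : ℂ))) with hF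
  have hFi : ∀ α, Integrable (F α) (volume.prod volume) := fun α =>
    ((hf.integrable_mul_hermitePhi α).mul_prod (hg.integrable_mul_hermitePhi α)).const_mul _
  have hFn : ∀ α, ∫ z, ‖F α z‖ ∂(volume.prod volume) ≤
      (volume.real A + 1) * (volume.real B + 1) * ‖r‖ ^ (∑ i, α i) := by
    intro α
    have : ∀ z, ‖F α z‖ = ‖r‖ ^ (∑ i, α i) * (‖f z.1 * (hermitePhi α z.1 : ℂ)‖ *
      ‖g z.2 * (hermitePhi α z.2 : ℂ)‖) := fun z => by
        simp only [hF]; rw [norm_mul, norm_mul, norm_pow]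
    simp_rw [this]
    rw [integral_const_mul, integral_prod_mul (fun x => ‖f x * (hermitePhi α x : ℂ)‖)
      (fun x => ‖g x * (hermitePhi α x : ℂ)‖), mul_comm]
    have h1 := hf.integral_norm_mul_hermitePhi_le α
    have h2 := hg.integral_norm_mul_hermitePhi_le α
    have h3 : 0 ≤ ∫ x, ‖g x * (hermitePhi α x : ℂ)‖ := integral_nonneg fun x => norm_nonneg _
    gcongr
  have hs : Summable fun α => ∫ z, ‖F α z‖ ∂(volume.prod volume) :=
    Summable.of_nonneg_of_le (fun α => integral_nonneg fun z => norm_nonneg _) hFn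
      ((summable_pow_sum (norm_nonneg r) hr).mul_left _)
  have h := hasSum_integral_of_summable_integral_norm hFi hs
  have hterm : ∀ α, ∫ z, F α z ∂(volume.prod volume) =
      r ^ (∑ i, α i) * (hermiteCoeff f α * hermiteCoeff g α) := by
    intro α
    simp only [hF]
    rw [integral_const_mul, integral_prod_mul (fun x => f x * (hermitePhi α x : ℂ))
      (fun x => g x * (hermitePhi α x : ℂ))]
    rfl
  simp_rw [hterm] at h
  rw [h.tsum_eq]
  have hpt : ∀ z, ∑' α, F α z = (∏ i, mehlerKernel r (z.1 i) (z.2 i)) * (f z.1 * g z.2) := by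
    intro z
    refine HasSum.tsum_eq (((hasSum_mehler_pi hr z.1 z.2).mul_right _).of_eq (fun α => ?_) rfl)
    simp only [hF]; push_cast; ring
  simp_rw [hpt]
  refine (norm_integral_le_of_norm_le (g := fun z => (Real.pi * ‖1 - r ^ 2‖) ^ (-(d / 2) : ℝ) *
    (‖f z.1‖ * ‖g z.2‖)) ((hf.integrable.norm.mul_prod hg.integrable.norm).const_mul _)
    (Filter.Eventually.of_forall fun z => ?_)).trans ?_
  · rw [norm_mul, norm_mul]
    gcongr
    exact norm_prod_mehlerKernel_le hr _ _
  · rw [integral_const_mul, integral_prod_mul (fun x => ‖f x‖) (fun x => ‖g x‖)]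
    have h1 := hf.integral_norm_le
    have h2 := hg.integral_norm_le
    have h3 : 0 ≤ ∫ x, ‖g x‖ := integral_nonneg fun x => norm_nonneg _
    gcongr

end DominatedBySet

end HermitePhi

/-! ### Trigonometric series on a period: radial limits and integrals away from the zeros of sin -/

section TrigSeries

variable {ι : Type*} {N : ι → ℕ} {w : ι → ℂ}

/-- The trigonometric series `∑ w_α e^{i N_α θ}`. -/
noncomputable def trigSeries (N : ι → ℕ) (w : ι → ℂ) (θ : ℝ) : ℂ :=
  ∑' α, w α * Complex.exp (N α * θ * Complex.I)

theorem norm_cexp_natCast_mul_mul_I (n : ℕ) (θ : ℝ) : ‖Complex.exp (n * θ * Complex.I)‖ = 1 := by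
  have := Complex.norm_exp_ofReal_mul_I (n * θ)
  push_cast at this
  exact this

theorem norm_trigSeries_term (α : ι) (θ : ℝ) :
    ‖w α * Complex.exp (N α * θ * Complex.I)‖ = ‖w α‖ := by
  rw [norm_mul, norm_cexp_natCast_mul_mul_I, mul_one]

theorem continuous_trigSeries (hw : Summable fun α => ‖w α‖) : Continuous (trigSeries N w) :=
  continuous_tsum (fun α => by fun_prop) hw fun α θ => (norm_trigSeries_term α θ).le

theorem norm_trigSeries_le (hw : Summable fun α => ‖w α‖) (θ : ℝ) :
    ‖trigSeries N w θ‖ ≤ ∑' α, ‖w α‖ := by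
  refine (norm_tsum_le_tsum_norm ?_).trans ?_ <;> simp_rw [norm_trigSeries_term]
  · exact hw
  · exact le_rfl

theorem periodic_trigSeries : Function.Periodic (trigSeries N w) (2 * Real.pi) := by
  intro θ
  refine tsum_congr fun α => ?_
  congr 1
  refine Complex.exp_eq_exp_iff_exists_int.2 ⟨N α, ?_⟩
  push_cast; ring

/-- Abel summation: bounds inside the unit disc pass to the unit circle. -/
theorem norm_trigSeries_le_of_disc (hw : Summable fun α => ‖w α‖) {s M : ℝ}
    (h : ∀ r : ℂ, ‖r‖ < 1 → ‖∑' α, r ^ N α * w α‖ ≤ (Real.pi * ‖1 - r ^ 2‖) ^ (-s) * M)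
    {θ : ℝ} (hθ : Real.sin θ ≠ 0) :
    ‖trigSeries N w θ‖ ≤ (2 * Real.pi * |Real.sin θ|) ^ (-s) * M := by
  set e := Complex.exp (θ * Complex.I) with he
  have hen : ‖e‖ = 1 := Complex.norm_exp_ofReal_mul_I θ
  have hF : Filter.Tendsto (fun ρ : ℝ => ∑' α, ((ρ : ℂ) * e) ^ N α * w α) (nhdsWithin 1 (Ioo 0 1))
      (nhds (trigSeries N w θ)) := by
    refine tendsto_tsum_of_dominated_convergence (bound := fun α => ‖w α‖) hw (fun α => ?_) ?_
    · have hc : Continuous fun ρ : ℝ => ((ρ : ℂ) * e) ^ N α * w α := by fun_prop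
      have := (hc.tendsto 1).mono_left (nhdsWithin_le_nhds (s := Ioo 0 1))
      convert this using 2
      rw [Complex.ofReal_one, one_mul, he, ← Complex.exp_nat_mul, mul_comm, ← mul_assoc]
    · filter_upwards [self_mem_nhdsWithin] with ρ hρ α
      rw [norm_mul, norm_pow, norm_mul, hen, mul_one, Complex.norm_real,
        Real.norm_of_nonneg hρ.1.le]
      exact mul_le_of_le_one_left (norm_nonneg _) (pow_le_one₀ hρ.1.le hρ.2.le)
  -- |1 - e^{2iθ}| = 2|sin θ|: the only singularities on the circle are the zeros of sin.
  have hsin : ‖1 - e ^ 2‖ = 2 * |Real.sin θ| := by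
    have h2 := Complex.norm_exp_I_mul_ofReal_sub_one (2 * θ)
    rw [norm_sub_rev, he, ← Complex.exp_nat_mul]
    convert h2 using 1
    · congr 2; push_cast; congr 1; ring
    · rw [mul_div_cancel_left₀ _ (by norm_num), norm_mul, Real.norm_eq_abs, Real.norm_eq_abs]
      simp
  have hpos : 0 < 2 * |Real.sin θ| := by positivity
  have hG : Filter.Tendsto (fun ρ : ℝ => (Real.pi * ‖1 - ((ρ : ℂ) * e) ^ 2‖) ^ (-s) * M)
      (nhdsWithin 1 (Ioo 0 1)) (nhds ((2 * Real.pi * |Real.sin θ|) ^ (-s) * M)) := by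
    have hc : ContinuousAt (fun ρ : ℝ => (Real.pi * ‖1 - ((ρ : ℂ) * e) ^ 2‖) ^ (-s) * M) 1 := by
      refine ContinuousAt.mul (ContinuousAt.rpow_const (by fun_prop) (Or.inl ?_)) continuousAt_const
      rw [Complex.ofReal_one, one_mul, hsin]
      have := Real.pi_pos
      positivity
    have := hc.tendsto.mono_left (nhdsWithin_le_nhds (s := Ioo 0 1))
    rw [Complex.ofReal_one, one_mul, hsin] at this
    convert this using 3
    ring_nf
  have : (nhdsWithin (1 : ℝ) (Ioo 0 1)).NeBot := by
    rw [← mem_closure_iff_nhdsWithin_neBot, closure_Ioo (by norm_num)]; simp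
  refine le_of_tendsto_of_tendsto hF.norm hG ?_
  filter_upwards [self_mem_nhdsWithin] with ρ hρ
  refine h _ ?_
  rw [norm_mul, hen, mul_one, Complex.norm_real, Real.norm_of_nonneg hρ.1.le]
  exact hρ.2

/-- Jordan's inequality at the nearest zero of sin. The closed period [-π, π] contains three zeros,
both endpoints being counted. -/
theorem exists_abs_sin_ge {θ : ℝ} (hθ : θ ∈ Icc (-Real.pi) Real.pi) :
    2 / Real.pi * |θ - 0| ≤ |Real.sin θ| ∨ 2 / Real.pi * |θ - Real.pi| ≤ |Real.sin θ| ∨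
      2 / Real.pi * |θ - -Real.pi| ≤ |Real.sin θ| := by
  have hp := Real.pi_pos
  rcases le_total |θ| (Real.pi / 2) with h | h
  · left; rw [sub_zero]; exact Real.mul_abs_le_abs_sin h
  · right
    rcases le_abs.1 h with h1 | h1
    · left
      have := Real.mul_abs_le_abs_sin (x := θ - Real.pi) (by rw [abs_le]; constructor <;> linarith [hθ.2])
      rwa [Real.sin_sub_pi, abs_neg] at this
    · right
      have := Real.mul_abs_le_abs_sin (x := θ + Real.pi) (by rw [abs_le]; constructor <;> linarith [hθ.1])
      rwa [Real.sin_add_pi, abs_neg, ← sub_neg_eq_add] at this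

theorem abs_sin_le_abs_sub (θ : ℝ) : |Real.sin θ| ≤ |θ - 0| ∧ |Real.sin θ| ≤ |θ - Real.pi| ∧
    |Real.sin θ| ≤ |θ - -Real.pi| := by
  refine ⟨by rw [sub_zero]; exact Real.abs_sin_le_abs, ?_, ?_⟩
  · have := Real.abs_sin_le_abs (x := θ - Real.pi)
    rwa [Real.sin_sub_pi, abs_neg] at this
  · have := Real.abs_sin_le_abs (x := θ + Real.pi)
    rwa [Real.sin_add_pi, abs_neg, ← sub_neg_eq_add] at this

/-- The points of a period at which `|sin|` is at most `δ`. -/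
def sinLe (δ : ℝ) : Set ℝ := Ioc (-Real.pi) Real.pi ∩ {θ | |Real.sin θ| ≤ δ}

/-- The points of a period at which `|sin|` exceeds `δ`. -/
def sinGt (δ : ℝ) : Set ℝ := Ioc (-Real.pi) Real.pi ∩ {θ | δ < |Real.sin θ|}

theorem measurableSet_sinLe (δ : ℝ) : MeasurableSet (sinLe δ) :=
  measurableSet_Ioc.inter (measurableSet_le (by fun_prop) measurable_const)

theorem measurableSet_sinGt (δ : ℝ) : MeasurableSet (sinGt δ) :=
  measurableSet_Ioc.inter (measurableSet_lt measurable_const (by fun_prop))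

theorem volume_sinLe_ne_top (δ : ℝ) : volume (sinLe δ) ≠ ∞ :=
  ((measure_mono inter_subset_left).trans_lt measure_Ioc_lt_top).ne

theorem volume_sinLe_le {δ : ℝ} (hδ : 0 ≤ δ) : volume.real (sinLe δ) ≤ 3 * Real.pi * δ := by
  have hp := Real.pi_pos
  have hsub : sinLe δ ⊆ Metric.closedBall 0 (Real.pi / 2 * δ) ∪
      (Metric.closedBall Real.pi (Real.pi / 2 * δ) ∪ Metric.closedBall (-Real.pi) (Real.pi / 2 * δ)) := by
    rintro θ ⟨h1, h2⟩
    have aux : ∀ t : ℝ, 2 / Real.pi * t ≤ |Real.sin θ| → t ≤ Real.pi / 2 * δ := by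
      intro t ht
      have h3 : 2 / Real.pi * t ≤ δ := ht.trans h2
      calc t = Real.pi / 2 * (2 / Real.pi * t) := by field_simp
        _ ≤ _ := by gcongr
    rcases exists_abs_sin_ge ⟨h1.1.le, h1.2⟩ with h | h | h
    · exact Or.inl (by rw [Metric.mem_closedBall, Real.dist_eq]; exact aux _ h)
    · exact Or.inr (Or.inl (by rw [Metric.mem_closedBall, Real.dist_eq]; exact aux _ h))
    · exact Or.inr (Or.inr (by rw [Metric.mem_closedBall, Real.dist_eq]; exact aux _ h))
  have hb : ∀ c : ℝ, volume (Metric.closedBall c (Real.pi / 2 * δ)) = ENNReal.ofReal (Real.pi * δ) := by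
    intro c; rw [Real.volume_closedBall]; congr 1; ring
  have h := (measure_mono (μ := volume) hsub).trans ((measure_union_le _ _).trans
    (add_le_add le_rfl (measure_union_le _ _)))
  rw [hb, hb, hb, ← ENNReal.ofReal_add (by positivity) (by positivity),
    ← ENNReal.ofReal_add (by positivity) (by positivity)] at h
  refine (ENNReal.toReal_mono ENNReal.ofReal_ne_top h).trans ?_
  rw [ENNReal.toReal_ofReal (by positivity)]
  linarith

/-- The constant in `setIntegral_sinGt_le`. -/
noncomputable def sinConst (s : ℝ) : ℝ :=
  (2 * Real.pi) ^ (-s) * (Real.pi / 2) ^ s * (6 / (s - 1))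

theorem sinConst_nonneg {s : ℝ} (hs : 1 < s) : 0 ≤ sinConst s := by
  have := Real.pi_pos
  have h1 : 0 < s - 1 := by linarith
  unfold sinConst
  positivity

/-- Near the closest zero c, |sin θ| is comparable to |θ - c|, and |θ - c| > δ on the domain. The
integrand is thus dominated by tails of t^(-s) over six half-lines, two for each of the three zeros;
they converge because s > 1 and give the factor 6/(s - 1). -/
theorem setIntegral_sinGt_le {s M δ : ℝ} (hs : 1 < s) (hM : 0 ≤ M) (hδ : 0 < δ) {f : ℝ → ℂ}
    (hf : Continuous f)
    (h : ∀ θ, Real.sin θ ≠ 0 → ‖f θ‖ ≤ (2 * Real.pi * |Real.sin θ|) ^ (-s) * M) :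
    ∫ θ in sinGt δ, ‖f θ‖ ≤ sinConst s * M * δ ^ (1 - s) := by
  have hp := Real.pi_pos
  set g : ℝ → ℝ := (Ioi δ).indicator fun t => t ^ (-s) with hg
  have hgi : Integrable g := by
    rw [hg, integrable_indicator_iff measurableSet_Ioi]
    exact integrableOn_Ioi_rpow_of_lt (by linarith) hδ
  have hgI : ∫ t, g t = δ ^ (1 - s) / (s - 1) := by
    rw [hg, integral_indicator measurableSet_Ioi, integral_Ioi_rpow_of_lt (by linarith) hδ,
      neg_div, ← div_neg]
    ring_nf
  have hg0 : ∀ t, 0 ≤ g t := fun t => indicator_nonneg (fun x hx =>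
    Real.rpow_nonneg (hδ.trans (mem_Ioi.1 hx)).le _) t
  have hgabs : ∀ t, δ < |t| → g t + g (-t) = |t| ^ (-s) := by
    intro t ht
    rcases lt_abs.1 ht with h1 | h1
    · rw [hg, indicator_of_mem (mem_Ioi.2 h1), indicator_of_notMem (by
        rw [mem_Ioi]; linarith), add_zero, abs_of_pos (hδ.trans h1)]
    · rw [hg, indicator_of_notMem (by rw [mem_Ioi]; linarith), indicator_of_mem (mem_Ioi.2 h1),
        zero_add, abs_of_neg (by linarith)]
  set G : ℝ → ℝ := fun θ => (g (θ - 0) + g (0 - θ)) + ((g (θ - Real.pi) + g (Real.pi - θ)) +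
    (g (θ - -Real.pi) + g (-Real.pi - θ))) with hG
  have hGi : Integrable G :=
    ((hgi.comp_sub_right 0).add (hgi.comp_sub_left 0)).add
      (((hgi.comp_sub_right Real.pi).add (hgi.comp_sub_left Real.pi)).add
      ((hgi.comp_sub_right (-Real.pi)).add (hgi.comp_sub_left (-Real.pi))))
  have hGI : ∫ θ, G θ = 6 * (δ ^ (1 - s) / (s - 1)) := by
    have e : ∀ c : ℝ, ∫ θ, (g (θ - c) + g (c - θ)) = 2 * (δ ^ (1 - s) / (s - 1)) := by
      intro c
      rw [integral_add (hgi.comp_sub_right c) (hgi.comp_sub_left c), integral_sub_right_eq_self,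
        integral_sub_left_eq_self, hgI]
      ring
    have i : ∀ c : ℝ, Integrable fun θ => g (θ - c) + g (c - θ) := fun c =>
      (hgi.comp_sub_right c).add (hgi.comp_sub_left c)
    calc ∫ θ, G θ = (∫ θ, (g (θ - 0) + g (0 - θ))) + ∫ θ, ((g (θ - Real.pi) + g (Real.pi - θ)) +
          (g (θ - -Real.pi) + g (-Real.pi - θ))) :=
          integral_add (i 0) ((i Real.pi).add (i (-Real.pi)))
      _ = 6 * (δ ^ (1 - s) / (s - 1)) := by
          rw [integral_add (i Real.pi) (i (-Real.pi)), e, e, e]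
          ring
  have hG0 : ∀ θ, 0 ≤ G θ := fun θ => by
    have := fun t => hg0 t
    simp only [hG]
    have h1 := hg0 (θ - 0); have h2 := hg0 (0 - θ); have h3 := hg0 (θ - Real.pi)
    have h4 := hg0 (Real.pi - θ); have h5 := hg0 (θ - -Real.pi); have h6 := hg0 (-Real.pi - θ)
    positivity
  have hle : ∀ θ ∈ sinGt δ, ‖f θ‖ ≤ (2 * Real.pi) ^ (-s) * (Real.pi / 2) ^ s * M * G θ := by
    rintro θ ⟨hθ, hθs⟩
    have hsp : 0 < |Real.sin θ| := hδ.trans hθs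
    have hub := abs_sin_le_abs_sub θ
    have aux : ∀ c : ℝ, δ < |θ - c| → 2 / Real.pi * |θ - c| ≤ |Real.sin θ| →
        |Real.sin θ| ^ (-s) ≤ (Real.pi / 2) ^ s * (g (θ - c) + g (c - θ)) := by
      intro c hc1 hc2
      have h1 := hgabs _ hc1
      rw [neg_sub] at h1
      rw [h1]
      calc |Real.sin θ| ^ (-s) ≤ (2 / Real.pi * |θ - c|) ^ (-s) :=
            Real.rpow_le_rpow_of_nonpos (by have := hδ.trans hc1; positivity) hc2 (by linarith)
        _ = _ := by
            rw [Real.mul_rpow (by positivity) (abs_nonneg _), Real.rpow_neg (by positivity),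
              ← Real.inv_rpow (by positivity), inv_div]
    have hG' : |Real.sin θ| ^ (-s) ≤ (Real.pi / 2) ^ s * G θ := by
      have h1 := hg0 (θ - 0); have h2 := hg0 (0 - θ); have h3 := hg0 (θ - Real.pi)
      have h4 := hg0 (Real.pi - θ); have h5 := hg0 (θ - -Real.pi); have h6 := hg0 (-Real.pi - θ)
      rcases exists_abs_sin_ge ⟨hθ.1.le, hθ.2⟩ with h | h | h
      · refine (aux 0 (lt_of_lt_of_le hθs hub.1) h).trans ?_
        gcongr; simp only [hG]; linarith
      · refine (aux Real.pi (lt_of_lt_of_le hθs hub.2.1) h).trans ?_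
        gcongr; simp only [hG]; linarith
      · refine (aux (-Real.pi) (lt_of_lt_of_le hθs hub.2.2) h).trans ?_
        gcongr; simp only [hG]; linarith
    refine (h θ (abs_pos.1 hsp)).trans ?_
    rw [Real.mul_rpow (by positivity) (abs_nonneg _)]
    calc (2 * Real.pi) ^ (-s) * |Real.sin θ| ^ (-s) * M ≤
        (2 * Real.pi) ^ (-s) * ((Real.pi / 2) ^ s * G θ) * M := by gcongr
      _ = _ := by ring
  calc ∫ θ in sinGt δ, ‖f θ‖ ≤ ∫ θ in sinGt δ, (2 * Real.pi) ^ (-s) * (Real.pi / 2) ^ s * M * G θ := by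
        refine setIntegral_mono_on ?_ (hGi.const_mul _).integrableOn (measurableSet_sinGt δ) hle
        exact (hf.norm.integrableOn_Ioc (a := -Real.pi) (b := Real.pi)).mono_set inter_subset_left
    _ ≤ ∫ θ, (2 * Real.pi) ^ (-s) * (Real.pi / 2) ^ s * M * G θ :=
        setIntegral_le_integral (hGi.const_mul _) (Filter.Eventually.of_forall fun θ => by
          have := hG0 θ
          simp only [Pi.zero_apply]
          positivity)
    _ = _ := by
        rw [integral_const_mul, hGI, sinConst]; ring

theorem sinLe_union_sinGt (δ : ℝ) : sinLe δ ∪ sinGt δ = Ioc (-Real.pi) Real.pi := by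
  rw [sinLe, sinGt, ← inter_union_distrib_left]
  refine inter_eq_left.2 fun θ _ => ?_
  rcases le_or_gt |Real.sin θ| δ with h | h
  · exact Or.inl h
  · exact Or.inr h

theorem disjoint_sinLe_sinGt (δ : ℝ) : Disjoint (sinLe δ) (sinGt δ) := by
  rw [Set.disjoint_left]
  rintro θ ⟨_, h1⟩ ⟨_, h2⟩
  exact absurd (show |Real.sin θ| ≤ δ from h1) (not_le.2 h2)

end TrigSeries

/-! ### Fourier coefficients of a window and L² smoothing -/

section TrigSeries

variable {ι : Type*} {N : ι → ℕ} {w u v : ι → ℂ}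

/-- The Fourier coefficient of the indicator function of `S` at the frequency `n - k`. -/
noncomputable def windowCoeff (S : Set ℝ) (k n : ℕ) : ℂ :=
  ∫ θ in S, Complex.exp (-(k * θ * Complex.I)) * Complex.exp (n * θ * Complex.I)

theorem norm_cexp_neg_natCast_mul_mul_I (n : ℕ) (θ : ℝ) : ‖Complex.exp (-(n * θ * Complex.I))‖ = 1 := by
  rw [Complex.exp_neg, norm_inv, norm_cexp_natCast_mul_mul_I, inv_one]

theorem hasSum_setIntegral_trigSeries [Countable ι] (hw : Summable fun α => ‖w α‖) {S : Set ℝ}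
    (hS : volume S ≠ ∞) (k : ℕ) :
    HasSum (fun α => w α * windowCoeff S k (N α))
      (∫ θ in S, Complex.exp (-(k * θ * Complex.I)) * trigSeries N w θ) := by
  have : IsFiniteMeasure (volume.restrict S) := ⟨by
    rw [Measure.restrict_apply_univ]; exact lt_top_iff_ne_top.2 hS⟩
  have hn : ∀ α (θ : ℝ), ‖Complex.exp (-(k * θ * Complex.I)) *
      (w α * Complex.exp (N α * θ * Complex.I))‖ = ‖w α‖ := fun α θ => by
    rw [norm_mul, norm_cexp_neg_natCast_mul_mul_I, one_mul, norm_trigSeries_term]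
  have h := hasSum_integral_of_summable_integral_norm (μ := volume.restrict S)
    (F := fun α (θ : ℝ) => Complex.exp (-(k * θ * Complex.I)) *
      (w α * Complex.exp (N α * θ * Complex.I)))
    (fun α => Integrable.of_bound (C := ‖w α‖) (by fun_prop)
      (Filter.Eventually.of_forall fun θ => (hn α θ).le))
    (by simp_rw [hn, integral_const]; exact hw.const_smul _)
  refine h.of_eq (fun α => ?_) ?_
  · rw [windowCoeff, ← integral_const_mul]
    congr 1; ext θ; ring
  · congr 1; ext θ; rw [trigSeries, tsum_mul_left]

theorem windowCoeff_period (k n : ℕ) :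
    windowCoeff (Ioc (-Real.pi) Real.pi) k n = if n = k then 2 * (Real.pi : ℂ) else 0 := by
  have hp := Real.pi_pos
  rw [windowCoeff, ← intervalIntegral.integral_of_le (by linarith)]
  split_ifs with h
  · subst h
    have : ∀ θ : ℝ, Complex.exp (-(n * θ * Complex.I)) * Complex.exp (n * θ * Complex.I) = 1 := by
      intro θ; rw [← Complex.exp_add, neg_add_cancel, Complex.exp_zero]
    simp_rw [this]
    rw [intervalIntegral.integral_const]
    simp only [Complex.real_smul]
    push_cast; ring
  · have hc : ((n : ℂ) - k) * Complex.I ≠ 0 :=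
      mul_ne_zero (sub_ne_zero.2 (by exact_mod_cast h)) Complex.I_ne_zero
    have : ∀ θ : ℝ, Complex.exp (-(k * θ * Complex.I)) * Complex.exp (n * θ * Complex.I) =
        Complex.exp (((n : ℂ) - k) * Complex.I * θ) := by
      intro θ; rw [← Complex.exp_add]; congr 1; ring
    simp_rw [this]
    rw [integral_exp_mul_complex hc, div_eq_zero_iff]
    left
    rw [sub_eq_zero]
    refine Complex.exp_eq_exp_iff_exists_int.2 ⟨(n : ℤ) - k, ?_⟩
    push_cast; ring

theorem two_pi_mul_tsum_eq [Countable ι] (hw : Summable fun α => ‖w α‖) (k : ℕ) :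
    ∑' α, (if N α = k then 2 * (Real.pi : ℂ) * w α else 0) =
      ∫ θ in Ioc (-Real.pi) Real.pi, Complex.exp (-(k * θ * Complex.I)) * trigSeries N w θ := by
  rw [← (hasSum_setIntegral_trigSeries hw measure_Ioc_lt_top.ne k).tsum_eq]
  refine tsum_congr fun α => ?_
  rw [windowCoeff_period]
  split_ifs <;> ring

/-- |∫_S e^{i(N-k)θ} dθ|² is a double integral over S × S of e^{i(N-k)(θ-t)}, so weighting by w and
summing reproduces the series evaluated at θ - t. -/
theorem hasSum_norm_windowCoeff_sq [Countable ι] (hw : Summable fun α => ‖w α‖) {S : Set ℝ}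
    (hS : volume S ≠ ∞) (k : ℕ) :
    HasSum (fun α => w α * ((‖windowCoeff S k (N α)‖ ^ 2 : ℝ) : ℂ))
      (∫ z, (Complex.exp (-(k * z.1 * Complex.I)) * Complex.exp (k * z.2 * Complex.I)) *
        trigSeries N w (z.1 - z.2) ∂(volume.restrict S).prod (volume.restrict S)) := by
  have : IsFiniteMeasure (volume.restrict S) := ⟨by
    rw [Measure.restrict_apply_univ]; exact lt_top_iff_ne_top.2 hS⟩
  set F : ι → ℝ × ℝ → ℂ := fun α z =>
    (Complex.exp (-(k * z.1 * Complex.I)) * Complex.exp (k * z.2 * Complex.I)) *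
      (w α * Complex.exp (N α * ((z.1 - z.2 : ℝ) : ℂ) * Complex.I)) with hF
  have hn : ∀ α z, ‖F α z‖ = ‖w α‖ := fun α z => by
    simp only [hF]
    rw [norm_mul, norm_mul, norm_cexp_neg_natCast_mul_mul_I, norm_cexp_natCast_mul_mul_I, one_mul,
      one_mul, norm_trigSeries_term]
  have h := hasSum_integral_of_summable_integral_norm
    (μ := (volume.restrict S).prod (volume.restrict S)) (F := F)
    (fun α => Integrable.of_bound (C := ‖w α‖) (by simp only [hF]; fun_prop)
      (Filter.Eventually.of_forall fun θ => (hn α θ).le))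
    (by simp_rw [hn, integral_const]; exact hw.const_smul _)
  refine h.of_eq (fun α => ?_) ?_
  · have e : ∀ z : ℝ × ℝ, F α z = w α * ((Complex.exp (-(k * z.1 * Complex.I)) *
        Complex.exp (N α * z.1 * Complex.I)) *
        (starRingEnd ℂ) (Complex.exp (-(k * z.2 * Complex.I)) *
          Complex.exp (N α * z.2 * Complex.I))) := by
      intro z
      simp only [hF, map_mul, ← Complex.exp_conj, map_neg, Complex.conj_ofReal, Complex.conj_I,
        Complex.conj_natCast]
      rw [mul_left_comm]
      congr 1
      simp only [← Complex.exp_add]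
      congr 1
      push_cast; ring
    simp_rw [e]
    rw [integral_const_mul, integral_prod_mul (fun θ : ℝ => Complex.exp (-(k * θ * Complex.I)) *
        Complex.exp (N α * θ * Complex.I)) (fun θ : ℝ => (starRingEnd ℂ)
        (Complex.exp (-(k * θ * Complex.I)) * Complex.exp (N α * θ * Complex.I))), integral_conj]
    congr 1
    rw [windowCoeff, Complex.mul_conj, Complex.normSq_eq_norm_sq]
  · congr 1; ext z; simp only [hF]; rw [trigSeries, tsum_mul_left]

/-- Enlarging S to the full period makes the translation by t invisible, by periodicity; the bound
is therefore uniform in t. -/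
theorem setIntegral_norm_trigSeries_sub_le (hw : Summable fun α => ‖w α‖) {S : Set ℝ}
    (hSsub : S ⊆ Ioc (-Real.pi) Real.pi) (t : ℝ) :
    ∫ θ in S, ‖trigSeries N w (θ - t)‖ ≤ ∫ θ in Ioc (-Real.pi) Real.pi, ‖trigSeries N w θ‖ := by
  have hp := Real.pi_pos
  have hc := (continuous_trigSeries (N := N) hw).norm
  have hct : Continuous fun θ => ‖trigSeries N w (θ - t)‖ := hc.comp (by fun_prop)
  have hper : Function.Periodic (fun θ => ‖trigSeries N w θ‖) (2 * Real.pi) := fun θ => by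
    dsimp only; rw [periodic_trigSeries]
  calc ∫ θ in S, ‖trigSeries N w (θ - t)‖ ≤ ∫ θ in Ioc (-Real.pi) Real.pi, ‖trigSeries N w (θ - t)‖ :=
        setIntegral_mono_set hct.integrableOn_Ioc (Filter.Eventually.of_forall fun θ => norm_nonneg _)
          (Filter.Eventually.of_forall hSsub)
    _ = ∫ θ in (-Real.pi)..Real.pi, ‖trigSeries N w (θ - t)‖ := by
        rw [intervalIntegral.integral_of_le (by linarith)]
    _ = ∫ θ in (-Real.pi - t)..(Real.pi - t), ‖trigSeries N w θ‖ :=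
        intervalIntegral.integral_comp_sub_right (fun θ => ‖trigSeries N w θ‖) t
    _ = ∫ θ in (-Real.pi)..Real.pi, ‖trigSeries N w θ‖ := by
        have := hper.intervalIntegral_add_eq (-Real.pi - t) (-Real.pi)
        convert this using 2 <;> ring
    _ = _ := by rw [intervalIntegral.integral_of_le (by linarith)]

/-- The `L²` smoothing estimate: the multiplier of a window `S` is controlled by the size of `S`
and the `L¹` norm of the trigonometric series. -/
theorem tsum_mul_norm_windowCoeff_sq_le [Countable ι] (hu : Summable fun α => ‖u α‖ ^ 2) {S : Set ℝ}
    (hSsub : S ⊆ Ioc (-Real.pi) Real.pi) (k : ℕ) :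
    Summable (fun α => ‖u α‖ ^ 2 * ‖windowCoeff S k (N α)‖ ^ 2) ∧
    ∑' α, ‖u α‖ ^ 2 * ‖windowCoeff S k (N α)‖ ^ 2 ≤
      volume.real S * ∫ θ in Ioc (-Real.pi) Real.pi,
        ‖trigSeries N (fun α => ((‖u α‖ ^ 2 : ℝ) : ℂ)) θ‖ := by
  have hS : volume S ≠ ∞ := ((measure_mono hSsub).trans_lt measure_Ioc_lt_top).ne
  have : IsFiniteMeasure (volume.restrict S) := ⟨by
    rw [Measure.restrict_apply_univ]; exact lt_top_iff_ne_top.2 hS⟩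
  set w : ι → ℂ := fun α => ((‖u α‖ ^ 2 : ℝ) : ℂ) with hwdef
  have hw : Summable fun α => ‖w α‖ := by
    simp only [hwdef, Complex.norm_real, Real.norm_eq_abs, abs_pow, abs_norm]; exact hu
  have h := hasSum_norm_windowCoeff_sq (N := N) hw hS k
  simp only [hwdef, ← Complex.ofReal_mul] at h
  have hc := (continuous_trigSeries (N := N) hw)
  have hs : Summable fun α => ‖u α‖ ^ 2 * ‖windowCoeff S k (N α)‖ ^ 2 := by
    exact_mod_cast h.summable
  refine ⟨hs, ?_⟩
  have hint : Integrable (fun z : ℝ × ℝ => ‖trigSeries N w (z.1 - z.2)‖)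
      ((volume.restrict S).prod (volume.restrict S)) :=
    Integrable.of_bound (C := ∑' α, ‖w α‖) (hc.norm.comp (by fun_prop)).aestronglyMeasurable
      (Filter.Eventually.of_forall fun z => by
        rw [norm_norm]; exact norm_trigSeries_le hw _)
  have h0 : 0 ≤ ∑' α, ‖u α‖ ^ 2 * ‖windowCoeff S k (N α)‖ ^ 2 :=
    tsum_nonneg fun α => by positivity
  calc ∑' α, ‖u α‖ ^ 2 * ‖windowCoeff S k (N α)‖ ^ 2 =
      ‖((∑' α, ‖u α‖ ^ 2 * ‖windowCoeff S k (N α)‖ ^ 2 : ℝ) : ℂ)‖ := by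
        rw [Complex.norm_real, Real.norm_of_nonneg h0]
    _ = ‖∫ z, (Complex.exp (-(k * z.1 * Complex.I)) * Complex.exp (k * z.2 * Complex.I)) *
        trigSeries N w (z.1 - z.2) ∂(volume.restrict S).prod (volume.restrict S)‖ := by
        rw [Complex.ofReal_tsum, h.tsum_eq]
    _ ≤ ∫ z, ‖trigSeries N w (z.1 - z.2)‖ ∂(volume.restrict S).prod (volume.restrict S) := by
        refine norm_integral_le_of_norm_le hint (Filter.Eventually.of_forall fun z => ?_)
        rw [norm_mul, norm_mul, norm_cexp_neg_natCast_mul_mul_I, norm_cexp_natCast_mul_mul_I,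
          one_mul, one_mul]
    _ = ∫ t in S, ∫ θ in S, ‖trigSeries N w (θ - t)‖ := integral_prod_symm _ hint
    _ ≤ ∫ _t in S, ∫ θ in Ioc (-Real.pi) Real.pi, ‖trigSeries N w θ‖ :=
        integral_mono hint.integral_prod_right (integrable_const _) fun t =>
          setIntegral_norm_trigSeries_sub_le hw hSsub t
    _ = _ := by rw [setIntegral_const, smul_eq_mul]

end TrigSeries

theorem tsum_mul_le_sqrt_mul_sqrt {ι : Type*} {x y : ι → ℝ} (hx0 : ∀ i, 0 ≤ x i) (hy0 : ∀ i, 0 ≤ y i)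
    (hx : Summable fun i => x i ^ 2) (hy : Summable fun i => y i ^ 2) :
    Summable (fun i => x i * y i) ∧
      ∑' i, x i * y i ≤ Real.sqrt (∑' i, x i ^ 2) * Real.sqrt (∑' i, y i ^ 2) := by
  have h := Real.inner_le_Lp_mul_Lq_tsum_of_nonneg Real.HolderConjugate.two_two hx0 hy0
    (by simpa using hx) (by simpa using hy)
  simp only [Real.rpow_ofNat] at h
  rw [Real.sqrt_eq_rpow, Real.sqrt_eq_rpow]
  refine ⟨Summable.of_nonneg_of_le (fun i => mul_nonneg (hx0 i) (hy0 i)) (fun i => ?_)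
    (hx.add hy), h⟩
  nlinarith [sq_nonneg (x i - y i), mul_nonneg (hx0 i) (hy0 i)]

/-! ### The restricted weak type estimate in sequence form -/

section TrigCore

variable {ι : Type*} {N : ι → ℕ} {u v : ι → ℂ}

/-- The series is bounded by a and by a constant multiple of a²|sin θ|^(-s). These cross at |sin θ|
of order a^(1/s), and each side of the cut contributes a · a^(1/s). -/
theorem setIntegral_period_norm_trigSeries_le {s a : ℝ} (hs : 1 < s) (ha : 0 < a)
    {w : ι → ℂ} (hw : Summable fun α => ‖w α‖) (hwa : ∑' α, ‖w α‖ ≤ a)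
    (hE : ∀ r : ℂ, ‖r‖ < 1 → ‖∑' α, r ^ N α * w α‖ ≤ (Real.pi * ‖1 - r ^ 2‖) ^ (-s) * (a * a)) :
    ∫ θ in Ioc (-Real.pi) Real.pi, ‖trigSeries N w θ‖ ≤
      (3 * Real.pi + sinConst s) * a ^ (1 + 1 / s) := by
  have hs0 : 0 < s := by linarith
  have hc := continuous_trigSeries (N := N) hw
  set δ := a ^ (1 / s) with hδ
  have hδ0 : 0 < δ := by positivity
  have hi : IntegrableOn (fun θ => ‖trigSeries N w θ‖) (Ioc (-Real.pi) Real.pi) :=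
    hc.norm.integrableOn_Ioc
  rw [← sinLe_union_sinGt δ, setIntegral_union (disjoint_sinLe_sinGt δ) (measurableSet_sinGt δ)
    (hi.mono_set inter_subset_left) (hi.mono_set inter_subset_left)]
  have h1 : ∫ θ in sinLe δ, ‖trigSeries N w θ‖ ≤ a * (3 * Real.pi * δ) := by
    calc ∫ θ in sinLe δ, ‖trigSeries N w θ‖ ≤ ∫ _θ in sinLe δ, a :=
          setIntegral_mono_on (hi.mono_set inter_subset_left)
            (integrableOn_const (volume_sinLe_ne_top δ)) (measurableSet_sinLe δ)
            fun θ _ => (norm_trigSeries_le hw θ).trans hwa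
      _ = volume.real (sinLe δ) * a := by rw [setIntegral_const, smul_eq_mul]
      _ ≤ _ := by rw [mul_comm]; gcongr; exact volume_sinLe_le hδ0.le
  have h2 := setIntegral_sinGt_le hs (by positivity : 0 ≤ a * a) hδ0 hc
    fun θ hθ => norm_trigSeries_le_of_disc hw hE hθ
  have e1 : a * δ = a ^ (1 + 1 / s) := by
    rw [hδ, Real.rpow_add ha, Real.rpow_one]
  have e2 : a * a * δ ^ (1 - s) = a ^ (1 + 1 / s) := by
    rw [hδ, ← Real.rpow_mul ha.le, ← sq, ← Real.rpow_natCast, ← Real.rpow_add ha]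
    congr 1
    field_simp
    push_cast; ring
  calc _ ≤ a * (3 * Real.pi * δ) + sinConst s * (a * a) * δ ^ (1 - s) := add_le_add h1 h2
    _ = 3 * Real.pi * (a * δ) + sinConst s * (a * a * δ ^ (1 - s)) := by ring
    _ = _ := by rw [e1, e2]; ring

/-- The constant in `norm_tsum_ite_le`. -/
noncomputable def restrictedConst (s : ℝ) : ℝ :=
  Real.sqrt (3 * Real.pi * (3 * Real.pi + sinConst s)) + sinConst s

/-- The restricted weak type estimate for a frequency projection, in sequence form. -/
theorem norm_tsum_ite_le [Countable ι] {s a b : ℝ} (hs : 1 < s) (ha : 0 < a) (hb : 0 < b)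
    (hu : Summable fun α => ‖u α‖ ^ 2) (hv : Summable fun α => ‖v α‖ ^ 2)
    (hua : ∑' α, ‖u α‖ ^ 2 ≤ a) (hvb : ∑' α, ‖v α‖ ^ 2 ≤ b)
    (hE : ∀ r : ℂ, ‖r‖ < 1 → ‖∑' α, r ^ N α * ((‖u α‖ ^ 2 : ℝ) : ℂ)‖ ≤
      (Real.pi * ‖1 - r ^ 2‖) ^ (-s) * (a * a))
    (hW : ∀ r : ℂ, ‖r‖ < 1 → ‖∑' α, r ^ N α * (u α * v α)‖ ≤
      (Real.pi * ‖1 - r ^ 2‖) ^ (-s) * (a * b)) (k : ℕ) :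
    ‖∑' α, if N α = k then u α * v α else 0‖ ≤
      restrictedConst s * (a ^ ((s ^ 2 + s - 1) / (s * (2 * s - 1))) * b ^ (s / (2 * s - 1))) := by
  have hp := Real.pi_pos
  have hs0 : 0 < s := by linarith
  have hs1 : 0 < 2 * s - 1 := by linarith
  have hs0' := hs0.ne'
  have hs1' := hs1.ne'
  have hC := sinConst_nonneg hs
  set w : ι → ℂ := fun α => u α * v α with hwdef
  have hw : Summable fun α => ‖w α‖ := by
    simp only [hwdef, norm_mul]
    exact (tsum_mul_le_sqrt_mul_sqrt (fun α => norm_nonneg _) (fun α => norm_nonneg _) hu hv).1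
  have hc := continuous_trigSeries (N := N) hw
  have hEn : ∫ θ in Ioc (-Real.pi) Real.pi, ‖trigSeries N (fun α => ((‖u α‖ ^ 2 : ℝ) : ℂ)) θ‖ ≤
      (3 * Real.pi + sinConst s) * a ^ (1 + 1 / s) := by
    refine setIntegral_period_norm_trigSeries_le hs ha ?_ ?_ hE <;>
      simp only [Complex.norm_real, Real.norm_eq_abs, abs_pow, abs_norm]
    · exact hu
    · exact hua
  -- The value that balances √(δ a^(1+1/s) b), from the window near the zeros of sin, with ab
  -- δ^(1-s), from its complement.
  set δ := a ^ ((s - 1) / (s * (2 * s - 1))) * b ^ (1 / (2 * s - 1)) with hδ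
  have hδ0 : 0 < δ := by positivity
  set G : ℝ → ℂ := fun θ => Complex.exp (-(k * θ * Complex.I)) * trigSeries N w θ with hG
  have hGc : Continuous G := by simp only [hG]; fun_prop
  have hGn : ∀ θ, ‖G θ‖ = ‖trigSeries N w θ‖ := fun θ => by
    simp only [hG]; rw [norm_mul, norm_cexp_neg_natCast_mul_mul_I, one_mul]
  have hi : IntegrableOn G (Ioc (-Real.pi) Real.pi) := hGc.integrableOn_Ioc
  have hsplit : (2 * Real.pi : ℂ) * (∑' α, if N α = k then w α else 0) =
      (∫ θ in sinLe δ, G θ) + ∫ θ in sinGt δ, G θ := by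
    rw [← setIntegral_union (disjoint_sinLe_sinGt δ) (measurableSet_sinGt δ)
      (hi.mono_set inter_subset_left) (hi.mono_set inter_subset_left), sinLe_union_sinGt,
      ← two_pi_mul_tsum_eq hw k, ← tsum_mul_left]
    refine tsum_congr fun α => ?_
    split_ifs <;> ring
  have h1 : ‖∫ θ in sinLe δ, G θ‖ ≤
      Real.sqrt (3 * Real.pi * (3 * Real.pi + sinConst s)) * Real.sqrt (δ * a ^ (1 + 1 / s) * b) := by
    have hsub : sinLe δ ⊆ Ioc (-Real.pi) Real.pi := inter_subset_left
    have hsum := hasSum_setIntegral_trigSeries (N := N) hw (volume_sinLe_ne_top δ) k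
    obtain ⟨hm1, hm2⟩ := tsum_mul_norm_windowCoeff_sq_le (N := N) hu hsub k
    have hcs := tsum_mul_le_sqrt_mul_sqrt (x := fun α => ‖u α‖ * ‖windowCoeff (sinLe δ) k (N α)‖)
      (y := fun α => ‖v α‖) (fun α => by positivity) (fun α => norm_nonneg _)
      (by simpa only [mul_pow] using hm1) hv
    simp only [mul_pow] at hcs
    calc ‖∫ θ in sinLe δ, G θ‖ = ‖∑' α, w α * windowCoeff (sinLe δ) k (N α)‖ := by
          rw [hsum.tsum_eq]
      _ ≤ ∑' α, ‖w α * windowCoeff (sinLe δ) k (N α)‖ :=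
          norm_tsum_le_tsum_norm (summable_norm_iff.2 hsum.summable)
      _ = ∑' α, ‖u α‖ * ‖windowCoeff (sinLe δ) k (N α)‖ * ‖v α‖ := by
          refine tsum_congr fun α => ?_
          simp only [hwdef, norm_mul]; ring
      _ ≤ _ := hcs.2
      _ ≤ Real.sqrt (3 * Real.pi * δ * ((3 * Real.pi + sinConst s) * a ^ (1 + 1 / s))) *
          Real.sqrt b := by
          gcongr
          refine hm2.trans ?_
          have := volume_sinLe_le hδ0.le
          gcongr
      _ = _ := by
          rw [← Real.sqrt_mul (by positivity), ← Real.sqrt_mul (by positivity)]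
          congr 1; ring
  have h2 : ‖∫ θ in sinGt δ, G θ‖ ≤ sinConst s * (a * b) * δ ^ (1 - s) := by
    refine (norm_integral_le_integral_norm _).trans ?_
    simp_rw [hGn]
    exact setIntegral_sinGt_le hs (by positivity) hδ0 hc
      fun θ hθ => norm_trigSeries_le_of_disc hw hW hθ
  set R := a ^ ((s ^ 2 + s - 1) / (s * (2 * s - 1))) * b ^ (s / (2 * s - 1)) with hR
  have e1 : Real.sqrt (δ * a ^ (1 + 1 / s) * b) = R := by
    rw [Real.sqrt_eq_rpow, hδ, hR]
    rw [show a ^ ((s - 1) / (s * (2 * s - 1))) * b ^ (1 / (2 * s - 1)) * a ^ (1 + 1 / s) * b =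
      (a ^ ((s - 1) / (s * (2 * s - 1))) * a ^ (1 + 1 / s)) * (b ^ (1 / (2 * s - 1)) * b ^ (1 : ℝ)) by
        rw [Real.rpow_one]; ring, ← Real.rpow_add ha, ← Real.rpow_add hb,
      Real.mul_rpow (by positivity) (by positivity), ← Real.rpow_mul ha.le, ← Real.rpow_mul hb.le]
    generalize ht : 2 * s - 1 = t at hs1'
    congr 2 <;> field_simp
    · linear_combination -(s + 1) * ht
    · linear_combination -ht
  have e2 : a * b * δ ^ (1 - s) = R := by
    rw [hδ, hR, Real.mul_rpow (by positivity) (by positivity), ← Real.rpow_mul ha.le,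
      ← Real.rpow_mul hb.le]
    rw [show ∀ x y : ℝ, a * b * (x * y) = (a ^ (1 : ℝ) * x) * (b ^ (1 : ℝ) * y) by
      intro x y; rw [Real.rpow_one, Real.rpow_one]; ring, ← Real.rpow_add ha, ← Real.rpow_add hb]
    generalize ht : 2 * s - 1 = t at hs1'
    congr 2 <;> field_simp
    · linear_combination -s * ht
    · linear_combination -ht
  rw [e1] at h1
  have hn : 2 * Real.pi * ‖∑' α, if N α = k then w α else 0‖ ≤ restrictedConst s * R := by
    have h3 := congrArg norm hsplit
    rw [norm_mul, norm_mul, Complex.norm_real, Complex.norm_ofNat, Real.norm_of_nonneg hp.le] at h3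
    rw [h3]
    refine (norm_add_le _ _).trans ((add_le_add h1 h2).trans (le_of_eq ?_))
    rw [mul_assoc (sinConst s), e2, restrictedConst]; ring
  refine le_trans ?_ hn
  nlinarith [norm_nonneg (∑' α, if N α = k then w α else 0), Real.pi_gt_three]

end TrigCore

/-! ### The spectral projection as a bilinear pairing, and its bound at 𝔉 -/

section Restricted

variable {d : ℕ}

/-- The pairing `∑_{|α| = k} ⟨f, Φ_α⟩ ⟨g, Φ_α⟩` of `Π f` with `g`. -/
noncomputable def hermitePairing (k : ℕ) (f g : EuclideanSpace ℝ (Fin d) → ℂ) : ℂ :=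
  ∑ α ∈ hermiteIndex d (2 * k + d), hermiteCoeff f α * hermiteCoeff g α

theorem mem_hermiteIndex_iff {k : ℕ} {α : Fin d → ℕ} :
    α ∈ hermiteIndex d (2 * k + d) ↔ ∑ i, α i = k := by
  rw [mem_hermiteIndex]; omega

theorem hermitePairing_comm (k : ℕ) (f g : EuclideanSpace ℝ (Fin d) → ℂ) :
    hermitePairing k f g = hermitePairing k g f :=
  Finset.sum_congr rfl fun _ _ => mul_comm _ _

theorem hermitePairing_eq_tsum (k : ℕ) (f g : EuclideanSpace ℝ (Fin d) → ℂ) :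
    hermitePairing k f g =
      ∑' α, if ∑ i, α i = k then hermiteCoeff f α * hermiteCoeff g α else 0 := by
  rw [tsum_eq_sum (s := hermiteIndex d (2 * k + d)) fun α hα => if_neg fun h =>
    hα (mem_hermiteIndex_iff.2 h)]
  exact Finset.sum_congr rfl fun α hα => (if_pos (mem_hermiteIndex_iff.1 hα)).symm

theorem hermiteCoeff_conj (f : EuclideanSpace ℝ (Fin d) → ℂ) (α : Fin d → ℕ) :
    hermiteCoeff (fun x => (starRingEnd ℂ) (f x)) α = (starRingEnd ℂ) (hermiteCoeff f α) := by
  rw [hermiteCoeff, hermiteCoeff, ← integral_conj]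
  congr 1; ext x
  rw [map_mul, Complex.conj_ofReal]

theorem DominatedBySet.conj {f : EuclideanSpace ℝ (Fin d) → ℂ} {A : Set (EuclideanSpace ℝ (Fin d))}
    (hf : DominatedBySet f A) : DominatedBySet (fun x => (starRingEnd ℂ) (f x)) A :=
  ⟨Complex.continuous_conj.measurable.comp hf.measurable, hf.measurableSet, hf.volume_ne_top,
    fun x => by rw [RCLike.norm_conj]; exact hf.norm_le x⟩

theorem DominatedBySet.hermiteCoeff_eq_zero {f : EuclideanSpace ℝ (Fin d) → ℂ}
    {A : Set (EuclideanSpace ℝ (Fin d))} (hf : DominatedBySet f A) (hA : volume.real A = 0)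
    (α : Fin d → ℕ) : hermiteCoeff f α = 0 := by
  have h := hf.tsum_norm_hermiteCoeff_sq_le
  have h1 := hf.summable_norm_hermiteCoeff_sq.le_tsum α fun _ _ => by positivity
  have h2 : ‖hermiteCoeff f α‖ ^ 2 ≤ 0 := by linarith
  exact norm_eq_zero.1 (pow_eq_zero_iff (two_ne_zero) |>.1 (le_antisymm h2 (by positivity)))

/-- The restricted weak type estimate at `𝔉`. -/
theorem norm_hermitePairing_le_of_dominatedBySet (hd : 3 ≤ d)
    {f g : EuclideanSpace ℝ (Fin d) → ℂ} {A B : Set (EuclideanSpace ℝ (Fin d))}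
    (hf : DominatedBySet f A) (hg : DominatedBySet g B) (k : ℕ) :
    ‖hermitePairing k f g‖ ≤ restrictedConst (d / 2) *
      (volume.real A ^ (((d : ℝ) ^ 2 + 2 * d - 4) / (2 * d * (d - 1))) *
        volume.real B ^ ((d : ℝ) / (2 * (d - 1)))) := by
  have hd3 : (3 : ℝ) ≤ d := by exact_mod_cast hd
  -- Null sets are treated apart: the cut δ is a product of powers of |A| and |B| and must be
  -- positive.
  rcases (measureReal_nonneg (μ := volume) (s := A)).eq_or_lt with hA | hA
  · have : hermitePairing k f g = 0 :=
      Finset.sum_eq_zero fun α _ => by rw [hf.hermiteCoeff_eq_zero hA.symm, zero_mul]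
    rw [this, norm_zero, ← hA, Real.zero_rpow, zero_mul, mul_zero]
    apply div_ne_zero <;> nlinarith
  rcases (measureReal_nonneg (μ := volume) (s := B)).eq_or_lt with hB | hB
  · have : hermitePairing k f g = 0 :=
      Finset.sum_eq_zero fun α _ => by rw [hg.hermiteCoeff_eq_zero hB.symm, mul_zero]
    rw [this, norm_zero, ← hB, Real.zero_rpow, mul_zero, mul_zero]
    apply div_ne_zero <;> nlinarith
  have h := norm_tsum_ite_le (N := fun α : Fin d → ℕ => ∑ i, α i) (u := hermiteCoeff f)
    (v := hermiteCoeff g) (s := d / 2) (by linarith) hA hB hf.summable_norm_hermiteCoeff_sq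
    hg.summable_norm_hermiteCoeff_sq hf.tsum_norm_hermiteCoeff_sq_le hg.tsum_norm_hermiteCoeff_sq_le
    (fun r hr => by
      -- Pairing f with its own conjugate turns the coefficient products into |f_α|².
      have := hf.norm_tsum_pow_mul_hermiteCoeff_le hf.conj hr
      simp_rw [hermiteCoeff_conj, Complex.mul_conj, Complex.normSq_eq_norm_sq] at this
      exact this)
    (fun r hr => hf.norm_tsum_pow_mul_hermiteCoeff_le hg hr) k
  rw [hermitePairing_eq_tsum]
  convert h using 4
  · have : (d : ℝ) - 1 ≠ 0 := by linarith
    have h2 : 2 * ((d : ℝ) / 2) - 1 ≠ 0 := by linarith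
    field_simp
    ring
  · have : (d : ℝ) - 1 ≠ 0 := by linarith
    have h2 : 2 * ((d : ℝ) / 2) - 1 ≠ 0 := by linarith
    field_simp

end Restricted

/-! ### Dyadic level sets -/

section Levels

variable {d : ℕ}

/-- The dyadic level set `{2 ^ j < |f| ≤ 2 ^ (j + 1)}`. -/
def levelSet (f : EuclideanSpace ℝ (Fin d) → ℂ) (j : ℤ) : Set (EuclideanSpace ℝ (Fin d)) :=
  {x | (2 : ℝ) ^ j < ‖f x‖ ∧ ‖f x‖ ≤ (2 : ℝ) ^ (j + 1)}

/-- The part of `f` that lives on its `j`-th dyadic level set. -/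
noncomputable def levelPart (f : EuclideanSpace ℝ (Fin d) → ℂ) (j : ℤ) :
    EuclideanSpace ℝ (Fin d) → ℂ := (levelSet f j).indicator f

variable {f g : EuclideanSpace ℝ (Fin d) → ℂ}

theorem measurableSet_levelSet (hf : Measurable f) (j : ℤ) : MeasurableSet (levelSet f j) :=
  (measurableSet_lt measurable_const hf.norm).inter (measurableSet_le hf.norm measurable_const)

theorem disjoint_levelSet : Pairwise (Function.onFun Disjoint (levelSet f)) := by
  intro i j hij
  rw [Function.onFun, Set.disjoint_left]
  rintro x ⟨h1, h2⟩ ⟨h3, h4⟩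
  have hm := zpow_right_strictMono₀ (a := (2 : ℝ)) (by norm_num)
  have h5 := hm.lt_iff_lt.1 (h1.trans_le h4)
  have h6 := hm.lt_iff_lt.1 (h3.trans_le h2)
  omega

theorem iUnion_levelSet : ⋃ j, levelSet f j = {x | f x ≠ 0} := by
  ext x
  simp only [mem_iUnion, mem_ofPred_eq]
  constructor
  · rintro ⟨j, h, -⟩ h0
    rw [h0, norm_zero] at h
    exact absurd h (not_lt.2 (by positivity))
  · intro h
    obtain ⟨j, h1, h2⟩ := exists_mem_Ioc_zpow (x := ‖f x‖) (y := (2 : ℝ)) (norm_pos_iff.2 h) (by norm_num)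
    exact ⟨j, h1, h2⟩

theorem hasSum_hermiteCoeff_levelPart (hf : Measurable f) {α : Fin d → ℕ}
    (hi : Integrable fun x => f x * (hermitePhi α x : ℂ)) :
    HasSum (fun j : ℤ => hermiteCoeff (levelPart f j) α) (hermiteCoeff f α) := by
  have h := hasSum_integral_iUnion (fun j => measurableSet_levelSet hf j) disjoint_levelSet
    (hi.integrableOn (s := ⋃ j, levelSet f j))
  refine h.of_eq (fun j => ?_) ?_
  · rw [hermiteCoeff, ← integral_indicator (measurableSet_levelSet hf j)]
    congr 1; ext x
    rw [levelPart, indicator_mul_left]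
  · rw [iUnion_levelSet, setIntegral_eq_integral_of_forall_compl_eq_zero]
    · rfl
    · intro x hx
      simp only [mem_ofPred_eq, not_not] at hx
      rw [hx, zero_mul]

theorem dominatedBySet_levelPart (hf : Measurable f) {j : ℤ} (hj : volume (levelSet f j) ≠ ∞) :
    DominatedBySet (fun x => ((2 : ℂ) ^ (j + 1))⁻¹ * levelPart f j x) (levelSet f j) where
  measurable := (hf.indicator (measurableSet_levelSet hf j)).const_mul _
  measurableSet := measurableSet_levelSet hf j
  volume_ne_top := hj
  norm_le x := by
    by_cases hx : x ∈ levelSet f j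
    · rw [levelPart, indicator_of_mem hx, indicator_of_mem hx, norm_mul, norm_inv, norm_zpow,
        Complex.norm_ofNat, Pi.one_apply, ← div_eq_inv_mul, div_le_one (by positivity)]
      exact hx.2
    · rw [levelPart, indicator_of_notMem hx, indicator_of_notMem hx, mul_zero, norm_zero]

theorem hermiteCoeff_const_mul (c : ℂ) (f : EuclideanSpace ℝ (Fin d) → ℂ) (α : Fin d → ℕ) :
    hermiteCoeff (fun x => c * f x) α = c * hermiteCoeff f α := by
  rw [hermiteCoeff, hermiteCoeff, ← integral_const_mul]
  congr 1; ext x; ring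

theorem hermitePairing_const_mul_left (k : ℕ) (c : ℂ) (f g : EuclideanSpace ℝ (Fin d) → ℂ) :
    hermitePairing k (fun x => c * f x) g = c * hermitePairing k f g := by
  simp only [hermitePairing, hermiteCoeff_const_mul, Finset.mul_sum, mul_assoc]

theorem hermitePairing_const_mul_right (k : ℕ) (c : ℂ) (f g : EuclideanSpace ℝ (Fin d) → ℂ) :
    hermitePairing k f (fun x => c * g x) = c * hermitePairing k f g := by
  rw [hermitePairing_comm, hermitePairing_const_mul_left, hermitePairing_comm]

/-- The restricted weak type bound at `(1/p, 1/q') = (a, b)`, uniform in the eigenvalue. -/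
def RestrictedBound (d : ℕ) (a b : ℝ) (K : ℝ≥0) : Prop :=
  ∀ (k : ℕ) (f g : EuclideanSpace ℝ (Fin d) → ℂ) (A B : Set (EuclideanSpace ℝ (Fin d))),
    DominatedBySet f A → DominatedBySet g B →
      ‖hermitePairing k f g‖ₑ ≤ K * (volume A ^ a * volume B ^ b)

/-- Since the second coordinate is 1/q' and not 1/q, duality is the swap of coordinates and follows
from symmetry of the pairing. -/
theorem RestrictedBound.symm {a b : ℝ} {K : ℝ≥0} (h : RestrictedBound d a b K) :
    RestrictedBound d b a K := fun k f g A B hf hg => by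
  rw [hermitePairing_comm, mul_comm (volume A ^ b)]; exact h k g f B A hg hf

theorem enorm_two_zpow (j : ℤ) : ‖(2 : ℂ) ^ j‖ₑ = (2 : ℝ≥0∞) ^ j := by
  rw [← ofReal_norm, norm_zpow, Complex.norm_ofNat, ← Real.rpow_intCast, ← ENNReal.ofReal_rpow_of_pos
    (by norm_num), ENNReal.rpow_intCast]
  simp

theorem RestrictedBound.levelPart_left {a b : ℝ} {K : ℝ≥0} (h : RestrictedBound d a b K)
    (hf : Measurable f) {j : ℤ} (hj : volume (levelSet f j) ≠ ∞)
    {B : Set (EuclideanSpace ℝ (Fin d))} (hg : DominatedBySet g B) (k : ℕ) :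
    ‖hermitePairing k (levelPart f j) g‖ₑ ≤
      (2 : ℝ≥0∞) ^ (j + 1) * (K * (volume (levelSet f j) ^ a * volume B ^ b)) := by
  have h1 := h k _ g _ B (dominatedBySet_levelPart hf hj) hg
  have e : levelPart f j = fun x => (2 : ℂ) ^ (j + 1) * (((2 : ℂ) ^ (j + 1))⁻¹ * levelPart f j x) := by
    ext x; rw [mul_inv_cancel_left₀ (zpow_ne_zero _ two_ne_zero)]
  rw [e, hermitePairing_const_mul_left, enorm_mul, enorm_two_zpow]
  gcongr

/-- The restricted weak type bound at `𝔉`. -/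
theorem restrictedBound_F (hd : 3 ≤ d) :
    RestrictedBound d (((d : ℝ) ^ 2 + 2 * d - 4) / (2 * d * (d - 1))) ((d : ℝ) / (2 * (d - 1)))
      (restrictedConst (d / 2)).toNNReal := by
  intro k f g A B hf hg
  have hd3 : (3 : ℝ) ≤ d := by exact_mod_cast hd
  have h := norm_hermitePairing_le_of_dominatedBySet hd hf hg k
  have hc : 0 ≤ restrictedConst (d / 2) :=
    add_nonneg (Real.sqrt_nonneg _) (sinConst_nonneg (by linarith))
  rw [← ofReal_norm]
  refine (ENNReal.ofReal_le_ofReal h).trans ?_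
  have e1 : (0 : ℝ) ≤ ((d : ℝ) ^ 2 + 2 * d - 4) / (2 * d * (d - 1)) := by
    apply div_nonneg <;> nlinarith
  have e2 : (0 : ℝ) ≤ (d : ℝ) / (2 * (d - 1)) := by
    apply div_nonneg <;> nlinarith
  rw [ENNReal.ofReal_mul hc, ENNReal.ofReal_mul (by positivity),
    ← ENNReal.ofReal_rpow_of_nonneg measureReal_nonneg e1,
    ← ENNReal.ofReal_rpow_of_nonneg measureReal_nonneg e2, ofReal_measureReal hf.volume_ne_top,
    ofReal_measureReal hg.volume_ne_top]
  rfl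

end Levels

/-! ### From restricted weak type to Lorentz bounds -/

section Lorentz

variable {d : ℕ} {f g : EuclideanSpace ℝ (Fin d) → ℂ}

theorem hermiteProj_eq (k : ℕ) (f : EuclideanSpace ℝ (Fin d) → ℂ) (x : EuclideanSpace ℝ (Fin d)) :
    hermiteProj d (2 * k + d) f x =
      ∑ α ∈ hermiteIndex d (2 * k + d), hermiteCoeff f α * (hermitePhi α x : ℂ) := rfl

theorem continuous_hermiteProj (k : ℕ) (f : EuclideanSpace ℝ (Fin d) → ℂ) :
    Continuous (hermiteProj d (2 * k + d) f) := by
  unfold hermiteProj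
  exact continuous_finsetSum _ fun α _ =>
    continuous_const.mul (Complex.continuous_ofReal.comp (continuous_hermitePhi α))

theorem memLp_hermiteProj (k : ℕ) (f : EuclideanSpace ℝ (Fin d) → ℂ) {p : ℝ≥0∞} (hp : 1 ≤ p) :
    MemLp (hermiteProj d (2 * k + d) f) p := by
  unfold hermiteProj
  exact memLp_finsetSum _ fun α _ => (memLp_hermitePhi α hp).const_mul _

theorem exists_norm_hermiteProj_le (k : ℕ) (f : EuclideanSpace ℝ (Fin d) → ℂ) :
    ∃ C, ∀ x, ‖hermiteProj d (2 * k + d) f x‖ ≤ C := by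
  choose C hC0 hC using exists_abs_hermitePhi_le (d := d)
  refine ⟨∑ α ∈ hermiteIndex d (2 * k + d), ‖hermiteCoeff f α‖ * C α, fun x => ?_⟩
  rw [hermiteProj_eq]
  refine (norm_sum_le _ _).trans (Finset.sum_le_sum fun α _ => ?_)
  rw [norm_mul, Complex.norm_real]
  gcongr
  exact hC α x

/-- `⟨Π f, g⟩` as an integral, for bounded measurable `g`. -/
theorem hermitePairing_eq_integral (k : ℕ) (f : EuclideanSpace ℝ (Fin d) → ℂ) (hg : Measurable g)
    {M : ℝ} (hM : ∀ x, ‖g x‖ ≤ M) :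
    hermitePairing k f g = ∫ x, hermiteProj d (2 * k + d) f x * g x := by
  have hi : ∀ α : Fin d → ℕ, Integrable fun x => g x * (hermitePhi α x : ℂ) := fun α =>
    (integrable_hermitePhi α).ofReal.bdd_mul hg.aestronglyMeasurable
      (Filter.Eventually.of_forall hM)
  have e : ∀ x, hermiteProj d (2 * k + d) f x * g x =
      ∑ α ∈ hermiteIndex d (2 * k + d), hermiteCoeff f α * (g x * (hermitePhi α x : ℂ)) := by
    intro x
    rw [hermiteProj_eq, Finset.sum_mul]
    exact Finset.sum_congr rfl fun α _ => by ring
  simp_rw [e]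
  rw [integral_finsetSum _ fun α _ => (hi α).const_mul _]
  exact Finset.sum_congr rfl fun α _ => by rw [integral_const_mul]; rfl

theorem lorentzNorm_one_eq (f : EuclideanSpace ℝ (Fin d) → ℂ) (p : ℝ≥0∞) :
    lorentzNorm f p 1 = p * ∫⁻ s in Ioi (0 : ℝ), distribFun f s ^ (1 / p.toReal) := by
  rw [lorentzNorm, if_neg ENNReal.one_ne_top]
  simp only [ENNReal.toReal_one, div_one, ENNReal.rpow_one]
  congr 1
  refine setLIntegral_congr_fun measurableSet_Ioi fun s hs => ?_
  have h0 : ENNReal.ofReal s ≠ 0 := by simpa using hs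
  rw [mul_div_assoc, ENNReal.mul_div_cancel h0 ENNReal.ofReal_ne_top]

/-- For s in (2^(j-1), 2^j] the set {|f| > s} contains the j-th level set; this interval has length
2^(j-1), a quarter of 2^(j+1). -/
theorem tsum_zpow_mul_volume_levelSet_le {a : ℝ} (ha : 0 ≤ a) :
    ∑' j : ℤ, (2 : ℝ≥0∞) ^ (j + 1) * volume (levelSet f j) ^ a ≤
      4 * ∫⁻ s in Ioi (0 : ℝ), distribFun f s ^ a := by
  have hterm : ∀ j : ℤ, (2 : ℝ≥0∞) ^ (j + 1) * volume (levelSet f j) ^ a ≤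
      4 * ∫⁻ s in Ioc ((2 : ℝ) ^ (j - 1)) ((2 : ℝ) ^ j), distribFun f s ^ a := by
    intro j
    have h1 : ∫⁻ _s in Ioc ((2 : ℝ) ^ (j - 1)) ((2 : ℝ) ^ j), volume (levelSet f j) ^ a ≤
        ∫⁻ s in Ioc ((2 : ℝ) ^ (j - 1)) ((2 : ℝ) ^ j), distribFun f s ^ a := by
      refine setLIntegral_mono' measurableSet_Ioc fun s hs => ?_
      refine ENNReal.rpow_le_rpow (measure_mono fun x hx => ?_) ha
      exact hs.2.trans_lt hx.1
    rw [setLIntegral_const, Real.volume_Ioc] at h1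
    have h2 : (2 : ℝ≥0∞) ^ (j + 1) = 4 * ENNReal.ofReal ((2 : ℝ) ^ j - (2 : ℝ) ^ (j - 1)) := by
      have e : (2 : ℝ) ^ j - (2 : ℝ) ^ (j - 1) = (2 : ℝ) ^ (j - 1) := by
        rw [zpow_sub_one₀ (by norm_num)]; ring
      rw [e, ← Real.rpow_intCast, ← ENNReal.ofReal_rpow_of_pos (by norm_num), ENNReal.rpow_intCast,
        ENNReal.ofReal_ofNat, show (4 : ℝ≥0∞) = 2 ^ (2 : ℤ) by norm_num,
        ← ENNReal.zpow_add (by norm_num) (by norm_num)]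
      congr 1; ring
    rw [h2, mul_assoc]
    gcongr
    rwa [mul_comm]
  calc _ ≤ ∑' j : ℤ, 4 * ∫⁻ s in Ioc ((2 : ℝ) ^ (j - 1)) ((2 : ℝ) ^ j), distribFun f s ^ a :=
        ENNReal.tsum_le_tsum hterm
    _ = 4 * ∫⁻ s in ⋃ j : ℤ, Ioc ((2 : ℝ) ^ (j - 1)) ((2 : ℝ) ^ j), distribFun f s ^ a := by
        rw [ENNReal.tsum_mul_left, lintegral_iUnion (fun j => measurableSet_Ioc)]
        intro i j hij
        rw [Function.onFun, Set.disjoint_left]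
        rintro x ⟨h1, h2⟩ ⟨h3, h4⟩
        have hm := zpow_right_strictMono₀ (a := (2 : ℝ)) (by norm_num)
        have h5 := hm.lt_iff_lt.1 (h1.trans_le h4)
        have h6 := hm.lt_iff_lt.1 (h3.trans_le h2)
        omega
    _ ≤ _ := by
        gcongr
        exact iUnion_subset fun j s hs => lt_of_le_of_lt (by positivity) hs.1

theorem ennreal_le_rpow_mul_rpow_of_le {x y z : ℝ≥0∞} {a : ℝ} (ha0 : 0 ≤ a) (ha1 : a ≤ 1)
    (hx : z ≤ x) (hy : z ≤ y) : z ≤ x ^ a * y ^ (1 - a) := by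
  calc z = z ^ a * z ^ (1 - a) := by
        rw [← ENNReal.rpow_add_of_nonneg _ _ ha0 (by linarith), add_sub_cancel, ENNReal.rpow_one]
    _ ≤ _ := by gcongr

/-- On a level set, ∫|Φ_α| is bounded both by a multiple of the volume and by the full L¹ norm of
Φ_α; the geometric mean with weights a and 1 - a matches the summability assumption. This ensures
that the integral defining `hermiteCoeff` is not the default value 0, and that it splits over
levels. -/
theorem integrable_mul_hermitePhi_of_tsum (hf : Measurable f) {a : ℝ} (ha0 : 0 ≤ a) (ha1 : a ≤ 1)
    (hs : ∑' j : ℤ, (2 : ℝ≥0∞) ^ (j + 1) * volume (levelSet f j) ^ a ≠ ∞) (α : Fin d → ℕ) :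
    Integrable fun x => f x * (hermitePhi α x : ℂ) := by
  obtain ⟨C, hC0, hC⟩ := exists_abs_hermitePhi_le α
  have hmeas : Measurable fun x => (hermitePhi α x : ℂ) :=
    (Complex.continuous_ofReal.comp (continuous_hermitePhi α)).measurable
  refine ⟨(hf.mul hmeas).aestronglyMeasurable, ?_⟩
  set I := ∫⁻ x, ‖(hermitePhi α x : ℂ)‖ₑ with hI
  have hIt : I ≠ ∞ := (integrable_hermitePhi α).ofReal.2.ne
  have hterm : ∀ j : ℤ, ∫⁻ x in levelSet f j, ‖f x * (hermitePhi α x : ℂ)‖ₑ ≤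
      ((ENNReal.ofReal C) ^ a * I ^ (1 - a)) * ((2 : ℝ≥0∞) ^ (j + 1) * volume (levelSet f j) ^ a) := by
    intro j
    have h1 : ∫⁻ x in levelSet f j, ‖f x * (hermitePhi α x : ℂ)‖ₑ ≤
        ∫⁻ x in levelSet f j, (2 : ℝ≥0∞) ^ (j + 1) * ‖(hermitePhi α x : ℂ)‖ₑ := by
      refine setLIntegral_mono' (measurableSet_levelSet hf j) fun x hx => ?_
      rw [enorm_mul]
      gcongr
      rw [← enorm_two_zpow, enorm_le_iff_norm_le, norm_zpow, Complex.norm_ofNat]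
      exact hx.2
    have h2 : ∫⁻ x in levelSet f j, ‖(hermitePhi α x : ℂ)‖ₑ ≤
        (ENNReal.ofReal C * volume (levelSet f j)) ^ a * I ^ (1 - a) := by
      refine ennreal_le_rpow_mul_rpow_of_le ha0 ha1 ?_ (setLIntegral_le_lintegral _ _)
      rw [← setLIntegral_const]
      refine setLIntegral_mono' (measurableSet_levelSet hf j) fun x _ => ?_
      rw [← ofReal_norm, Complex.norm_real]
      exact ENNReal.ofReal_le_ofReal (hC x)
    rw [lintegral_const_mul _ hmeas.enorm] at h1
    refine h1.trans ?_
    rw [ENNReal.mul_rpow_of_nonneg _ _ ha0] at h2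
    calc _ ≤ (2 : ℝ≥0∞) ^ (j + 1) * (ENNReal.ofReal C ^ a * volume (levelSet f j) ^ a * I ^ (1 - a)) := by
          gcongr
      _ = _ := by ring
  have hfin : ∫⁻ x, ‖f x * (hermitePhi α x : ℂ)‖ₑ = ∫⁻ x in ⋃ j, levelSet f j,
      ‖f x * (hermitePhi α x : ℂ)‖ₑ := by
    rw [iUnion_levelSet, setLIntegral_eq_of_support_subset]
    intro x hx h0
    simp [h0] at hx
  rw [HasFiniteIntegral, hfin, lintegral_iUnion (measurableSet_levelSet hf) disjoint_levelSet]
  refine (ENNReal.tsum_le_tsum hterm).trans_lt ?_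
  rw [ENNReal.tsum_mul_left]
  refine ENNReal.mul_lt_top (ENNReal.mul_lt_top ?_ ?_) (lt_top_iff_ne_top.2 hs)
  · exact ENNReal.rpow_lt_top_of_nonneg ha0 ENNReal.ofReal_ne_top
  · exact ENNReal.rpow_lt_top_of_nonneg (by linarith) hIt

end Lorentz

section WeakType

variable {d : ℕ} {f g : EuclideanSpace ℝ (Fin d) → ℂ}

theorem RestrictedBound.enorm_hermitePairing_le {a b : ℝ} {K : ℝ≥0} (h : RestrictedBound d a b K)
    (ha0 : 0 < a) (ha1 : a ≤ 1) (hf : Measurable f)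
    (hI : ∫⁻ s in Ioi (0 : ℝ), distribFun f s ^ a ≠ ∞)
    {B : Set (EuclideanSpace ℝ (Fin d))} (hg : DominatedBySet g B) (k : ℕ) :
    ‖hermitePairing k f g‖ₑ ≤
      4 * K * (∫⁻ s in Ioi (0 : ℝ), distribFun f s ^ a) * volume B ^ b := by
  have hle := tsum_zpow_mul_volume_levelSet_le (f := f) ha0.le
  have hs : ∑' j : ℤ, (2 : ℝ≥0∞) ^ (j + 1) * volume (levelSet f j) ^ a ≠ ∞ :=
    (hle.trans_lt (ENNReal.mul_lt_top (by norm_num) (lt_top_iff_ne_top.2 hI))).ne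
  have hvol : ∀ j, volume (levelSet f j) ≠ ∞ := by
    intro j hj
    have h1 := ENNReal.ne_top_of_tsum_ne_top hs j
    rw [hj, ENNReal.top_rpow_of_pos ha0, ENNReal.mul_top] at h1
    · exact h1 rfl
    · exact (ENNReal.zpow_pos (by norm_num) (by norm_num) _).ne'
  have hsum : HasSum (fun j : ℤ => hermitePairing k (levelPart f j) g) (hermitePairing k f g) :=
    hasSum_sum fun α _ => (hasSum_hermiteCoeff_levelPart hf
      (integrable_mul_hermitePhi_of_tsum hf ha0.le ha1 hs α)).mul_right _
  rw [← hsum.tsum_eq]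
  calc _ ≤ ∑' j : ℤ, ‖hermitePairing k (levelPart f j) g‖ₑ := enorm_tsum_le_tsum_enorm
    _ ≤ ∑' j : ℤ, (K * volume B ^ b) * ((2 : ℝ≥0∞) ^ (j + 1) * volume (levelSet f j) ^ a) :=
        ENNReal.tsum_le_tsum fun j => (h.levelPart_left hf (hvol j) hg k).trans_eq (by ring)
    _ ≤ (K * volume B ^ b) * (4 * ∫⁻ s in Ioi (0 : ℝ), distribFun f s ^ a) := by
        rw [ENNReal.tsum_mul_left]; gcongr
    _ = _ := by ring

/-- Testing `Π f` against its phase on a superlevel set. -/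
theorem exists_dominatedBySet_ofReal_mul_volume_le (k : ℕ) (f : EuclideanSpace ℝ (Fin d) → ℂ)
    {s : ℝ} (hs : 0 < s) :
    ∃ g, DominatedBySet g {x | s < ‖hermiteProj d (2 * k + d) f x‖} ∧
      ENNReal.ofReal s * volume {x | s < ‖hermiteProj d (2 * k + d) f x‖} ≤
        ‖hermitePairing k f g‖ₑ := by
  set F := hermiteProj d (2 * k + d) f with hF
  have hFc : Continuous F := continuous_hermiteProj k f
  have hFi : Integrable F := memLp_one_iff_integrable.1 (memLp_hermiteProj k f le_rfl)
  set B := {x | s < ‖F x‖} with hB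
  have hBm : MeasurableSet B := measurableSet_lt measurable_const hFc.norm.measurable
  have hBt : volume B ≠ ∞ := (hFi.measure_norm_gt_lt_top hs).ne
  set g : EuclideanSpace ℝ (Fin d) → ℂ :=
    B.indicator fun x => (starRingEnd ℂ) (F x) * ((‖F x‖ : ℂ))⁻¹ with hg
  have hgd : DominatedBySet g B := by
    refine ⟨?_, hBm, hBt, fun x => ?_⟩
    · refine Measurable.indicator ?_ hBm
      exact (Complex.continuous_conj.comp hFc).measurable.mul
        (Complex.continuous_ofReal.comp hFc.norm).measurable.inv
    · by_cases hx : x ∈ B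
      · have h0 : 0 < ‖F x‖ := hs.trans hx
        rw [hg, indicator_of_mem hx, indicator_of_mem hx, norm_mul, RCLike.norm_conj, norm_inv,
          Complex.norm_real, norm_norm, mul_inv_cancel₀ h0.ne', Pi.one_apply]
      · rw [hg, indicator_of_notMem hx, indicator_of_notMem hx, norm_zero]
  refine ⟨g, hgd, ?_⟩
  rw [hermitePairing_eq_integral k f hgd.measurable hgd.norm_le_one]
  have e : ∀ x, F x * g x = ((B.indicator (fun x => ‖F x‖) x : ℝ) : ℂ) := by
    intro x
    by_cases hx : x ∈ B
    · have h0 : (‖F x‖ : ℂ) ≠ 0 := by exact_mod_cast (hs.trans hx).ne'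
      rw [hg, indicator_of_mem hx, indicator_of_mem hx, ← mul_assoc, Complex.mul_conj,
        Complex.normSq_eq_norm_sq]
      push_cast
      field_simp
    · rw [hg, indicator_of_notMem hx, indicator_of_notMem hx, mul_zero, Complex.ofReal_zero]
  rw [← hF, integral_congr_ae (Filter.Eventually.of_forall e), integral_complex_ofReal,
    ← ofReal_norm, Complex.norm_real,
    integral_indicator hBm,
    Real.norm_of_nonneg (integral_nonneg fun _ => norm_nonneg _),
    ofReal_integral_eq_lintegral_ofReal hFi.norm.integrableOn
      (Filter.Eventually.of_forall fun _ => norm_nonneg _), ← setLIntegral_const]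
  exact setLIntegral_mono' hBm fun x hx => ENNReal.ofReal_le_ofReal (le_of_lt hx)

theorem hermiteProj_congr_ae (h : f =ᵐ[volume] g) (lam : ℕ) :
    hermiteProj d lam f = hermiteProj d lam g := by
  ext x
  unfold hermiteProj
  refine Finset.sum_congr rfl fun α _ => ?_
  congr 1
  exact integral_congr_ae (h.mono fun y hy => by simp only [hy])

theorem distribFun_congr_ae (h : f =ᵐ[volume] g) (s : ℝ) : distribFun f s = distribFun g s :=
  measure_congr (h.mono fun y hy => by
    change (s < ‖f y‖) = (s < ‖g y‖)
    rw [hy])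

theorem lorentzNorm_congr_ae (h : f =ᵐ[volume] g) (p r : ℝ≥0∞) :
    lorentzNorm f p r = lorentzNorm g p r := by
  unfold lorentzNorm
  simp only [distribFun_congr_ae h]

/-- Restricted weak type bounds pass to `L^{p,1} → L^{q,∞}`. -/
theorem RestrictedBound.lorentzNorm_hermiteProj_le {p q : ℝ≥0∞} {K : ℝ≥0} (hp : 1 ≤ p)
    (hpt : p ≠ ∞) (hq : 1 < q) (hqt : q ≠ ∞)
    (h : RestrictedBound d p⁻¹.toReal (1 - q⁻¹.toReal) K)
    (hf : AEStronglyMeasurable f volume) (hfin : lorentzNorm f p 1 < ∞) (k : ℕ) :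
    lorentzNorm (hermiteProj d (2 * k + d) f) q ∞ ≤ (4 * K : ℝ≥0) * lorentzNorm f p 1 := by
  -- Neither the projection nor the Lorentz norm sees a change on a null set.
  wlog hm : Measurable f generalizing f
  · have hae := hf.ae_eq_mk
    rw [hermiteProj_congr_ae hae, lorentzNorm_congr_ae hae]
    rw [lorentzNorm_congr_ae hae] at hfin
    exact this hf.stronglyMeasurable_mk.aestronglyMeasurable hfin
      hf.stronglyMeasurable_mk.measurable
  have hp0 : 0 < p.toReal := ENNReal.toReal_pos (by positivity) hpt
  have hp1 : 1 ≤ p.toReal := by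
    rw [← ENNReal.toReal_one]; exact ENNReal.toReal_mono hpt hp
  have hq1 : 1 < q.toReal := by
    rw [← ENNReal.toReal_one]; exact (ENNReal.toReal_lt_toReal (by simp) hqt).2 hq
  have hpinv : 1 / p.toReal = p⁻¹.toReal := by rw [ENNReal.toReal_inv, one_div]
  have hqinv : 1 / q.toReal = q⁻¹.toReal := by rw [ENNReal.toReal_inv, one_div]
  have ha0 : 0 < p⁻¹.toReal := by rw [← hpinv]; positivity
  have ha1 : p⁻¹.toReal ≤ 1 := by rw [← hpinv, div_le_one hp0]; exact hp1
  have hb0 : 0 < q⁻¹.toReal := by rw [← hqinv]; positivity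
  rw [lorentzNorm_one_eq, hpinv] at hfin ⊢
  set I := ∫⁻ s in Ioi (0 : ℝ), distribFun f s ^ p⁻¹.toReal with hI
  have hIt : I ≠ ∞ := by
    intro hI'
    rw [hI', ENNReal.mul_top (by positivity)] at hfin
    exact hfin.ne rfl
  rw [lorentzNorm, if_pos rfl]
  refine iSup₂_le fun s hs => ?_
  rw [hqinv, distribFun]
  obtain ⟨g, hg, hle⟩ := exists_dominatedBySet_ofReal_mul_volume_le k f hs
  set V := volume {x | s < ‖hermiteProj d (2 * k + d) f x‖} with hV
  have hVt : V ≠ ∞ := hg.volume_ne_top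
  have h1 := hle.trans (h.enorm_hermitePairing_le ha0 ha1 hm hIt hg k)
  have h2 : ENNReal.ofReal s * V ^ q⁻¹.toReal ≤ 4 * K * I := by
    rcases eq_or_ne V 0 with h0 | h0
    · rw [h0, ENNReal.zero_rpow_of_pos hb0, mul_zero]; exact zero_le
    -- Testing gave sV ≲ V^(1 - 1/q); dividing is legitimate because V is finite and nonzero.
    · have hz : V ^ (1 - q⁻¹.toReal) ≠ 0 := (ENNReal.rpow_pos (pos_iff_ne_zero.2 h0) hVt).ne'
      have hz' : V ^ (1 - q⁻¹.toReal) ≠ ∞ := ENNReal.rpow_ne_top_of_ne_zero h0 hVt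
      rw [← ENNReal.mul_le_mul_iff_left hz hz', mul_assoc, ← ENNReal.rpow_add _ _ h0 hVt,
        add_sub_cancel, ENNReal.rpow_one]
      exact h1
  refine h2.trans ?_
  push_cast
  gcongr
  -- The factor p in the definition of the L^{p,1} norm is at least 1 and is simply thrown in.
  exact le_mul_of_one_le_left' hp

/-- Both p = 0 and p = ∞ make `p⁻¹.toReal` equal to 0, so positivity of this number excludes the
spurious case p = 0 as well. -/
theorem one_le_of_toReal_inv {p : ℝ≥0∞} (h0 : 0 < p⁻¹.toReal) (h1 : p⁻¹.toReal ≤ 1) :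
    1 ≤ p ∧ p ≠ ∞ := by
  have hpt : p ≠ ∞ := by rintro rfl; simp at h0
  have hp0 : p ≠ 0 := by rintro rfl; simp at h0
  refine ⟨?_, hpt⟩
  rw [← ENNReal.inv_le_one]
  rw [← ENNReal.toReal_one, ENNReal.toReal_le_toReal (by simp [hp0]) (by simp)] at h1
  exact h1

theorem one_lt_of_toReal_inv {p : ℝ≥0∞} (h0 : 0 < p⁻¹.toReal) (h1 : p⁻¹.toReal < 1) :
    1 < p ∧ p ≠ ∞ := by
  obtain ⟨h2, h3⟩ := one_le_of_toReal_inv h0 h1.le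
  refine ⟨lt_of_le_of_ne h2 ?_, h3⟩
  rintro rfl
  simp at h1

/-- The Lorentz space bounds at the two excluded vertices. -/
theorem exists_lorentzNorm_hermiteProj_le (hd : 3 ≤ d) :
    ∃ C : ℝ≥0, ∀ p q : ℝ≥0∞,
      (exponentPoint p q = pointF d ∨ exponentPoint p q = dualPoint (pointF d)) →
      ∀ lam ∈ hermiteSpectrum d, ∀ f : EuclideanSpace ℝ (Fin d) → ℂ,
        AEStronglyMeasurable f volume → lorentzNorm f p 1 < ∞ →
        lorentzNorm (hermiteProj d lam f) q ∞ ≤ C * lorentzNorm f p 1 := by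
  have hd3 : (3 : ℝ) ≤ d := by exact_mod_cast hd
  have hF := restrictedBound_F hd
  set K := (restrictedConst (d / 2)).toNNReal
  set a : ℝ := ((d : ℝ) ^ 2 + 2 * d - 4) / (2 * d * (d - 1)) with ha
  set b : ℝ := (d : ℝ) / (2 * (d - 1)) with hb
  have hden : 0 < 2 * (d : ℝ) * (d - 1) := by nlinarith
  have ha0 : 0 < a := div_pos (by nlinarith) hden
  have ha1 : a < 1 := by rw [ha, div_lt_one hden]; nlinarith
  have hb0 : 0 < b := div_pos (by linarith) (by linarith)
  have hb1 : b < 1 := by rw [hb, div_lt_one (by linarith)]; linarith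
  have hbe : ((d : ℝ) - 2) / (2 * (d - 1)) = 1 - b := by
    have : (d : ℝ) - 1 ≠ 0 := by linarith
    rw [hb]; field_simp; ring
  refine ⟨4 * K, ?_⟩
  rintro p q hpq _ ⟨k, rfl⟩ f hf hfin
  rcases hpq with hpq | hpq
  · rw [exponentPoint, pointF, Prod.mk.injEq, hbe] at hpq
    obtain ⟨h1, h2⟩ := hpq
    obtain ⟨hp, hpt⟩ := one_le_of_toReal_inv (p := p) (by rw [h1]; exact ha0) (by rw [h1]; exact ha1.le)
    obtain ⟨hq, hqt⟩ := one_lt_of_toReal_inv (p := q) (by rw [h2]; linarith) (by rw [h2]; linarith)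
    refine RestrictedBound.lorentzNorm_hermiteProj_le hp hpt hq hqt ?_ hf hfin k
    rw [h1, h2, sub_sub_cancel]
    exact hF
  · rw [exponentPoint, dualPoint, pointF, Prod.mk.injEq, hbe, sub_sub_cancel] at hpq
    obtain ⟨h1, h2⟩ := hpq
    obtain ⟨hp, hpt⟩ := one_le_of_toReal_inv (p := p) (by rw [h1]; exact hb0) (by rw [h1]; exact hb1.le)
    obtain ⟨hq, hqt⟩ := one_lt_of_toReal_inv (p := q) (by rw [h2]; change 0 < 1 - a; linarith)
      (by rw [h2]; change 1 - a < 1; linarith)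
    refine RestrictedBound.lorentzNorm_hermiteProj_le hp hpt hq hqt ?_ hf hfin k
    rw [h1, h2]
    change RestrictedBound d b (1 - (1 - a)) K
    rw [sub_sub_cancel]
    exact hF.symm

end WeakType

/-! ### Bilinear real interpolation -/

section Kernel

theorem summable_pow_natAbs {r : ℝ≥0∞} (hr : r < 1) : ∑' l : ℤ, r ^ l.natAbs ≠ ∞ := by
  have hg : ∑' n : ℕ, r ^ n ≠ ∞ := by
    rw [ENNReal.tsum_geometric, ne_eq, ENNReal.inv_eq_top, tsub_eq_zero_iff_le, not_le]
    exact hr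
  rw [tsum_of_nat_of_neg_add_one (ENNReal.summable) (ENNReal.summable)]
  refine ENNReal.add_ne_top.2 ⟨by simpa using hg, ?_⟩
  refine ne_top_of_le_ne_top hg (ENNReal.tsum_le_tsum fun n => ?_)
  have : (-((n : ℤ) + 1)).natAbs = n + 1 := by omega
  rw [this]
  exact pow_le_pow_right_of_le_one' hr.le (Nat.le_succ n)

/-- A geometric kernel along an arithmetic progression is summable, uniformly in the shift. -/
theorem exists_tsum_two_rpow_neg_abs_le {η v : ℝ} (hη : 0 < η) (hv : v ≠ 0) :
    ∃ S : ℝ≥0, ∀ c : ℝ, ∑' l : ℤ, (2 : ℝ≥0∞) ^ (-(η * |c + v * l|)) ≤ S := by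
  set r : ℝ≥0∞ := (2 : ℝ≥0∞) ^ (-(η * |v|)) with hr
  have hηv : 0 < η * |v| := mul_pos hη (abs_pos.2 hv)
  have hr1 : r < 1 := ENNReal.rpow_lt_one_of_one_lt_of_neg (by norm_num) (by linarith)
  have hT := summable_pow_natAbs hr1
  set T := ∑' l : ℤ, r ^ l.natAbs with hTdef
  refine ⟨((2 : ℝ≥0∞) ^ (η * |v|) * T).toNNReal, fun c => ?_⟩
  rw [ENNReal.coe_toNNReal (ENNReal.mul_ne_top
    (ENNReal.rpow_ne_top_of_nonneg hηv.le (by norm_num)) hT), ← ENNReal.tsum_mul_left]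
  -- An integer within 1 of the zero of l ↦ c + vl. Recentring the progression there costs at most
  -- the factor 2^(η|v|), whatever c is.
  set m : ℤ := ⌊-(c / v)⌋ with hm
  rw [← (Equiv.subRight m).tsum_eq
    (fun l : ℤ => (2 : ℝ≥0∞) ^ (η * |v|) * r ^ l.natAbs)]
  refine ENNReal.tsum_le_tsum fun l => ?_
  rw [hr, ← ENNReal.rpow_natCast, ← ENNReal.rpow_mul,
    ← ENNReal.rpow_add _ _ (by norm_num) (by norm_num)]
  refine ENNReal.rpow_le_rpow_of_exponent_le (by norm_num) ?_
  have h1 : ((Equiv.subRight m l).natAbs : ℝ) = |(l : ℝ) - m| := by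
    rw [Equiv.subRight_apply, Nat.cast_natAbs, Int.cast_abs, Int.cast_sub]
  rw [h1]
  have h2 : |v| * |(l : ℝ) - m| ≤ |c + v * l| + |v| := by
    rw [← abs_mul]
    have e : v * ((l : ℝ) - m) = (c + v * l) + v * (-(c / v) - m) := by field_simp; ring
    rw [e]
    refine (abs_add_le _ _).trans ?_
    rw [abs_mul v]
    have h3 : |(-(c / v) - m)| ≤ 1 := by
      rw [abs_le]
      constructor <;> linarith [Int.floor_le (-(c / v)), Int.lt_floor_add_one (-(c / v))]
    gcongr
    exact mul_le_of_le_one_right (abs_nonneg _) h3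
  nlinarith

end Kernel

section StrongBound

variable {d : ℕ} {f g : EuclideanSpace ℝ (Fin d) → ℂ}

/-- Bounded measurable functions in `L^{1/a}`. -/
structure BddRpow (f : EuclideanSpace ℝ (Fin d) → ℂ) (a : ℝ) : Prop where
  measurable : Measurable f
  bdd : ∃ M, ∀ x, ‖f x‖ ≤ M
  lintegral_ne_top : ∫⁻ x, ‖f x‖ₑ ^ (1 / a) ≠ ∞

theorem BddRpow.integrable_mul_hermitePhi {a : ℝ} (hf : BddRpow f a) (α : Fin d → ℕ) :
    Integrable fun x => f x * (hermitePhi α x : ℂ) := by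
  obtain ⟨M, hM⟩ := hf.bdd
  exact (integrable_hermitePhi α).ofReal.bdd_mul hf.measurable.aestronglyMeasurable
    (Filter.Eventually.of_forall hM)

theorem BddRpow.const_mul {a : ℝ} (ha : 0 < a) (hf : BddRpow f a) (c : ℂ) :
    BddRpow (fun x => c * f x) a where
  measurable := hf.measurable.const_mul c
  bdd := by
    obtain ⟨M, hM⟩ := hf.bdd
    exact ⟨‖c‖ * M, fun x => by rw [norm_mul]; gcongr; exact hM x⟩
  lintegral_ne_top := by
    have h0 : (0 : ℝ) ≤ 1 / a := by positivity
    simp only [enorm_mul, ENNReal.mul_rpow_of_nonneg _ _ h0]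
    rw [lintegral_const_mul _ (hf.measurable.enorm.pow_const _)]
    exact ENNReal.mul_ne_top (ENNReal.rpow_ne_top_of_nonneg h0 enorm_ne_top) hf.lintegral_ne_top

/-- The strong type bound at `(1/p, 1/q') = (a, b)`, uniform in the eigenvalue, in bilinear form. -/
def StrongBound (d : ℕ) (a b : ℝ) (K : ℝ≥0) : Prop :=
  ∀ (k : ℕ) (f g : EuclideanSpace ℝ (Fin d) → ℂ), BddRpow f a → BddRpow g b →
    ‖hermitePairing k f g‖ₑ ≤
      K * ((∫⁻ x, ‖f x‖ₑ ^ (1 / a)) ^ a * (∫⁻ x, ‖g x‖ₑ ^ (1 / b)) ^ b)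

theorem StrongBound.symm {a b : ℝ} {K : ℝ≥0} (h : StrongBound d a b K) : StrongBound d b a K :=
  fun k f g hf hg => by
    rw [hermitePairing_comm, mul_comm ((∫⁻ x, ‖f x‖ₑ ^ (1 / b)) ^ b)]
    exact h k g f hg hf

theorem DominatedBySet.lintegral_le {A : Set (EuclideanSpace ℝ (Fin d))} (hf : DominatedBySet f A)
    {p : ℝ} (hp : 0 < p) : ∫⁻ x, ‖f x‖ₑ ^ p ≤ volume A := by
  rw [← lintegral_indicator_one hf.measurableSet]
  refine lintegral_mono fun x => ?_
  have h := hf.norm_le x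
  by_cases hx : x ∈ A
  · rw [indicator_of_mem hx] at h ⊢
    rw [Pi.one_apply]
    refine ENNReal.rpow_le_one ?_ hp.le
    rw [← ofReal_norm]
    exact ENNReal.ofReal_le_one.2 h
  · rw [indicator_of_notMem hx] at h ⊢
    rw [norm_le_zero_iff.1 h, enorm_zero, ENNReal.zero_rpow_of_pos hp]

theorem DominatedBySet.bddRpow {A : Set (EuclideanSpace ℝ (Fin d))} (hf : DominatedBySet f A)
    {a : ℝ} (ha : 0 < a) : BddRpow f a where
  measurable := hf.measurable
  bdd := ⟨1, hf.norm_le_one⟩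
  lintegral_ne_top := ne_top_of_le_ne_top hf.volume_ne_top (hf.lintegral_le (by positivity))

theorem StrongBound.restrictedBound {a b : ℝ} {K : ℝ≥0} (ha : 0 < a) (hb : 0 < b)
    (h : StrongBound d a b K) : RestrictedBound d a b K := fun k f g A B hf hg => by
  refine (h k f g (hf.bddRpow ha) (hg.bddRpow hb)).trans ?_
  gcongr
  · exact hf.lintegral_le (by positivity)
  · exact hg.lintegral_le (by positivity)

theorem hermitePairing_eq_zero_of_lintegral_eq_zero {a : ℝ} (ha : 0 < a) (hf : Measurable f)
    (h : ∫⁻ x, ‖f x‖ₑ ^ (1 / a) = 0) (k : ℕ) (g : EuclideanSpace ℝ (Fin d) → ℂ) :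
    hermitePairing k f g = 0 := by
  rw [lintegral_eq_zero_iff (hf.enorm.pow_const _)] at h
  refine Finset.sum_eq_zero fun α _ => ?_
  have : hermiteCoeff f α = 0 := by
    refine integral_eq_zero_of_ae (h.mono fun x hx => ?_)
    have hx' : ‖f x‖ₑ = 0 := (ENNReal.rpow_eq_zero_iff_of_pos (by positivity)).1 hx
    simp only [enorm_eq_zero] at hx'
    simp [hx']
  rw [this, zero_mul]

/-- Rescaling to unit norm. -/
theorem BddRpow.exists_normalized {a : ℝ} (ha : 0 < a) (hf : BddRpow f a)
    (h0 : ∫⁻ x, ‖f x‖ₑ ^ (1 / a) ≠ 0) :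
    ∃ (c : ℂ) (f' : EuclideanSpace ℝ (Fin d) → ℂ), BddRpow f' a ∧ (f = fun x => c * f' x) ∧
      ‖c‖ₑ = (∫⁻ x, ‖f x‖ₑ ^ (1 / a)) ^ a ∧ ∫⁻ x, ‖f' x‖ₑ ^ (1 / a) ≤ 1 := by
  set J := ∫⁻ x, ‖f x‖ₑ ^ (1 / a) with hJ
  have hJt : J ≠ ∞ := hf.lintegral_ne_top
  have hN0 : J ^ a ≠ 0 := (ENNReal.rpow_pos (pos_iff_ne_zero.2 h0) hJt).ne'
  have hNt : J ^ a ≠ ∞ := ENNReal.rpow_ne_top_of_nonneg ha.le hJt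
  set c : ℂ := ((J ^ a).toReal : ℂ) with hc
  have hce : ‖c‖ₑ = J ^ a := by
    rw [hc, ← ofReal_norm, Complex.norm_real, Real.norm_of_nonneg ENNReal.toReal_nonneg,
      ENNReal.ofReal_toReal hNt]
  have hc0 : c ≠ 0 := by
    rw [← enorm_ne_zero, hce]; exact hN0
  refine ⟨c, fun x => c⁻¹ * f x, hf.const_mul ha _, ?_, hce, ?_⟩
  · ext x; rw [mul_inv_cancel_left₀ hc0]
  · have hp : (0 : ℝ) ≤ 1 / a := by positivity
    simp only [enorm_mul, ENNReal.mul_rpow_of_nonneg _ _ hp]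
    rw [lintegral_const_mul _ (hf.measurable.enorm.pow_const _), ← hJ, enorm_inv hc0, hce,
      ← ENNReal.rpow_neg, ← ENNReal.rpow_mul, mul_one_div, neg_div, div_self ha.ne',
      ENNReal.rpow_neg_one, ENNReal.inv_mul_cancel h0 hJt]

theorem strongBound_of_normalized {a b : ℝ} (ha : 0 < a) (hb : 0 < b) {K : ℝ≥0}
    (h : ∀ (k : ℕ) (f g : EuclideanSpace ℝ (Fin d) → ℂ), BddRpow f a → BddRpow g b →
      ∫⁻ x, ‖f x‖ₑ ^ (1 / a) ≤ 1 → ∫⁻ x, ‖g x‖ₑ ^ (1 / b) ≤ 1 → ‖hermitePairing k f g‖ₑ ≤ K) :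
    StrongBound d a b K := by
  intro k f g hf hg
  rcases eq_or_ne (∫⁻ x, ‖f x‖ₑ ^ (1 / a)) 0 with h0 | h0
  · rw [hermitePairing_eq_zero_of_lintegral_eq_zero ha hf.measurable h0, enorm_zero]
    exact zero_le
  rcases eq_or_ne (∫⁻ x, ‖g x‖ₑ ^ (1 / b)) 0 with h1 | h1
  · rw [hermitePairing_comm, hermitePairing_eq_zero_of_lintegral_eq_zero hb hg.measurable h1,
      enorm_zero]
    exact zero_le
  obtain ⟨c, f', hf', hfe, hc, hf1⟩ := hf.exists_normalized ha h0
  obtain ⟨e, g', hg', hge, he, hg1⟩ := hg.exists_normalized hb h1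
  rw [← hc, ← he, hfe, hge, hermitePairing_const_mul_left, hermitePairing_const_mul_right,
    enorm_mul, enorm_mul, ← mul_assoc, mul_comm (K : ℝ≥0∞)]
  gcongr
  exact h k f' g' hf' hg' hf1 hg1

/-- The normalised size `2 ^ (j / a) |{2 ^ j < |f| ≤ 2 ^ (j + 1)}|` of a level set. -/
noncomputable def levelMass (f : EuclideanSpace ℝ (Fin d) → ℂ) (a : ℝ) (j : ℤ) : ℝ≥0∞ :=
  (2 : ℝ≥0∞) ^ ((j : ℝ) / a) * volume (levelSet f j)

theorem tsum_levelMass_le {a : ℝ} (ha : 0 < a) (hf : Measurable f) :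
    ∑' j, levelMass f a j ≤ ∫⁻ x, ‖f x‖ₑ ^ (1 / a) := by
  calc ∑' j, levelMass f a j ≤ ∑' j, ∫⁻ x in levelSet f j, ‖f x‖ₑ ^ (1 / a) := by
        refine ENNReal.tsum_le_tsum fun j => ?_
        rw [levelMass, ← setLIntegral_const]
        refine setLIntegral_mono' (measurableSet_levelSet hf j) fun x hx => ?_
        rw [show (j : ℝ) / a = j * (1 / a) by ring, ENNReal.rpow_mul, ENNReal.rpow_intCast,
          ← enorm_two_zpow]
        refine ENNReal.rpow_le_rpow ?_ (by positivity)
        rw [enorm_le_iff_norm_le, norm_zpow, Complex.norm_ofNat]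
        exact hx.1.le
    _ = ∫⁻ x in ⋃ j, levelSet f j, ‖f x‖ₑ ^ (1 / a) :=
        (lintegral_iUnion (measurableSet_levelSet hf) disjoint_levelSet _).symm
    _ ≤ _ := setLIntegral_le_lintegral _ _

theorem volume_levelSet_eq {a : ℝ} (j : ℤ) :
    volume (levelSet f j) = (2 : ℝ≥0∞) ^ (-((j : ℝ) / a)) * levelMass f a j := by
  rw [levelMass, ← mul_assoc, ← ENNReal.rpow_add _ _ (by norm_num) (by norm_num), neg_add_cancel,
    ENNReal.rpow_zero, one_mul]

theorem volume_levelSet_ne_top {a : ℝ} (ha : 0 < a) (hf : BddRpow f a) (j : ℤ) :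
    volume (levelSet f j) ≠ ∞ := by
  rw [volume_levelSet_eq (a := a)]
  refine ENNReal.mul_ne_top (ENNReal.rpow_ne_top_of_ne_zero (by norm_num) (by norm_num)) ?_
  exact ENNReal.ne_top_of_tsum_ne_top
    (ne_top_of_le_ne_top hf.lintegral_ne_top (tsum_levelMass_le ha hf.measurable)) j

theorem BddRpow.enorm_hermitePairing_le_tsum {a : ℝ} (hf : BddRpow f a) (k : ℕ)
    (g : EuclideanSpace ℝ (Fin d) → ℂ) :
    ‖hermitePairing k f g‖ₑ ≤ ∑' j : ℤ, ‖hermitePairing k (levelPart f j) g‖ₑ := by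
  have hsum : HasSum (fun j : ℤ => hermitePairing k (levelPart f j) g) (hermitePairing k f g) :=
    hasSum_sum fun α _ => (hasSum_hermiteCoeff_levelPart hf.measurable
      (hf.integrable_mul_hermitePhi α)).mul_right _
  rw [← hsum.tsum_eq]
  exact enorm_tsum_le_tsum_enorm

theorem RestrictedBound.levelPart {a b : ℝ} {K : ℝ≥0} (h : RestrictedBound d a b K)
    (hf : Measurable f) (hg : Measurable g) {i j : ℤ} (hi : volume (levelSet f i) ≠ ∞)
    (hj : volume (levelSet g j) ≠ ∞) (k : ℕ) :
    ‖hermitePairing k (levelPart f i) (levelPart g j)‖ₑ ≤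
      K * ((2 : ℝ≥0∞) ^ (i + 1) * volume (levelSet f i) ^ a *
        ((2 : ℝ≥0∞) ^ (j + 1) * volume (levelSet g j) ^ b)) := by
  have h1 := h.levelPart_left hf hi (dominatedBySet_levelPart hg hj) k
  have e : _root_.levelPart g j =
      fun x => (2 : ℂ) ^ (j + 1) * (((2 : ℂ) ^ (j + 1))⁻¹ * _root_.levelPart g j x) := by
    ext x; rw [mul_inv_cancel_left₀ (zpow_ne_zero _ two_ne_zero)]
  rw [e, hermitePairing_const_mul_right, enorm_mul, enorm_two_zpow]
  exact (mul_le_mul_right h1 _).trans_eq (by ring)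

/-- Measures the contribution of a level at exponent a' in the normalization adapted to a. The power
2^(j(1 - a'/a)) is the gain or loss used for interpolation; the factor 2 comes from the upper end
2^(j+1) of the level. -/
theorem two_zpow_mul_volume_rpow {a a' : ℝ} (ha' : 0 ≤ a') (j : ℤ) :
    (2 : ℝ≥0∞) ^ (j + 1) * volume (levelSet f j) ^ a' =
      2 * ((2 : ℝ≥0∞) ^ ((j : ℝ) * (1 - a' / a)) * levelMass f a j ^ a') := by
  rw [volume_levelSet_eq (a := a), ENNReal.mul_rpow_of_nonneg _ _ ha', ← ENNReal.rpow_mul,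
    ← ENNReal.rpow_intCast, ← mul_assoc, ← ENNReal.rpow_add _ _ (by norm_num) (by norm_num),
    ← mul_assoc]
  congr 1
  nth_rw 2 [← ENNReal.rpow_one 2]
  rw [← ENNReal.rpow_add _ _ (by norm_num) (by norm_num)]
  congr 1
  push_cast
  ring

/-- Masses at most 1 and exponents at least 1/2 give X^a' Y^b' ≤ √X √Y ≤ X + Y. The bound becomes
linear in the masses, so the sums for f and g decouple. -/
theorem RestrictedBound.levelPart_normalized {a b a' b' : ℝ} {K : ℝ≥0}
    (h : RestrictedBound d a' b' K) (ha : 0 < a) (hb : 0 < b) (ha' : 1 / 2 ≤ a') (hb' : 1 / 2 ≤ b')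
    (hf : BddRpow f a) (hg : BddRpow g b)
    (hf1 : ∫⁻ x, ‖f x‖ₑ ^ (1 / a) ≤ 1) (hg1 : ∫⁻ x, ‖g x‖ₑ ^ (1 / b) ≤ 1) (k : ℕ) (i j : ℤ) :
    ‖hermitePairing k (_root_.levelPart f i) (_root_.levelPart g j)‖ₑ ≤
      4 * K * (2 : ℝ≥0∞) ^ ((i : ℝ) * (1 - a' / a) + (j : ℝ) * (1 - b' / b)) *
        (levelMass f a i + levelMass g b j) := by
  have h1 := h.levelPart hf.measurable hg.measurable (volume_levelSet_ne_top ha hf i)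
    (volume_levelSet_ne_top hb hg j) k
  rw [two_zpow_mul_volume_rpow (a := a) (by linarith),
    two_zpow_mul_volume_rpow (a := b) (by linarith)] at h1
  have hX : levelMass f a i ≤ 1 :=
    (ENNReal.le_tsum i).trans ((tsum_levelMass_le ha hf.measurable).trans hf1)
  have hY : levelMass g b j ≤ 1 :=
    (ENNReal.le_tsum j).trans ((tsum_levelMass_le hb hg.measurable).trans hg1)
  have hXY : levelMass f a i ^ a' * levelMass g b j ^ b' ≤ levelMass f a i + levelMass g b j := by
    set X := levelMass f a i
    set Y := levelMass g b j
    calc X ^ a' * Y ^ b' ≤ X ^ (1 / 2 : ℝ) * Y ^ (1 / 2 : ℝ) :=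
          mul_le_mul' (ENNReal.rpow_le_rpow_of_exponent_ge hX ha')
            (ENNReal.rpow_le_rpow_of_exponent_ge hY hb')
      _ ≤ (X + Y) ^ (1 / 2 : ℝ) * (X + Y) ^ (1 / 2 : ℝ) := by
          gcongr
          · exact le_self_add
          · exact le_add_self
      _ = X + Y := by
          rw [← ENNReal.rpow_add_of_nonneg _ _ (by norm_num) (by norm_num)]
          norm_num
  refine h1.trans ?_
  rw [ENNReal.rpow_add _ _ (by norm_num) (by norm_num)]
  calc _ = 4 * K * ((2 : ℝ≥0∞) ^ ((i : ℝ) * (1 - a' / a)) * (2 : ℝ≥0∞) ^ ((j : ℝ) * (1 - b' / b))) *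
        (levelMass f a i ^ a' * levelMass g b j ^ b') := by ring
    _ ≤ _ := by gcongr

/-- Restricted weak type bounds at two points whose coordinates both differ interpolate to
strong type bounds in between. -/
theorem exists_strongBound_of_restrictedBound {a₀ b₀ a₁ b₁ θ : ℝ} {K₀ K₁ : ℝ≥0}
    (h₀ : RestrictedBound d a₀ b₀ K₀) (h₁ : RestrictedBound d a₁ b₁ K₁)
    (ha₀ : 1 / 2 ≤ a₀) (hb₀ : 1 / 2 ≤ b₀) (ha₁ : 1 / 2 ≤ a₁) (hb₁ : 1 / 2 ≤ b₁)
    (ha : a₀ ≠ a₁) (hb : b₀ ≠ b₁) (hθ0 : 0 < θ) (hθ1 : θ < 1) :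
    ∃ K, StrongBound d ((1 - θ) * a₀ + θ * a₁) ((1 - θ) * b₀ + θ * b₁) K := by
  set a := (1 - θ) * a₀ + θ * a₁ with hadef
  set b := (1 - θ) * b₀ + θ * b₁ with hbdef
  have ha0 : 0 < a := by nlinarith
  have hb0 : 0 < b := by nlinarith
  set u : ℝ := (a₁ - a₀) / a with hu
  set v : ℝ := (b₁ - b₀) / b with hv
  have hu0 : u ≠ 0 := div_ne_zero (sub_ne_zero.2 ha.symm) ha0.ne'
  have hv0 : v ≠ 0 := div_ne_zero (sub_ne_zero.2 hb.symm) hb0.ne'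
  set η := min θ (1 - θ) with hη
  have hη0 : 0 < η := lt_min hθ0 (by linarith)
  obtain ⟨S, hS⟩ := exists_tsum_two_rpow_neg_abs_le hη0 hv0
  obtain ⟨T, hT⟩ := exists_tsum_two_rpow_neg_abs_le hη0 hu0
  refine ⟨4 * (K₀ + K₁) * (S + T), strongBound_of_normalized ha0 hb0 fun k f g hf hg hf1 hg1 => ?_⟩
  have hterm : ∀ i j : ℤ, ‖hermitePairing k (levelPart f i) (levelPart g j)‖ₑ ≤
      4 * (K₀ + K₁) * ((2 : ℝ≥0∞) ^ (-(η * |u * i + v * j|)) *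
        (levelMass f a i + levelMass g b j)) := by
    intro i j
    -- Both endpoints see the same linear form ui + vj, multiplied by θ at the first and by -(1 - θ)
    -- at the second.
    have e0 : (i : ℝ) * (1 - a₀ / a) + (j : ℝ) * (1 - b₀ / b) = θ * (u * i + v * j) := by
      have h1 : 1 - a₀ / a = θ * u := by rw [hu]; field_simp; rw [hadef]; ring
      have h2 : 1 - b₀ / b = θ * v := by rw [hv]; field_simp; rw [hbdef]; ring
      rw [h1, h2]; ring
    have e1 : (i : ℝ) * (1 - a₁ / a) + (j : ℝ) * (1 - b₁ / b) = -((1 - θ) * (u * i + v * j)) := by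
      have h1 : 1 - a₁ / a = -((1 - θ) * u) := by rw [hu]; field_simp; rw [hadef]; ring
      have h2 : 1 - b₁ / b = -((1 - θ) * v) := by rw [hv]; field_simp; rw [hbdef]; ring
      rw [h1, h2]; ring
    -- For each pair of levels use the endpoint whose exponent is nonpositive; this yields decay in
    -- |ui + vj| at rate η = min(θ, 1 - θ).
    rcases le_total 0 (u * i + v * j) with hw | hw
    · refine (h₁.levelPart_normalized ha0 hb0 ha₁ hb₁ hf hg hf1 hg1 k i j).trans ?_
      rw [e1, abs_of_nonneg hw, mul_assoc]
      gcongr 4 * ?_ * (?_ * ?_)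
      · exact le_add_self
      · refine ENNReal.rpow_le_rpow_of_exponent_le (by norm_num) (neg_le_neg ?_)
        exact mul_le_mul_of_nonneg_right (min_le_right _ _) hw
      · exact le_rfl
    · refine (h₀.levelPart_normalized ha0 hb0 ha₀ hb₀ hf hg hf1 hg1 k i j).trans ?_
      rw [e0, abs_of_nonpos hw, mul_assoc]
      gcongr 4 * ?_ * (?_ * ?_)
      · exact le_self_add
      · refine ENNReal.rpow_le_rpow_of_exponent_le (by norm_num) ?_
        rw [mul_neg, neg_neg]
        exact mul_le_mul_of_nonpos_right (min_le_left _ _) hw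
      · exact le_rfl
  have hX : ∑' i, levelMass f a i ≤ 1 := (tsum_levelMass_le ha0 hf.measurable).trans hf1
  have hY : ∑' j, levelMass g b j ≤ 1 := (tsum_levelMass_le hb0 hg.measurable).trans hg1
  set κ : ℤ → ℤ → ℝ≥0∞ := fun i j => (2 : ℝ≥0∞) ^ (-(η * |u * i + v * j|)) with hκ
  -- The masses of f require summing the kernel in j, those of g in i. This is where v ≠ 0 and u ≠ 0
  -- enter, that is, why both coordinates of the endpoints must differ.
  have h2 : ∑' (i : ℤ) (j : ℤ), κ i j * levelMass f a i ≤ S := by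
    calc _ = ∑' i : ℤ, (∑' j : ℤ, κ i j) * levelMass f a i := by simp_rw [ENNReal.tsum_mul_right]
      _ ≤ ∑' i : ℤ, S * levelMass f a i :=
          ENNReal.tsum_le_tsum fun i => mul_le_mul_left (hS _) _
      _ ≤ S := by rw [ENNReal.tsum_mul_left]; exact mul_le_of_le_one_right' hX
  have h3 : ∑' (i : ℤ) (j : ℤ), κ i j * levelMass g b j ≤ T := by
    rw [ENNReal.tsum_comm]
    calc _ = ∑' j : ℤ, (∑' i : ℤ, κ i j) * levelMass g b j := by simp_rw [ENNReal.tsum_mul_right]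
      _ ≤ ∑' j : ℤ, T * levelMass g b j := by
          refine ENNReal.tsum_le_tsum fun j => mul_le_mul_left ?_ _
          simp_rw [hκ, add_comm (u * _)]
          exact hT _
      _ ≤ T := by rw [ENNReal.tsum_mul_left]; exact mul_le_of_le_one_right' hY
  calc ‖hermitePairing k f g‖ₑ ≤ ∑' i : ℤ, ‖hermitePairing k (levelPart f i) g‖ₑ :=
        hf.enorm_hermitePairing_le_tsum k g
    _ ≤ ∑' (i : ℤ) (j : ℤ), ‖hermitePairing k (levelPart f i) (levelPart g j)‖ₑ := by
        refine ENNReal.tsum_le_tsum fun i => ?_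
        rw [hermitePairing_comm]
        refine (hg.enorm_hermitePairing_le_tsum k _).trans_eq ?_
        simp_rw [hermitePairing_comm k (levelPart g _)]
    _ ≤ ∑' (i : ℤ) (j : ℤ), 4 * (K₀ + K₁) * (κ i j * (levelMass f a i + levelMass g b j)) :=
        ENNReal.tsum_le_tsum fun i => ENNReal.tsum_le_tsum fun j => hterm i j
    _ = 4 * (K₀ + K₁) * (∑' (i : ℤ) (j : ℤ), κ i j * levelMass f a i +
          ∑' (i : ℤ) (j : ℤ), κ i j * levelMass g b j) := by
        simp_rw [ENNReal.tsum_mul_left, mul_add, ENNReal.tsum_add, mul_add]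
    _ ≤ _ := by
        push_cast
        gcongr

end StrongBound

/-! ### Filling the pentagon -/

section Pentagon

variable {d : ℕ} {f g : EuclideanSpace ℝ (Fin d) → ℂ}

theorem hermitePairing_conj_self (k : ℕ) (f : EuclideanSpace ℝ (Fin d) → ℂ) :
    hermitePairing k f (fun x => (starRingEnd ℂ) (f x)) =
      ((∑ α ∈ hermiteIndex d (2 * k + d), ‖hermiteCoeff f α‖ ^ 2 : ℝ) : ℂ) := by
  rw [hermitePairing, Complex.ofReal_sum]
  refine Finset.sum_congr rfl fun α _ => ?_
  rw [hermiteCoeff_conj, Complex.mul_conj, Complex.normSq_eq_norm_sq]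

theorem enorm_hermitePairing_conj_self (k : ℕ) (f : EuclideanSpace ℝ (Fin d) → ℂ) :
    ‖hermitePairing k f (fun x => (starRingEnd ℂ) (f x))‖ₑ =
      ENNReal.ofReal (∑ α ∈ hermiteIndex d (2 * k + d), ‖hermiteCoeff f α‖ ^ 2) := by
  rw [hermitePairing_conj_self, ← ofReal_norm, Complex.norm_real,
    Real.norm_of_nonneg (Finset.sum_nonneg fun _ _ => sq_nonneg _)]

/-- Cauchy–Schwarz for the positive form `⟨Π f, f⟩`. -/
theorem enorm_hermitePairing_sq_le (k : ℕ) (f g : EuclideanSpace ℝ (Fin d) → ℂ) :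
    ‖hermitePairing k f g‖ₑ ^ 2 ≤ ‖hermitePairing k f (fun x => (starRingEnd ℂ) (f x))‖ₑ *
      ‖hermitePairing k g (fun x => (starRingEnd ℂ) (g x))‖ₑ := by
  rw [enorm_hermitePairing_conj_self, enorm_hermitePairing_conj_self,
    ← ENNReal.ofReal_mul (Finset.sum_nonneg fun _ _ => sq_nonneg _), ← ofReal_norm,
    ← ENNReal.ofReal_pow (norm_nonneg _)]
  refine ENNReal.ofReal_le_ofReal ?_
  refine le_trans ?_ (Finset.sum_mul_sq_le_sq_mul_sq _ _ _)
  refine pow_le_pow_left₀ (norm_nonneg _) ((norm_sum_le _ _).trans_eq ?_) 2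
  exact Finset.sum_congr rfl fun α _ => norm_mul _ _

theorem BddRpow.conj {a : ℝ} (hf : BddRpow f a) : BddRpow (fun x => (starRingEnd ℂ) (f x)) a where
  measurable := Complex.continuous_conj.measurable.comp hf.measurable
  bdd := by simpa only [RCLike.norm_conj] using hf.bdd
  lintegral_ne_top := by simpa only [RCLike.enorm_conj] using hf.lintegral_ne_top

theorem lintegral_enorm_conj_rpow (f : EuclideanSpace ℝ (Fin d) → ℂ) (p : ℝ) :
    ∫⁻ x, ‖(starRingEnd ℂ) (f x)‖ₑ ^ p = ∫⁻ x, ‖f x‖ₑ ^ p := by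
  simp only [RCLike.enorm_conj]

/-- A TT* argument: Π is a positive form, so the off-diagonal pairing is controlled by the geometric
mean of two diagonal ones. It reaches points such as 𝔈, which share a coordinate with the L² point,
where interpolation along a segment is not available. -/
theorem StrongBound.of_diagonal {a b : ℝ} {K L : ℝ≥0} (ha : StrongBound d a a K)
    (hb : StrongBound d b b L) : StrongBound d a b (NNReal.sqrt (K * L)) := by
  intro k f g hf hg
  have h1 := ha k f _ hf hf.conj
  have h2 := hb k g _ hg hg.conj
  rw [lintegral_enorm_conj_rpow] at h1 h2
  rw [← ENNReal.pow_le_pow_left_iff two_ne_zero]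
  refine (enorm_hermitePairing_sq_le k f g).trans ((mul_le_mul' h1 h2).trans_eq ?_)
  have e : ((NNReal.sqrt (K * L) : ℝ≥0) : ℝ≥0∞) ^ 2 = K * L := by
    rw [← ENNReal.coe_pow, NNReal.sq_sqrt, ENNReal.coe_mul]
  rw [mul_pow, e]
  ring

theorem BddRpow.memLp_two (hf : BddRpow f (1 / 2)) : MemLp f 2 := by
  refine ⟨hf.measurable.aestronglyMeasurable, ?_⟩
  rw [eLpNorm_eq_lintegral_rpow_enorm_toReal two_ne_zero ENNReal.ofNat_ne_top]
  have h := hf.lintegral_ne_top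
  rw [one_div_one_div] at h
  exact ENNReal.rpow_lt_top_of_nonneg (by positivity) (by simpa using h)

theorem BddRpow.sum_norm_hermiteCoeff_sq_le (hf : BddRpow f (1 / 2)) (s : Finset (Fin d → ℕ)) :
    ENNReal.ofReal (∑ α ∈ s, ‖hermiteCoeff f α‖ ^ 2) ≤ ∫⁻ x, ‖f x‖ₑ ^ (1 / (1 / 2) : ℝ) := by
  have h := hf.memLp_two
  have h1 := ((summable_norm_hermiteCoeff_sq h).sum_le_tsum s fun _ _ => sq_nonneg _).trans
    (tsum_norm_hermiteCoeff_sq_le h)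
  refine (ENNReal.ofReal_le_ofReal h1).trans_eq ?_
  rw [ofReal_integral_eq_lintegral_ofReal
    ((memLp_two_iff_integrable_sq_norm hf.measurable.aestronglyMeasurable).1 h)
    (Filter.Eventually.of_forall fun _ => sq_nonneg _)]
  refine lintegral_congr fun x => ?_
  rw [one_div_one_div, ENNReal.ofReal_pow (norm_nonneg _), ofReal_norm, ENNReal.rpow_ofNat]

/-- Cauchy–Schwarz for the form, then Bessel's inequality for each factor. -/
theorem strongBound_half : StrongBound d (1 / 2) (1 / 2) 1 := by
  intro k f g hf hg
  rw [← ENNReal.pow_le_pow_left_iff two_ne_zero]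
  refine (enorm_hermitePairing_sq_le k f g).trans ?_
  rw [enorm_hermitePairing_conj_self, enorm_hermitePairing_conj_self]
  refine (mul_le_mul' (hf.sum_norm_hermiteCoeff_sq_le _) (hg.sum_norm_hermiteCoeff_sq_le _)).trans ?_
  have e : ∀ x : ℝ≥0∞, (x ^ (1 / 2 : ℝ)) ^ 2 = x := fun x => by
    rw [← ENNReal.rpow_natCast, ← ENNReal.rpow_mul]; norm_num
  rw [ENNReal.coe_one, one_mul, mul_pow, e, e]

/-- Interpolation with the position of the point given implicitly. -/
theorem exists_strongBound_of_mem_openSegment {a₀ b₀ a₁ b₁ a b : ℝ}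
    (h₀ : ∃ K, RestrictedBound d a₀ b₀ K) (h₁ : ∃ K, RestrictedBound d a₁ b₁ K)
    (ha₀ : 1 / 2 ≤ a₀) (hb₀ : 1 / 2 ≤ b₀) (ha₁ : 1 / 2 ≤ a₁) (hb₁ : 1 / 2 ≤ b₁)
    (ha : a₀ ≠ a₁) (hb : b₀ ≠ b₁) {θ : ℝ} (hθ0 : 0 < θ) (hθ1 : θ < 1)
    (hea : a = (1 - θ) * a₀ + θ * a₁) (heb : b = (1 - θ) * b₀ + θ * b₁) :
    ∃ K, StrongBound d a b K := by
  obtain ⟨K₀, h₀⟩ := h₀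
  obtain ⟨K₁, h₁⟩ := h₁
  rw [hea, heb]
  exact exists_strongBound_of_restrictedBound h₀ h₁ ha₀ hb₀ ha₁ hb₁ ha hb hθ0 hθ1

/-- The strong type bounds on the line through `𝔉` and `𝔉'`. -/
theorem exists_strongBound_of_add_eq (hd : 3 ≤ d) {a b : ℝ} (hab : a + b = 1 + 2 / d)
    (ha : a < ((d : ℝ) ^ 2 + 2 * d - 4) / (2 * d * (d - 1)))
    (hb : b < ((d : ℝ) ^ 2 + 2 * d - 4) / (2 * d * (d - 1))) : ∃ K, StrongBound d a b K := by
  have hd3 : (3 : ℝ) ≤ d := by exact_mod_cast hd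
  have hF := restrictedBound_F hd
  set A : ℝ := ((d : ℝ) ^ 2 + 2 * d - 4) / (2 * d * (d - 1)) with hA
  set B : ℝ := (d : ℝ) / (2 * (d - 1)) with hB
  have hd1 : (d : ℝ) - 1 ≠ 0 := by linarith
  have hd0 : (d : ℝ) ≠ 0 := by linarith
  have hAB : A + B = 1 + 2 / d := by rw [hA, hB]; field_simp; ring
  have hBh : 1 / 2 ≤ B := by rw [hB, div_le_div_iff₀ (by norm_num) (by linarith)]; linarith
  have hlt : B < A := by linarith
  refine exists_strongBound_of_mem_openSegment ⟨_, hF⟩ ⟨_, hF.symm⟩ (by linarith) hBh hBh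
    (by linarith) hlt.ne' hlt.ne (θ := (A - a) / (A - B)) (div_pos (by linarith) (by linarith))
    ((div_lt_one (by linarith)).2 (by linarith)) ?_ ?_
  · have : A - B ≠ 0 := by linarith
    field_simp; ring
  · have : A - B ≠ 0 := by linarith
    have : b = A + B - a := by linarith
    rw [this]
    field_simp; ring

/-- The upper end is the midpoint of 𝔉 and 𝔉', strictly between them because d > 2; below it one
interpolates with L² along the diagonal, where both coordinates move. -/
theorem exists_strongBound_diagonal (hd : 3 ≤ d) {a : ℝ} (h1 : 1 / 2 ≤ a)
    (h2 : a ≤ 1 / 2 + 1 / d) : ∃ K, StrongBound d a a K := by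
  have hd3 : (3 : ℝ) ≤ d := by exact_mod_cast hd
  have hd0 : (0 : ℝ) < 1 / d := by positivity
  have hM : ∃ K, StrongBound d (1 / 2 + 1 / d : ℝ) (1 / 2 + 1 / d) K := by
    have : (1 / 2 + 1 / d : ℝ) < ((d : ℝ) ^ 2 + 2 * d - 4) / (2 * d * (d - 1)) := by
      rw [lt_div_iff₀ (by nlinarith)]
      have : (d : ℝ) ≠ 0 := by linarith
      field_simp
      nlinarith
    exact exists_strongBound_of_add_eq hd (by ring) this this
  rcases h1.eq_or_lt with rfl | h1
  · exact ⟨1, strongBound_half⟩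
  rcases h2.eq_or_lt with rfl | h2
  · exact hM
  obtain ⟨K, hK⟩ := hM
  refine exists_strongBound_of_mem_openSegment
    ⟨1, strongBound_half.restrictedBound (by norm_num) (by norm_num)⟩
    ⟨K, hK.restrictedBound (by positivity) (by positivity)⟩ le_rfl le_rfl (by linarith)
    (by linarith) (by linarith) (by linarith) (θ := d * (a - 1 / 2)) (by nlinarith) ?_ ?_ ?_
  · calc d * (a - 1 / 2) < d * (1 / d) := by gcongr; linarith
      _ = 1 := by field_simp
  all_goals field_simp; ring

theorem exists_strongBound_square (hd : 3 ≤ d) {a b : ℝ} (ha1 : 1 / 2 ≤ a)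
    (ha2 : a ≤ 1 / 2 + 1 / d) (hb1 : 1 / 2 ≤ b) (hb2 : b ≤ 1 / 2 + 1 / d) :
    ∃ K, StrongBound d a b K := by
  obtain ⟨K, hK⟩ := exists_strongBound_diagonal hd ha1 ha2
  obtain ⟨L, hL⟩ := exists_strongBound_diagonal hd hb1 hb2
  exact ⟨_, hK.of_diagonal hL⟩

/-- The triangle with vertices `𝔈`, `𝔉` and the midpoint of `𝔉`, `𝔉'`. -/
theorem exists_strongBound_triangle (hd : 3 ≤ d) {a b : ℝ} (ha : 1 / 2 + 1 / d < a)
    (hb : 1 / 2 ≤ b) (hab : a + b ≤ 1 + 2 / d)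
    (hline : (d : ℝ) * (a - (1 / 2 + 1 / d)) ≤ (d - 2) * (b - 1 / 2))
    (hne : a ≠ ((d : ℝ) ^ 2 + 2 * d - 4) / (2 * d * (d - 1)) ∨ b ≠ (d : ℝ) / (2 * (d - 1))) :
    ∃ K, StrongBound d a b K := by
  have hd3 : (3 : ℝ) ≤ d := by exact_mod_cast hd
  have hF := restrictedBound_F hd
  have hline' := fun (x y : ℝ) (h : x + y = 1 + 2 / d)
      (hl : (d : ℝ) * (x - (1 / 2 + 1 / d)) ≤ (d - 2) * (y - 1 / 2)) =>
    show x ≤ ((d : ℝ) ^ 2 + 2 * d - 4) / (2 * d * (d - 1)) by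
      have : y = 1 + 2 / d - x := by linarith
      rw [le_div_iff₀ (by nlinarith)]
      rw [this] at hl
      have hd0 : (d : ℝ) ≠ 0 := by linarith
      field_simp at hl
      nlinarith
  set A : ℝ := ((d : ℝ) ^ 2 + 2 * d - 4) / (2 * d * (d - 1)) with hA
  set B : ℝ := (d : ℝ) / (2 * (d - 1)) with hB
  have hd1 : (d : ℝ) - 1 ≠ 0 := by linarith
  have hd0 : (d : ℝ) ≠ 0 := by linarith
  have hdpos : (0 : ℝ) < 1 / d := by positivity
  have h2d : (2 : ℝ) / d = 1 / d + 1 / d := by ring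
  have hAB : A + B = 1 + 2 / d := by rw [hA, hB]; field_simp; ring
  have hBh : 1 / 2 < B := by rw [hB, div_lt_div_iff₀ (by norm_num) (by linarith)]; linarith
  have honline : ∀ x y : ℝ, 1 / 2 + 1 / d < x → x + y = 1 + 2 / d →
      (d : ℝ) * (x - (1 / 2 + 1 / d)) ≤ (d - 2) * (y - 1 / 2) → (x ≠ A ∨ y ≠ B) →
      ∃ K, StrongBound d x y K := by
    intro x y hx hxy hl hn
    have hxA := hline' x y hxy hl
    have hxne : x ≠ A := by
      rintro rfl
      exact hn.elim (fun h => h rfl) fun h => h (by linarith)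
    have hlt := lt_of_le_of_ne hxA hxne
    exact exists_strongBound_of_add_eq hd hxy hlt (by linarith)
  rcases hab.eq_or_lt with hab | hab
  · exact honline a b ha hab hline hne
  have hpos : 0 < a - (1 / 2 + 1 / d) := by linarith
  have hb' : 0 < b - 1 / 2 := by
    by_contra hcon
    have : b - 1 / 2 = 0 := by linarith
    rw [this, mul_zero] at hline
    nlinarith
  -- The position of (a, b) on the segment from 𝔈 (w = 0) to a point (x, y) of the line 𝔉𝔉' (w = 1):
  -- both displacements from 𝔈 are divided by w, and w is fixed by x + y = 1 + 2/d.
  set w := d * ((a - (1 / 2 + 1 / d)) + (b - 1 / 2)) with hw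
  have hw0 : 0 < w := mul_pos (by linarith) (by linarith)
  have hw1 : w < 1 := by
    calc w < d * (1 / d) := mul_lt_mul_of_pos_left (by linarith) (by linarith)
      _ = 1 := by field_simp
  set x := 1 / 2 + 1 / d + (a - (1 / 2 + 1 / d)) / w with hx
  set y := 1 / 2 + (b - 1 / 2) / w with hy
  have hx1 : 0 < (a - (1 / 2 + 1 / d)) / w := div_pos hpos hw0
  have hy1 : 0 < (b - 1 / 2) / w := div_pos hb' hw0
  have hxy : x + y = 1 + 2 / d := by
    have : (a - (1 / 2 + 1 / d)) / w + (b - 1 / 2) / w = 1 / d := by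
      rw [← add_div, div_eq_div_iff hw0.ne' hd0, hw]; ring
    rw [hx, hy]; linarith
  have hxl : (d : ℝ) * (x - (1 / 2 + 1 / d)) ≤ (d - 2) * (y - 1 / 2) := by
    rw [hx, hy, add_sub_cancel_left, add_sub_cancel_left, ← mul_div_assoc, ← mul_div_assoc]
    gcongr
  have hZ : ∃ K, RestrictedBound d x y K := by
    by_cases hn : x ≠ A ∨ y ≠ B
    · obtain ⟨K, hK⟩ := honline x y (by linarith) hxy hxl hn
      exact ⟨K, hK.restrictedBound (by linarith) (by linarith)⟩
    · push Not at hn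
      rw [hn.1, hn.2]
      exact ⟨_, hF⟩
  obtain ⟨K, hK⟩ := exists_strongBound_square hd (a := 1 / 2 + 1 / d) (b := 1 / 2) (by linarith)
    le_rfl le_rfl (by linarith)
  refine exists_strongBound_of_mem_openSegment ⟨K, hK.restrictedBound (by linarith) (by norm_num)⟩
    hZ (by linarith) le_rfl (by linarith) (by linarith) (by linarith) (by linarith) hw0 hw1 ?_ ?_
  · rw [hx, mul_add w, mul_div_cancel₀ _ hw0.ne']; ring
  · rw [hy, mul_add w, mul_div_cancel₀ _ hw0.ne']; ring

/-- If both coordinates are at most 1/2 + 1/d the point lies in the square; otherwise it lies in the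
triangle at 𝔉 or, after the swap, in its mirror image. -/
theorem exists_strongBound_of_halfPlanes (hd : 3 ≤ d) {a b : ℝ} (ha : 1 / 2 ≤ a)
    (hb : 1 / 2 ≤ b) (hab : a + b ≤ 1 + 2 / d)
    (h1 : (d : ℝ) * (a - (1 / 2 + 1 / d)) ≤ (d - 2) * (b - 1 / 2))
    (h2 : (d : ℝ) * (b - (1 / 2 + 1 / d)) ≤ (d - 2) * (a - 1 / 2))
    (hF : a ≠ ((d : ℝ) ^ 2 + 2 * d - 4) / (2 * d * (d - 1)) ∨ b ≠ (d : ℝ) / (2 * (d - 1)))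
    (hF' : b ≠ ((d : ℝ) ^ 2 + 2 * d - 4) / (2 * d * (d - 1)) ∨ a ≠ (d : ℝ) / (2 * (d - 1))) :
    ∃ K, StrongBound d a b K := by
  rcases lt_or_ge (1 / 2 + 1 / d : ℝ) a with h | h
  · exact exists_strongBound_triangle hd h hb hab h1 hF
  rcases lt_or_ge (1 / 2 + 1 / d : ℝ) b with h' | h'
  · obtain ⟨K, hK⟩ := exists_strongBound_triangle hd h' ha (by linarith) h2 hF'
    exact ⟨K, hK.symm⟩
  exact exists_strongBound_square hd ha h hb h'

/-- The five half-planes are bounded by the sides of the pentagon, written in (1/p, 1 - 1/q): two L²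
sides, the side 𝔉𝔉', and the sides 𝔈𝔉 and 𝔈'𝔉'. Checking the vertices suffices by convexity. -/
theorem convexHull_pentagon_subset (hd : 3 ≤ d) :
    convexHull ℝ {pointE d, dualPoint (pointE d), pointF d, dualPoint (pointF d), (1 / 2, 1 / 2)} ⊆
      {X : ℝ × ℝ | 1 / 2 ≤ X.1 ∧ 1 / 2 ≤ 1 - X.2 ∧ X.1 + (1 - X.2) ≤ 1 + 2 / d ∧
        (d : ℝ) * (X.1 - (1 / 2 + 1 / d)) ≤ (d - 2) * (1 - X.2 - 1 / 2) ∧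
        (d : ℝ) * (1 - X.2 - (1 / 2 + 1 / d)) ≤ (d - 2) * (X.1 - 1 / 2)} := by
  have hd3 : (3 : ℝ) ≤ d := by exact_mod_cast hd
  refine convexHull_min ?_ ?_
  · have hE : ((d : ℝ) + 2) / (2 * d) = 1 / 2 + 1 / d := by field_simp
    have hd1 : (d : ℝ) - 1 ≠ 0 := by linarith
    have hd0 : (d : ℝ) ≠ 0 := by linarith
    have hF1 : ((d : ℝ) ^ 2 + 2 * d - 4) / (2 * d * (d - 1)) =
        1 / 2 + 1 / d + (d - 2) / (2 * (d * (d - 1))) := by field_simp; ring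
    have hF2 : ((d : ℝ) - 2) / (2 * (d - 1)) = 1 / 2 - d / (2 * (d * (d - 1))) := by
      field_simp; ring
    have hdpos : (0 : ℝ) < 1 / d := by positivity
    set w : ℝ := 1 / (2 * (d * (d - 1))) with hw
    have hwpos : 0 < w := one_div_pos.2 (by nlinarith)
    have e1 : ((d : ℝ) - 2) / (2 * (d * (d - 1))) = (d - 2) * w := by rw [hw]; ring
    have e2 : (d : ℝ) / (2 * (d * (d - 1))) = d * w := by rw [hw]; ring
    have e3 : 2 * (d - 1) * w = (1 : ℝ) / d := by rw [hw]; field_simp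
    have e4 : (2 : ℝ) / d = 2 * (1 / d) := by ring
    have e5 : (d : ℝ) * (1 / d) = 1 := by field_simp
    rw [e1] at hF1
    rw [e2] at hF2
    set i : ℝ := 1 / d with hi
    have hi3 : i ≤ 1 / 3 := by rw [hi]; gcongr
    have hdw : 0 < d * w := by positivity
    have hdw2 : 0 < (d - 2) * w := mul_pos (by linarith) hwpos
    intro X hX
    simp only [mem_insert_iff, mem_singleton_iff] at hX
    rcases hX with rfl | rfl | rfl | rfl | rfl
    · simp only [pointE, mem_ofPred_eq, hE, e4]
      refine ⟨?_, ?_, ?_, ?_, ?_⟩ <;> linarith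
    · simp only [pointE, dualPoint, mem_ofPred_eq, hE, e4]
      refine ⟨?_, ?_, ?_, ?_, ?_⟩ <;> linarith
    · simp only [pointF, mem_ofPred_eq, hF1, hF2, e4]
      refine ⟨?_, ?_, ?_, ?_, ?_⟩ <;> linarith
    · simp only [pointF, dualPoint, mem_ofPred_eq, hF1, hF2, e4]
      refine ⟨?_, ?_, ?_, ?_, ?_⟩ <;> linarith
    · simp only [mem_ofPred_eq, e4]
      refine ⟨?_, ?_, ?_, ?_, ?_⟩ <;> linarith
  · rintro ⟨x, y⟩ ⟨h1, h2, h3, h4, h5⟩ ⟨x', y'⟩ ⟨h1', h2', h3', h4', h5'⟩ s t hs ht hst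
    simp only [mem_ofPred_eq, Prod.smul_mk, Prod.mk_add_mk, smul_eq_mul] at *
    obtain rfl : t = 1 - s := by linarith
    refine ⟨?_, ?_, ?_, ?_, ?_⟩
    · nlinarith [mul_le_mul_of_nonneg_left h1 hs, mul_le_mul_of_nonneg_left h1' ht]
    · nlinarith [mul_le_mul_of_nonneg_left h2 hs, mul_le_mul_of_nonneg_left h2' ht]
    · nlinarith [mul_le_mul_of_nonneg_left h3 hs, mul_le_mul_of_nonneg_left h3' ht]
    · nlinarith [mul_le_mul_of_nonneg_left h4 hs, mul_le_mul_of_nonneg_left h4' ht]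
    · nlinarith [mul_le_mul_of_nonneg_left h5 hs, mul_le_mul_of_nonneg_left h5' ht]

/-- Duality: a strong bilinear bound bounds `Π f` in `L^q`. -/
theorem StrongBound.lintegral_hermiteProj_le {a b : ℝ} {K : ℝ≥0} (h : StrongBound d a b K)
    (hb : 1 / 2 ≤ b) (hb1 : b < 1) (hf : BddRpow f a) (k : ℕ) :
    (∫⁻ x, ‖hermiteProj d (2 * k + d) f x‖ₑ ^ (1 / (1 - b))) ^ (1 - b) ≤
      K * (∫⁻ x, ‖f x‖ₑ ^ (1 / a)) ^ a := by
  set F := hermiteProj d (2 * k + d) f with hF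
  have hFc : Continuous F := continuous_hermiteProj k f
  obtain ⟨M, hM⟩ := exists_norm_hermiteProj_le k f
  rw [← hF] at hM
  have hM0 : 0 ≤ M := (norm_nonneg _).trans (hM 0)
  set r : ℝ := 1 / (1 - b) with hr
  have hr2 : 2 ≤ r := by rw [hr, le_div_iff₀ (by linarith)]; linarith
  have hrb : (r - 1) * (1 / b) = r := by
    have : 1 - b ≠ 0 := by linarith
    have : b ≠ 0 := by linarith
    rw [hr]; field_simp; ring
  set J := ∫⁻ x, ‖F x‖ₑ ^ r with hJ
  have hmem : MemLp F (ENNReal.ofReal r) :=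
    memLp_hermiteProj k f (ENNReal.one_le_ofReal.2 (by linarith))
  have hJt : J ≠ ∞ := by
    have := lintegral_rpow_enorm_lt_top_of_eLpNorm_lt_top (by simpa using by linarith)
      ENNReal.ofReal_ne_top hmem.2
    rw [ENNReal.toReal_ofReal (by linarith)] at this
    exact this.ne
  -- The extremizer in Hölder's inequality: Fg = |F|^r and |g|^(1/b) = |F|^r, so the bilinear bound
  -- becomes J ≲ J^b, and J is finite and can be divided out.
  set g : EuclideanSpace ℝ (Fin d) → ℂ := fun x =>
    (starRingEnd ℂ) (F x) * ((‖F x‖ ^ (r - 2) : ℝ) : ℂ) with hg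
  have hgc : Continuous g := (Complex.continuous_conj.comp hFc).mul
    (Complex.continuous_ofReal.comp (hFc.norm.rpow_const fun _ => Or.inr (by linarith)))
  have hgn : ∀ x, ‖g x‖ = ‖F x‖ ^ (r - 1) := by
    intro x
    rw [hg, norm_mul, RCLike.norm_conj, Complex.norm_real, Real.norm_of_nonneg (by positivity)]
    rcases (norm_nonneg (F x)).eq_or_lt with h0 | h0
    · rw [← h0, zero_mul, Real.zero_rpow (by linarith)]
    · rw [← Real.rpow_one_add' h0.le (by linarith)]; congr 1; ring
  have hge : ∀ x, ‖g x‖ₑ ^ (1 / b) = ‖F x‖ₑ ^ r := by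
    intro x
    rw [← ofReal_norm, hgn, ← ENNReal.ofReal_rpow_of_nonneg (norm_nonneg _) (by linarith),
      ofReal_norm, ← ENNReal.rpow_mul, hrb]
  have hgI : ∫⁻ x, ‖g x‖ₑ ^ (1 / b) = J := lintegral_congr hge
  have hgM : ∀ x, ‖g x‖ ≤ M ^ (r - 1) := fun x => by
    rw [hgn]
    exact Real.rpow_le_rpow (norm_nonneg _) (hM x) (by linarith)
  have hgb : BddRpow g b := ⟨hgc.measurable, ⟨_, hgM⟩, by rwa [hgI]⟩
  have hpair : ‖hermitePairing k f g‖ₑ = J := by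
    rw [hermitePairing_eq_integral k f hgc.measurable hgM]
    have e : ∀ x, F x * g x = ((‖F x‖ ^ r : ℝ) : ℂ) := by
      intro x
      rw [hg, ← mul_assoc, Complex.mul_conj, Complex.normSq_eq_norm_sq, ← Complex.ofReal_mul,
        ← Real.rpow_two, ← Real.rpow_add' (norm_nonneg _) (by linarith)]
      congr 2; ring
    rw [← hF, integral_congr_ae (Filter.Eventually.of_forall e), integral_complex_ofReal,
      ← ofReal_norm, Complex.norm_real,
      Real.norm_of_nonneg (integral_nonneg fun _ => by positivity),
      integral_eq_lintegral_of_nonneg_ae (Filter.Eventually.of_forall fun _ => by positivity)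
        (hFc.norm.rpow_const fun _ => Or.inr (by linarith)).aestronglyMeasurable]
    have e2 : ∫⁻ x, ENNReal.ofReal (‖F x‖ ^ r) = J := lintegral_congr fun x => by
      rw [← ENNReal.ofReal_rpow_of_nonneg (norm_nonneg _) (by linarith), ofReal_norm]
    rw [e2, ENNReal.ofReal_toReal hJt]
  have hmain := h k f g hf hgb
  rw [hpair, hgI, ← mul_assoc] at hmain
  rcases eq_or_ne J 0 with h0 | h0
  · rw [h0, ENNReal.zero_rpow_of_pos (by linarith)]
    exact zero_le
  · have hz : J ^ b ≠ 0 := (ENNReal.rpow_pos (pos_iff_ne_zero.2 h0) hJt).ne'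
    have hz' : J ^ b ≠ ∞ := ENNReal.rpow_ne_top_of_ne_zero h0 hJt
    rw [← ENNReal.mul_le_mul_iff_left hz hz', ← ENNReal.rpow_add _ _ h0 hJt, sub_add_cancel,
      ENNReal.rpow_one]
    exact hmain

theorem exists_norm_schwartzMap_le (f : 𝓢(EuclideanSpace ℝ (Fin d), ℂ)) :
    ∃ M, ∀ x, ‖f x‖ ≤ M :=
  ⟨_, fun x => f.toBoundedContinuousFunction.norm_coe_le_norm x⟩

theorem StrongBound.opNormLp_le {p q : ℝ≥0∞} {a b : ℝ} {K : ℝ≥0} (h : StrongBound d a b K)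
    (ha : 0 < a) (ha1 : a ≤ 1) (hb : 1 / 2 ≤ b) (hb1 : b < 1) (hp : p⁻¹.toReal = a)
    (hq : q⁻¹.toReal = 1 - b) (k : ℕ) : opNormLp (hermiteProj d (2 * k + d)) p q ≤ K := by
  obtain ⟨hp1, hpt⟩ := one_le_of_toReal_inv (p := p) (by rw [hp]; exact ha) (by rw [hp]; exact ha1)
  obtain ⟨hq1, hqt⟩ := one_le_of_toReal_inv (p := q) (by rw [hq]; linarith) (by rw [hq]; linarith)
  have hp0 : p ≠ 0 := (zero_lt_one.trans_le hp1).ne'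
  have hq0 : q ≠ 0 := (zero_lt_one.trans_le hq1).ne'
  have hpr : p.toReal = 1 / a := by rw [← hp, ENNReal.toReal_inv, one_div, inv_inv]
  have hqr : q.toReal = 1 / (1 - b) := by rw [← hq, ENNReal.toReal_inv, one_div, inv_inv]
  refine iSup₂_le fun f hf => ?_
  have hfin := lintegral_rpow_enorm_lt_top_of_eLpNorm_lt_top hp0 hpt (hf.trans_lt ENNReal.one_lt_top)
  rw [eLpNorm_eq_lintegral_rpow_enorm_toReal hp0 hpt] at hf
  rw [hpr] at hfin hf
  rw [one_div_one_div] at hf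
  have hfb : BddRpow f a := ⟨f.continuous.measurable, exists_norm_schwartzMap_le f, hfin.ne⟩
  rw [eLpNorm_eq_lintegral_rpow_enorm_toReal hq0 hqt, hqr, one_div_one_div]
  refine (h.lintegral_hermiteProj_le hb hb1 hfb k).trans ?_
  exact mul_le_of_le_one_right' hf

theorem exists_opNormLp_le_of_mem_pentagon (hd : 3 ≤ d) {p q : ℝ≥0∞}
    (hpq : exponentPoint p q ∈ pentagon d) :
    ∃ C : ℝ≥0, ∀ lam ∈ hermiteSpectrum d, opNormLp (hermiteProj d lam) p q ≤ C := by
  have hd3 : (3 : ℝ) ≤ d := by exact_mod_cast hd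
  obtain ⟨hhull, hv⟩ := hpq
  obtain ⟨h1, h2, h3, h4, h5⟩ := convexHull_pentagon_subset hd hhull
  simp only [exponentPoint, pointF, dualPoint, mem_insert_iff, mem_singleton_iff, not_or,
    Prod.mk.injEq, not_and_or] at h1 h2 h3 h4 h5 hv
  set a := p⁻¹.toReal with ha
  set c := q⁻¹.toReal with hc
  have hd1 : (d : ℝ) - 1 ≠ 0 := by linarith
  have hB : (d : ℝ) / (2 * (d - 1)) = 1 - (d - 2) / (2 * (d - 1)) := by field_simp; ring
  obtain ⟨K, hK⟩ := exists_strongBound_of_halfPlanes hd h1 h2 h3 h4 h5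
    (hv.1.imp_right fun h h' => h (by linarith))
    (hv.2.symm.imp (fun h h' => h (by linarith)) fun h h' => h (by linarith))
  have h2d : (2 : ℝ) / d ≤ 2 / 3 := by gcongr
  have hid : (1 : ℝ) / d ≤ 1 / 3 := by gcongr
  -- The pentagon stays away from p = 1 and q = ∞; the duality step needs q finite.
  have hlt : a < 1 ∧ 1 - c < 1 := by
    have e : (d : ℝ) * (1 / d) = 1 := by field_simp
    have e2 : (2 : ℝ) / d = 2 * (1 / d) := by ring
    rw [e2] at h3
    constructor <;> by_contra! hcon <;> nlinarith
  refine ⟨K, ?_⟩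
  rintro _ ⟨k, rfl⟩
  exact hK.opNormLp_le (by linarith) hlt.1.le h2 hlt.2 rfl (by ring) k

end Pentagon

/-! ### Dimension two: the Laguerre polynomials L_k^{(1)} -/

section Laguerre

open Polynomial

/-- The Laguerre polynomial `L_k^{(1)}(X) = ∑_{j ≤ k} C(k + 1, j + 1) (-X) ^ j / j!`. -/
noncomputable def laguerreOne (k : ℕ) : ℝ[X] :=
  ∑ j ∈ Finset.range (k + 1), C ((k + 1).choose (j + 1) * (-1) ^ j / j.factorial : ℝ) * X ^ j

theorem coeff_laguerreOne (k j : ℕ) :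
    (laguerreOne k).coeff j = (k + 1).choose (j + 1) * (-1) ^ j / j.factorial := by
  rw [laguerreOne, finsetSum_coeff]
  simp only [coeff_C_mul, coeff_X_pow, mul_ite, mul_one, mul_zero]
  rw [Finset.sum_ite_eq]
  split_ifs with h
  · rfl
  · rw [Finset.mem_range, not_lt] at h
    rw [Nat.choose_eq_zero_of_lt (by omega)]
    simp

/-- Pascal's rule on coefficients. It drives the telescoping in `derivative_laguerreSum`. -/
theorem derivative_laguerreOne_succ (k : ℕ) :
    derivative (laguerreOne (k + 1)) = derivative (laguerreOne k) - laguerreOne k := by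
  ext j
  rw [coeff_sub, coeff_derivative, coeff_derivative, coeff_laguerreOne, coeff_laguerreOne,
    coeff_laguerreOne, Nat.choose_succ_succ (k + 1) (j + 1), Nat.factorial_succ]
  push_cast
  field_simp
  ring

/-- Coefficientwise the equation is the ratio recurrence (j + 1)(j + 2)c_{j+1} = (j - k)c_j of the
binomial coefficients. -/
theorem laguerreOne_ode (k : ℕ) :
    X * derivative (derivative (laguerreOne k)) + (2 - X) * derivative (laguerreOne k) +
      (k : ℝ[X]) * laguerreOne k = 0 := by
  have key : ∀ j : ℕ, ((j : ℝ) + 1) * (j + 2) * (laguerreOne k).coeff (j + 1) =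
      (j - k) * (laguerreOne k).coeff j := by
    intro j
    rw [coeff_laguerreOne, coeff_laguerreOne, Nat.factorial_succ]
    have h : ((k + 1).choose (j + 2) : ℝ) * (j + 2) = (k + 1).choose (j + 1) * (k - j) := by
      rcases le_or_gt j k with hjk | hjk
      · have := Nat.choose_succ_right_eq (k + 1) (j + 1)
        rw [Nat.add_sub_add_right] at this
        have h2 := congrArg (Nat.cast : ℕ → ℝ) this
        push_cast [Nat.cast_sub hjk] at h2
        rw [← h2]; ring
      · rw [Nat.choose_eq_zero_of_lt (by omega), Nat.choose_eq_zero_of_lt (by omega)]; simp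
    push_cast
    field_simp
    rw [pow_succ]
    linear_combination (-(-1) ^ j) * h
  have hk : (k : ℝ[X]) = C (k : ℝ) := by simp
  have h2 : (2 : ℝ[X]) = C (2 : ℝ) := rfl
  ext j
  rw [sub_mul, hk, h2]
  rcases j with _ | j
  · simp only [coeff_add, coeff_sub, coeff_C_mul, coeff_X_mul_zero, coeff_derivative, coeff_zero]
    have := key 0
    push_cast at this ⊢
    linarith
  · simp only [coeff_add, coeff_sub, coeff_C_mul, coeff_X_mul, coeff_derivative, coeff_zero]
    have := key (j + 1)
    push_cast at this ⊢
    linarith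

/-- `laguerreSum k = ∑_{n ≤ k} (-1) ^ n L_n`, in the form `N_k + 2 ∑_{n < k} N_n` with
`N_n = (-1) ^ n L_n^{(1)}`. -/
noncomputable def laguerreSum (k : ℕ) : ℝ[X] :=
  C ((-1) ^ k) * laguerreOne k + 2 * ∑ n ∈ Finset.range k, C ((-1) ^ n) * laguerreOne n

theorem laguerreSum_succ (k : ℕ) : laguerreSum (k + 1) =
    laguerreSum k + C ((-1) ^ (k + 1)) * laguerreOne (k + 1) + C ((-1) ^ k) * laguerreOne k := by
  rw [laguerreSum, laguerreSum, Finset.sum_range_succ]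
  ring

theorem laguerreOne_zero : laguerreOne 0 = 1 := by
  simp [laguerreOne]

theorem laguerreSum_zero : laguerreSum 0 = 1 := by
  simp [laguerreSum, laguerreOne_zero]

/-- Equivalently, e^{-x/2} times the sum has derivative -(1/2) e^{-x/2} (-1)^k L_k^{(1)}: a single
solution of a second-order equation instead of a sum of k terms. -/
theorem derivative_laguerreSum (k : ℕ) :
    2 * derivative (laguerreSum k) = laguerreSum k - C ((-1) ^ k) * laguerreOne k := by
  induction k with
  | zero => simp [laguerreSum_zero, laguerreOne_zero]
  | succ k ih =>
    rw [laguerreSum_succ, map_add, map_add, mul_add, mul_add, ih, derivative_C_mul,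
      derivative_C_mul, derivative_laguerreOne_succ, pow_succ, C_mul, C_neg, C_1]
    ring

theorem eval_zero_laguerreOne (k : ℕ) : (laguerreOne k).eval 0 = k + 1 := by
  rw [← coeff_zero_eq_eval_zero, coeff_laguerreOne]; simp

theorem eval_zero_laguerreSum (k : ℕ) : (laguerreSum k).eval 0 = (1 + (-1) ^ k) / 2 := by
  induction k with
  | zero => simp [laguerreSum_zero]
  | succ k ih =>
    rw [laguerreSum_succ, eval_add, eval_add, eval_C_mul, eval_C_mul, eval_zero_laguerreOne,
      eval_zero_laguerreOne, ih, pow_succ]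
    push_cast
    ring

/-- The generating function of `(-1) ^ k L_k^{(1)}`. -/
theorem hasSum_laguerreOne {r : ℝ} (hr : |r| < 1) (x : ℝ) :
    HasSum (fun k => ((-1) ^ k * (laguerreOne k).eval x) * r ^ k)
      (((1 + r) ^ 2)⁻¹ * Real.exp (x * r / (1 + r))) := by
  have h1 : ∀ q : ℝ, |q| < 1 → ∀ y : ℝ, HasSum (fun j : ℕ => y ^ j / j.factorial *
      (q ^ j * (1 / (1 - q) ^ (j + 1 + 1)))) (((1 - q) ^ 2)⁻¹ * Real.exp (y * q / (1 - q))) := by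
    intro q hq y
    have hq1 : 1 - q ≠ 0 := by linarith [(abs_lt.1 hq).2]
    have := (NormedSpace.expSeries_div_hasSum_exp (y * q / (1 - q))).mul_left (((1 - q) ^ 2)⁻¹)
    rw [← Real.exp_eq_exp_ℝ] at this
    refine this.of_eq (fun j => ?_) rfl
    rw [div_pow, mul_pow, pow_add (1 - q) (j + 1) 1, pow_succ (1 - q) j]
    field_simp
  -- The double series over (j, m) with k = j + m. Summing in m first is a negative binomial series,
  -- after which the sum in j is an exponential series; grouping by j + m gives the polynomials.
  set F : ℕ × ℕ → ℝ := fun i => (-x) ^ i.1 / i.1.factorial *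
    ((-r) ^ i.1 * (((i.2 + (i.1 + 1)).choose (i.1 + 1) : ℕ) * (-r) ^ i.2)) with hF
  have hr' : ‖-r‖ < 1 := by rwa [norm_neg]
  have hr'' : ‖|r|‖ < 1 := by rwa [Real.norm_eq_abs, abs_abs]
  have hinner : ∀ j : ℕ, HasSum (fun m => F (j, m)) ((-x) ^ j / j.factorial *
      ((-r) ^ j * (1 / (1 - -r) ^ (j + 1 + 1)))) := fun j =>
    ((hasSum_choose_mul_geometric_of_norm_lt_one (j + 1) hr').mul_left _).mul_left _
  have hinner' : ∀ j : ℕ, HasSum (fun m => ‖F (j, m)‖) (|x| ^ j / j.factorial *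
      (|r| ^ j * (1 / (1 - |r|) ^ (j + 1 + 1)))) := fun j => by
    refine (((hasSum_choose_mul_geometric_of_norm_lt_one (j + 1) hr'').mul_left _).mul_left
      _).of_eq (fun m => ?_) rfl
    simp only [hF, norm_mul, norm_div, norm_pow, norm_neg, Real.norm_eq_abs, Nat.abs_cast]
  have hsum : Summable F := by
    refine Summable.of_norm ((summable_prod_of_nonneg fun _ => norm_nonneg _).2
      ⟨fun j => (hinner' j).summable, ?_⟩)
    simp_rw [(hinner' _).tsum_eq]
    exact (h1 |r| (by rwa [abs_abs]) |x|).summable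
  have htot : HasSum F (((1 + r) ^ 2)⁻¹ * Real.exp (x * r / (1 + r))) := by
    have h2 := hsum.hasSum.prod_fiberwise hinner
    have h3 := h1 (-r) (by rwa [abs_neg]) (-x)
    have h4 := h2.unique h3
    rw [sub_neg_eq_add, neg_mul_neg] at h4
    rw [← h4]
    exact hsum.hasSum
  rw [← Finset.HasAntidiagonal.sigmaAntidiagonalEquivProd.hasSum_iff] at htot
  refine (htot.sigma fun k => hasSum_fintype _).of_eq (fun k => ?_) rfl
  refine Eq.symm ((Finset.sum_coe_sort (Finset.HasAntidiagonal.antidiagonal k) F).trans ?_)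
  rw [Finset.Nat.sum_antidiagonal_eq_sum_range_succ_mk, laguerreOne, eval_finsetSum,
    Finset.mul_sum, Finset.sum_mul]
  refine Finset.sum_congr rfl fun j hj => ?_
  have hjk : j ≤ k := by simpa [Nat.lt_succ_iff] using hj
  obtain ⟨m, rfl⟩ := Nat.exists_eq_add_of_le hjk
  simp only [hF, eval_mul, eval_C, eval_pow, eval_X, add_tsub_cancel_left]
  rw [show m + (j + 1) = j + m + 1 by ring, neg_pow x, neg_pow r, neg_pow r m, pow_add r, pow_add (-1 : ℝ)]
  ring

end Laguerre

/-! ### The diagonal of the projection kernel in dimension two -/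

section Density

theorem eq_zero_of_hasSum_pow {c : ℕ → ℝ}
    (h : ∀ r : ℝ, |r| < 1 → HasSum (fun n => c n * r ^ n) 0) (n : ℕ) : c n = 0 := by
  have h1 : HasFPowerSeriesAt (0 : ℝ → ℝ) (FormalMultilinearSeries.ofScalars ℝ c) 0 := by
    rw [hasFPowerSeriesAt_iff]
    filter_upwards [Metric.ball_mem_nhds (0 : ℝ) one_pos] with r hr
    refine (h r (by simpa using hr)).of_eq (fun n => ?_) rfl
    rw [FormalMultilinearSeries.coeff_ofScalars, smul_eq_mul, mul_comm]
  have h2 := h1.eq_zero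
  rw [FormalMultilinearSeries.ofScalars_series_eq_zero] at h2
  rw [h2]; rfl

/-- Comparing coefficients in `(1 - r) ∑ a_n r ^ n = (1 + r) ∑ b_n r ^ n`. -/
theorem coeff_of_one_sub_mul_eq {a b : ℕ → ℝ} {α β : ℝ → ℝ}
    (ha : ∀ r : ℝ, |r| < 1 → HasSum (fun n => a n * r ^ n) (α r))
    (hb : ∀ r : ℝ, |r| < 1 → HasSum (fun n => b n * r ^ n) (β r))
    (h : ∀ r : ℝ, |r| < 1 → (1 - r) * α r = (1 + r) * β r) :
    a 0 = b 0 ∧ ∀ n, a (n + 1) = a n + b (n + 1) + b n := by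
  -- These are the coefficients of (1 - r)∑ a_n r^n - (1 + r)∑ b_n r^n; the constant term has no
  -- shifted contribution.
  have h1 : ∀ n, (Nat.casesOn n (a 0 - b 0)
      fun n => a (n + 1) - b (n + 1) - (a n + b n) : ℝ) = 0 := by
    refine eq_zero_of_hasSum_pow fun r hr => ?_
    rw [← hasSum_nat_add_iff' 1]
    have h2 := (hasSum_nat_add_iff' 1).2 ((ha r hr).sub (hb r hr))
    have h3 := ((ha r hr).add (hb r hr)).mul_left r
    refine (h2.sub h3).of_eq (fun n => ?_) ?_
    · simp only
      ring
    · rw [Finset.sum_range_one, Finset.sum_range_one]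
      change 0 - (a 0 - b 0) * r ^ 0 = _
      linarith [h r hr]
  exact ⟨sub_eq_zero.1 (h1 0), fun n => by have := h1 (n + 1); simp only at this; linarith⟩

variable {d : ℕ}

/-- The diagonal `∑_{|α| = k} Φ_α(x)²` of the kernel of the spectral projection. -/
noncomputable def hermiteDensity (k : ℕ) (x : EuclideanSpace ℝ (Fin d)) : ℝ :=
  ∑ α ∈ hermiteIndex d (2 * k + d), hermitePhi α x ^ 2

theorem hermiteDensity_nonneg (k : ℕ) (x : EuclideanSpace ℝ (Fin d)) : 0 ≤ hermiteDensity k x :=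
  Finset.sum_nonneg fun _ _ => sq_nonneg _

theorem hasSum_hermiteDensity {r : ℂ} (hr : ‖r‖ < 1) (x : EuclideanSpace ℝ (Fin d)) :
    HasSum (fun k : ℕ => (hermiteDensity k x : ℂ) * r ^ k) (∏ i, mehlerKernel r (x i) (x i)) := by
  have h := hasSum_mehler_pi hr x x
  rw [← (Equiv.sigmaFiberEquiv fun α : Fin d → ℕ => ∑ i, α i).hasSum_iff] at h
  refine HasSum.sigma h fun k => ?_
  set F : (Fin d → ℕ) → ℂ := fun α => if ∑ i, α i = k then
    r ^ (∑ i, α i) * ((hermitePhi α x * hermitePhi α x : ℝ) : ℂ) else 0 with hF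
  have hfin : HasSum F (∑ α ∈ hermiteIndex d (2 * k + d), F α) :=
    hasSum_sum_of_ne_finset_zero fun α hα => by
      rw [mem_hermiteIndex] at hα
      rw [hF]
      exact if_neg (by omega)
  have e : ((hermiteDensity k x : ℂ) * r ^ k) = ∑ α ∈ hermiteIndex d (2 * k + d), F α := by
    rw [hermiteDensity, Complex.ofReal_sum, Finset.sum_mul]
    refine Finset.sum_congr rfl fun α hα => ?_
    rw [mem_hermiteIndex] at hα
    have hk : ∑ i, α i = k := by omega
    simp only [hF, if_pos hk, hk]
    push_cast
    ring
  rw [e]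
  refine (hasSum_subtype_iff_indicator (f := fun α : Fin d → ℕ =>
    r ^ (∑ i, α i) * ((hermitePhi α x * hermitePhi α x : ℝ) : ℂ))
    (s := {α : Fin d → ℕ | ∑ i, α i = k})).2 (hfin.of_eq (fun α => ?_) rfl)
  rw [indicator_apply]; rfl

/-- With two variables the square root in the prefactor is squared, so the branch disappears and a
rational function of r is left. -/
theorem mehlerKernel_self_sq_exp {r : ℝ} (hr : |r| < 1) (x y : ℝ) :
    mehlerKernel r x x * mehlerKernel r y y =
      ((Real.pi⁻¹ * (1 - r ^ 2)⁻¹ * Real.exp (-(x ^ 2 + y ^ 2) * ((1 - r) / (1 + r))) : ℝ) : ℂ) := by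
  have h1 : ∀ t : ℝ, mehlerKernel r t t = ((Real.sqrt 2 * Real.pi : ℝ) : ℂ)⁻¹ *
      (Real.pi / ((1 - (r : ℂ) ^ 2) / 2)) ^ (1 / 2 : ℂ) *
      Complex.exp (-((1 - r) / (1 + r) * t ^ 2)) := by
    intro t
    rw [mehlerKernel]
    congr 2
    ring
  have h2 : ((Real.pi / ((1 - (r : ℂ) ^ 2) / 2)) ^ (1 / 2 : ℂ)) ^ 2 =
      Real.pi / ((1 - (r : ℂ) ^ 2) / 2) := by
    have := Complex.cpow_nat_inv_pow (Real.pi / ((1 - (r : ℂ) ^ 2) / 2)) two_ne_zero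
    rw [one_div]
    exact_mod_cast this
  have h3 : (((Real.sqrt 2 * Real.pi : ℝ) : ℂ)⁻¹) ^ 2 = (2 * (Real.pi : ℂ) ^ 2)⁻¹ := by
    rw [inv_pow, ← Complex.ofReal_pow, mul_pow, Real.sq_sqrt (by norm_num)]
    push_cast
    rfl
  have hne : (1 : ℂ) - r ^ 2 ≠ 0 := by
    have : (1 : ℝ) - r ^ 2 ≠ 0 := by nlinarith [abs_lt.1 hr, (sq_lt_one_iff_abs_lt_one r).2 hr]
    exact_mod_cast this
  have hpi : (Real.pi : ℂ) ≠ 0 := by exact_mod_cast Real.pi_ne_zero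
  rw [h1, h1]
  calc _ = (((Real.sqrt 2 * Real.pi : ℝ) : ℂ)⁻¹) ^ 2 *
        ((Real.pi / ((1 - (r : ℂ) ^ 2) / 2)) ^ (1 / 2 : ℂ)) ^ 2 *
        (Complex.exp (-((1 - r) / (1 + r) * x ^ 2)) * Complex.exp (-((1 - r) / (1 + r) * y ^ 2))) := by
          ring
    _ = _ := by
      rw [h2, h3, ← Complex.exp_add]
      push_cast
      congr 1
      · field_simp
      · congr 1; ring

/-- In dimension two, the density is a Laguerre sum in `2 |x|²`. -/
theorem hermiteDensity_eq (k : ℕ) (x : EuclideanSpace ℝ (Fin 2)) :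
    hermiteDensity k x = Real.pi⁻¹ * (Real.exp (-(x 0 ^ 2 + x 1 ^ 2)) *
      (laguerreSum k).eval (2 * (x 0 ^ 2 + x 1 ^ 2))) := by
  set s := x 0 ^ 2 + x 1 ^ 2 with hs
  set c := Real.pi⁻¹ * Real.exp (-s) with hc
  have ha : ∀ r : ℝ, |r| < 1 → HasSum (fun n => hermiteDensity n x * r ^ n)
      (Real.pi⁻¹ * (1 - r ^ 2)⁻¹ * Real.exp (-s * ((1 - r) / (1 + r)))) := by
    intro r hr
    have h := hasSum_hermiteDensity (r := (r : ℂ)) (by rwa [Complex.norm_real]) x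
    rw [Fin.prod_univ_two, mehlerKernel_self_sq_exp hr] at h
    rw [← Complex.hasSum_ofReal]
    exact h.of_eq (fun n => by push_cast; rfl) rfl
  have hb : ∀ r : ℝ, |r| < 1 → HasSum (fun n => c * ((-1) ^ n * (laguerreOne n).eval (2 * s)) * r ^ n)
      (c * (((1 + r) ^ 2)⁻¹ * Real.exp (2 * s * r / (1 + r)))) := by
    intro r hr
    exact ((hasSum_laguerreOne hr (2 * s)).mul_left c).of_eq (fun n => by ring) rfl
  -- The two generating functions differ by the factor (1 + r)/(1 - r), so the density satisfies the
  -- recursion of `laguerreSum_succ`.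
  obtain ⟨h0, hsucc⟩ := coeff_of_one_sub_mul_eq ha hb fun r hr => by
    have h1 : 1 - r ≠ 0 := by linarith [(abs_lt.1 hr).2]
    have h2 : 1 + r ≠ 0 := by linarith [(abs_lt.1 hr).1]
    have h3 : (1 - r ^ 2) = (1 - r) * (1 + r) := by ring
    have h4 : Real.exp (-s * ((1 - r) / (1 + r))) = Real.exp (-s) * Real.exp (2 * s * r / (1 + r)) := by
      rw [← Real.exp_add]; congr 1; field_simp; ring
    rw [h3, h4, hc]
    field_simp
  rw [← mul_assoc, ← hc]
  induction k with
  | zero => rw [h0, laguerreSum_zero, laguerreOne_zero]; simp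
  | succ k ih =>
    rw [hsucc, ih, laguerreSum_succ]
    simp only [Polynomial.eval_add, Polynomial.eval_mul, Polynomial.eval_C]
    ring

end Density

/-! ### Monotone quantities and the adiabatic invariant for the Laguerre equation -/

section TurningPoint

theorem le_of_hasDerivAt_nonpos {f f' : ℝ → ℝ} {a b : ℝ} (hab : a ≤ b)
    (hf : ∀ x ∈ Icc a b, HasDerivAt f (f' x) x) (h : ∀ x ∈ Icc a b, f' x ≤ 0) : f b ≤ f a := by
  refine antitoneOn_of_deriv_nonpos (convex_Icc a b)
    (fun x hx => (hf x hx).continuousAt.continuousWithinAt)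
    (fun x hx => (hf x (interior_subset hx)).differentiableAt.differentiableWithinAt)
    (fun x hx => ?_) (left_mem_Icc.2 hab) (right_mem_Icc.2 hab) hab
  rw [(hf x (interior_subset hx)).deriv]
  exact h x (interior_subset hx)

/-- Nonnegative solutions of `(x E')'' = -(K - x / 4) E'` that decay at infinity; here `D = E'` and
`q = (x E')'`. -/
structure DecayingSolution (K : ℝ) (E D D₁ q : ℝ → ℝ) : Prop where
  hasDerivAt_E : ∀ x, HasDerivAt E (D x) x
  hasDerivAt_D : ∀ x, HasDerivAt D (D₁ x) x
  q_eq : ∀ x, q x = D x + x * D₁ x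
  hasDerivAt_q : ∀ x, HasDerivAt q (-(K - x / 4) * D x) x
  nonneg : ∀ x, 0 ≤ x → 0 ≤ E x
  E_zero_le : E 0 ≤ 1
  abs_D_zero_le : |D 0| ≤ K / 2
  tendsto_p : Filter.Tendsto (fun x => x * D x) Filter.atTop (nhds 0)
  tendsto_G : Filter.Tendsto (fun x => 4 * q x + (4 * K - x) * E x) Filter.atTop (nhds 0)

namespace DecayingSolution

variable {K : ℝ} {E D D₁ q : ℝ → ℝ}

theorem hasDerivAt_p (h : DecayingSolution K E D D₁ q) (x : ℝ) :
    HasDerivAt (fun x => x * D x) (q x) x := by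
  have h1 := (hasDerivAt_id x).mul (h.hasDerivAt_D x)
  refine h1.congr_deriv ?_
  rw [h.q_eq]
  simp only [id, one_mul]

/-- The weights 4 and 4K - x make the D terms cancel. What remains is -E, so positivity of E alone
makes this quantity G decreasing. -/
theorem hasDerivAt_G (h : DecayingSolution K E D D₁ q) (x : ℝ) :
    HasDerivAt (fun x => 4 * q x + (4 * K - x) * E x) (-E x) x := by
  have h1 := ((h.hasDerivAt_q x).const_mul 4).add
    (((hasDerivAt_id x).const_sub (4 * K)).mul (h.hasDerivAt_E x))
  refine h1.congr_deriv ?_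
  simp only [id]
  ring

theorem G_antitone (h : DecayingSolution K E D D₁ q) {x y : ℝ} (hx : 0 ≤ x) (hxy : x ≤ y) :
    4 * q y + (4 * K - y) * E y ≤ 4 * q x + (4 * K - x) * E x :=
  le_of_hasDerivAt_nonpos hxy (fun z _ => h.hasDerivAt_G z)
    fun z hz => neg_nonpos.2 (h.nonneg z (hx.trans hz.1))

/-- A decreasing function that tends to 0 at infinity is nonnegative. -/
theorem G_nonneg (h : DecayingSolution K E D D₁ q) {x : ℝ} (hx : 0 ≤ x) :
    0 ≤ 4 * q x + (4 * K - x) * E x :=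
  le_of_tendsto h.tendsto_G
    ((Filter.eventually_ge_atTop x).mono fun _ hy => h.G_antitone hx hy)

/-- The Sonin-type energy `Q x D² + q²` is decreasing. -/
theorem energy_le (h : DecayingSolution K E D D₁ q) (hK : 0 ≤ K) {x : ℝ} (hx : 0 ≤ x) :
    (K - x / 4) * (x * D x ^ 2) + q x ^ 2 ≤ (K / 2) ^ 2 := by
  have hq0 : q 0 = D 0 := by rw [h.q_eq]; ring
  have h1 : (K - x / 4) * (x * D x ^ 2) + q x ^ 2 ≤ (K - 0 / 4) * (0 * D 0 ^ 2) + q 0 ^ 2 := by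
    -- The cross terms D D₁ cancel against those of (q²)', and the terms yD²/4 cancel as well,
    -- leaving exactly -K D².
    refine le_of_hasDerivAt_nonpos (f := fun y => (K - y / 4) * (y * D y ^ 2) + q y ^ 2) (f' := fun y => -(K * D y ^ 2)) hx (fun y _ => ?_)
      fun y _ => neg_nonpos.2 (by positivity)
    have h2 := ((((hasDerivAt_id y).div_const 4).const_sub K).mul
      ((hasDerivAt_id y).mul ((h.hasDerivAt_D y).pow 2))).add ((h.hasDerivAt_q y).pow 2)
    refine h2.congr_deriv ?_
    simp only [id, h.q_eq y, Pi.pow_apply, Pi.mul_apply]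
    push_cast
    ring
  refine h1.trans ?_
  rw [hq0, zero_mul, mul_zero, zero_add]
  exact sq_le_sq' (by linarith [neg_abs_le (D 0), h.abs_D_zero_le])
    ((le_abs_self _).trans h.abs_D_zero_le)

theorem abs_q_le (h : DecayingSolution K E D D₁ q) (hK : 0 ≤ K) {x : ℝ} (hx : 0 ≤ x)
    (hx4 : x ≤ 4 * K) : |q x| ≤ K / 2 := by
  have h1 := h.energy_le hK hx
  have h2 : 0 ≤ (K - x / 4) * (x * D x ^ 2) := mul_nonneg (by linarith) (by positivity)
  exact abs_le_of_sq_le_sq (by linarith) (by linarith)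

/-- G is largest at 0, where 4q(0) ≤ 2K and 4K E(0) ≤ 4K. -/
theorem G_le (h : DecayingSolution K E D D₁ q) (hK : 0 ≤ K) {x : ℝ} (hx : 0 ≤ x) :
    4 * q x + (4 * K - x) * E x ≤ 6 * K := by
  refine (h.G_antitone le_rfl hx).trans ?_
  have h1 := (le_abs_self _).trans (h.abs_q_le hK le_rfl (by linarith))
  have h2 := mul_le_mul_of_nonneg_left h.E_zero_le hK
  linarith

theorem E_le_of_le (h : DecayingSolution K E D D₁ q) (hK : 0 < K) {x : ℝ} (hx : 0 ≤ x)
    (hx2 : x ≤ 2 * K) : E x ≤ 4 := by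
  have h1 := h.G_le hK.le hx
  have h2 := neg_le_of_abs_le (h.abs_q_le hK.le hx (by linarith))
  have h3 := h.nonneg x hx
  by_contra! hcon
  nlinarith

/-- The coefficient of the correction in `adiabatic`. -/
noncomputable def adiabaticCoeff (K x : ℝ) : ℝ := -(K / (2 * x ^ 2)) / √(K / x - 1 / 4) ^ 3

/-- The adiabatic invariant of the oscillating region, with its first correction. -/
noncomputable def adiabatic (K : ℝ) (D q : ℝ → ℝ) (x : ℝ) : ℝ :=
  √(K / x - 1 / 4) * (x * D x) ^ 2 + q x ^ 2 / √(K / x - 1 / 4) +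
    adiabaticCoeff K x * ((x * D x) * q x)

theorem freq_pos {x : ℝ} (hx : 0 < x) (hx4 : x < 4 * K) : 0 < K / x - 1 / 4 := by
  rw [sub_pos, div_lt_div_iff₀ (by norm_num) hx]; linarith

theorem hasDerivAt_sqrt_freq {x : ℝ} (hx : 0 < x) (hx4 : x < 4 * K) :
    HasDerivAt (fun y => √(K / y - 1 / 4)) (-(K / (2 * x ^ 2)) / √(K / x - 1 / 4)) x := by
  have h1 := (((hasDerivAt_inv hx.ne').const_mul K).sub_const (1 / 4)).sqrt
    (by rw [← div_eq_mul_inv]; exact (freq_pos hx hx4).ne')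
  simp only [← div_eq_mul_inv] at h1
  refine h1.congr_deriv ?_
  have := (Real.sqrt_pos.2 (freq_pos hx hx4)).ne'
  field_simp

theorem hasDerivAt_adiabaticCoeff {x : ℝ} (hx : 0 < x) (hx4 : x < 4 * K) :
    HasDerivAt (adiabaticCoeff K)
      (K * (K - x) / (x ^ 3 * √(K / x - 1 / 4) ^ 3 * (4 * K - x))) x := by
  have hw := hasDerivAt_sqrt_freq hx hx4
  have hpos := Real.sqrt_pos.2 (freq_pos hx hx4)
  have hsq := Real.sq_sqrt (freq_pos hx hx4).le
  set w := √(K / x - 1 / 4) with hwdef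
  have h1 : HasDerivAt (fun y : ℝ => -(K / (2 * y ^ 2))) (K / x ^ 3) x := by
    have := (((hasDerivAt_pow 2 x).inv (pow_ne_zero 2 hx.ne')).const_mul (-(K / 2)))
    refine (this.congr_of_eventuallyEq (Filter.Eventually.of_forall fun y => ?_)).congr_deriv ?_
    · simp only [Pi.inv_apply]
      rw [← div_div, ← div_eq_mul_inv, neg_div]
    · push_cast; field_simp
  have h2 := h1.div (hw.pow 3) (pow_ne_zero 3 hpos.ne')
  refine h2.congr_deriv ?_
  simp only [Pi.pow_apply, ← hwdef]
  have hne : 4 * K - x ≠ 0 := by linarith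
  have hxe : 4 * x * w ^ 2 = 4 * K - x := by rw [hsq]; field_simp
  rw [← hxe]
  field_simp
  push_cast
  linear_combination (4 * K * w ^ 2) * hxe

/-- With ω = √(K/x - 1/4) and p = xD one has p' = q and q' = -ω²p. The derivative of ωp² + q²/ω is
ω'(p² - q²/ω²), and the correction (ω'/ω²)pq cancels it; only the derivative of the coefficient
ω'/ω² remains. -/
theorem hasDerivAt_adiabatic (h : DecayingSolution K E D D₁ q) {x : ℝ} (hx : 0 < x)
    (hx4 : x < 4 * K) : HasDerivAt (adiabatic K D q)
      (K * (K - x) / (x ^ 3 * √(K / x - 1 / 4) ^ 3 * (4 * K - x)) * ((x * D x) * q x)) x := by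
  have hw := hasDerivAt_sqrt_freq hx hx4
  have hc := hasDerivAt_adiabaticCoeff hx hx4
  have hpos := Real.sqrt_pos.2 (freq_pos hx hx4)
  have hsq := Real.sq_sqrt (freq_pos hx hx4).le
  have hp := h.hasDerivAt_p x
  have hq := h.hasDerivAt_q x
  have h1 := ((hw.mul (hp.pow 2)).add ((hq.pow 2).div hw hpos.ne')).add (hc.mul (hp.mul hq))
  refine h1.congr_deriv ?_
  simp only [Pi.pow_apply, Pi.mul_apply, adiabaticCoeff]
  set c' := K * (K - x) / (x ^ 3 * √(K / x - 1 / 4) ^ 3 * (4 * K - x))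
  set w := √(K / x - 1 / 4) with hwdef
  have hKx : K - x / 4 = x * w ^ 2 := by rw [hsq]; field_simp
  rw [hKx]
  field_simp
  push_cast
  ring

/-- `|p q| ≤ W` and `W ≤ (3/2) (w p² + q² / w)`, where `W` is the adiabatic invariant. -/
theorem adiabatic_bounds {x : ℝ} (hx : 0 < x) (hx4 : x < 4 * K)
    (hc : |adiabaticCoeff K x| ≤ 1) (D q : ℝ → ℝ) :
    |(x * D x) * q x| ≤ adiabatic K D q x ∧
    √(K / x - 1 / 4) * (x * D x) ^ 2 + q x ^ 2 / √(K / x - 1 / 4) ≤ 2 * adiabatic K D q x ∧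
    adiabatic K D q x ≤
      2 * (√(K / x - 1 / 4) * (x * D x) ^ 2 + q x ^ 2 / √(K / x - 1 / 4)) := by
  have hpos := Real.sqrt_pos.2 (freq_pos hx hx4)
  rw [adiabatic]
  set w := √(K / x - 1 / 4)
  set p := x * D x
  set r := q x
  set c := adiabaticCoeff K x
  have h1 : 2 * |p * r| ≤ w * p ^ 2 + r ^ 2 / w := by
    have e : w * p ^ 2 + r ^ 2 / w - 2 * |p * r| = w * (|p| - |r| / w) ^ 2 := by
      rw [abs_mul, ← sq_abs p, ← sq_abs r]
      field_simp
      ring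
    have : 0 ≤ w * (|p| - |r| / w) ^ 2 := by positivity
    linarith
  have h2 : |c * (p * r)| ≤ |p * r| := by
    rw [abs_mul]; exact mul_le_of_le_one_left (abs_nonneg _) hc
  have h3 := abs_le.1 h2
  have h4 := abs_nonneg (p * r)
  refine ⟨?_, ?_, ?_⟩ <;> linarith

/-- Squaring reduces the claim to a polynomial inequality. It fails only close to the singular point
0 and close to the turning point 4K. -/
theorem abs_adiabaticCoeff_le_one (hK : 0 < K) {x : ℝ} (hx : 0 < x) (hx4 : x < 4 * K)
    (h : 16 * K ^ 2 ≤ x * (4 * K - x) ^ 3) : |adiabaticCoeff K x| ≤ 1 := by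
  have hpos := Real.sqrt_pos.2 (freq_pos hx hx4)
  have hsq := Real.sq_sqrt (freq_pos hx hx4).le
  rw [adiabaticCoeff]
  set w := √(K / x - 1 / 4)
  rw [neg_div, abs_neg, abs_of_pos (by positivity), div_le_one (by positivity)]
  rw [← sq_le_sq₀ (by positivity) (by positivity), ← pow_mul, mul_comm 3 2, pow_mul, hsq, div_pow,
    show K / x - 1 / 4 = (4 * K - x) / (4 * x) by field_simp, div_pow,
    div_le_div_iff₀ (by positivity) (by positivity)]
  calc K ^ 2 * (4 * x) ^ 3 = 4 * x ^ 3 * (16 * K ^ 2) := by ring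
    _ ≤ 4 * x ^ 3 * (x * (4 * K - x) ^ 3) := by gcongr
    _ = _ := by ring

/-- Grönwall with |pq| ≤ W: the derivative of the coefficient c is nonnegative for x ≤ K, so W
e^{-c} decreases, and |c| ≤ 1 at both ends costs at most e². Beyond K the derivative changes sign
and e^{c} is used instead. -/
theorem adiabatic_le_left (h : DecayingSolution K E D D₁ q) (hK : 0 < K) {a b : ℝ} (ha : 0 < a)
    (hab : a ≤ b) (hb : b ≤ K) (hc : ∀ x ∈ Icc a b, |adiabaticCoeff K x| ≤ 1) :
    adiabatic K D q b ≤ adiabatic K D q a * Real.exp 2 := by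
  have h1 : adiabatic K D q b * Real.exp (-adiabaticCoeff K b) ≤
      adiabatic K D q a * Real.exp (-adiabaticCoeff K a) := by
    refine le_of_hasDerivAt_nonpos
      (f := fun x => adiabatic K D q x * Real.exp (-adiabaticCoeff K x)) hab (fun x hx =>
        (h.hasDerivAt_adiabatic (ha.trans_le hx.1) (by linarith [hx.2])).mul
          (hasDerivAt_adiabaticCoeff (ha.trans_le hx.1) (by linarith [hx.2])).neg.exp) fun x hx => ?_
    have hx0 : 0 < x := ha.trans_le hx.1
    have hx4 : x < 4 * K := by linarith [hx.2]
    have hpos := Real.sqrt_pos.2 (freq_pos hx0 hx4)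
    have hb1 := (adiabatic_bounds hx0 hx4 (hc x hx) D q).1
    have hc' : 0 ≤ K * (K - x) / (x ^ 3 * √(K / x - 1 / 4) ^ 3 * (4 * K - x)) :=
      div_nonneg (mul_nonneg hK.le (by linarith [hx.2])) (mul_nonneg (by positivity) (by linarith))
    have h2 := mul_le_mul_of_nonneg_left ((le_abs_self _).trans hb1) hc'
    have h3 := mul_le_mul_of_nonneg_right h2 (Real.exp_pos (-adiabaticCoeff K x)).le
    rw [Pi.neg_apply]
    linarith
  have ha1 := abs_le.1 (hc a (left_mem_Icc.2 hab))
  have hb1 := abs_le.1 (hc b (right_mem_Icc.2 hab))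
  have hWa : 0 ≤ adiabatic K D q a := (abs_nonneg _).trans
    (adiabatic_bounds ha (by linarith) (hc a (left_mem_Icc.2 hab)) D q).1
  calc adiabatic K D q b = adiabatic K D q b * Real.exp (-adiabaticCoeff K b) *
        Real.exp (adiabaticCoeff K b) := by rw [mul_assoc, ← Real.exp_add]; simp
    _ ≤ adiabatic K D q a * Real.exp (-adiabaticCoeff K a) * Real.exp (adiabaticCoeff K b) := by
        gcongr
    _ ≤ _ := by
        rw [mul_assoc, ← Real.exp_add]
        gcongr
        linarith

theorem adiabatic_le_right (h : DecayingSolution K E D D₁ q) (hK : 0 < K) {a b : ℝ} (ha : K ≤ a)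
    (hab : a ≤ b) (hb : b < 4 * K) (hc : ∀ x ∈ Icc a b, |adiabaticCoeff K x| ≤ 1) :
    adiabatic K D q b ≤ adiabatic K D q a * Real.exp 2 := by
  have h1 : adiabatic K D q b * Real.exp (adiabaticCoeff K b) ≤
      adiabatic K D q a * Real.exp (adiabaticCoeff K a) := by
    refine le_of_hasDerivAt_nonpos
      (f := fun x => adiabatic K D q x * Real.exp (adiabaticCoeff K x)) hab (fun x hx =>
        (h.hasDerivAt_adiabatic (by linarith [hx.1]) (by linarith [hx.2])).mul
          (hasDerivAt_adiabaticCoeff (by linarith [hx.1]) (by linarith [hx.2])).exp) fun x hx => ?_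
    have hx0 : 0 < x := by linarith [hx.1]
    have hx4 : x < 4 * K := by linarith [hx.2]
    have hpos := Real.sqrt_pos.2 (freq_pos hx0 hx4)
    have hb1 := (adiabatic_bounds hx0 hx4 (hc x hx) D q).1
    have hc' : K * (K - x) / (x ^ 3 * √(K / x - 1 / 4) ^ 3 * (4 * K - x)) ≤ 0 :=
      div_nonpos_of_nonpos_of_nonneg (mul_nonpos_of_nonneg_of_nonpos hK.le (by linarith [hx.1]))
        (mul_nonneg (by positivity) (by linarith))
    have h2 := mul_le_mul_of_nonpos_left ((neg_le_abs _).trans hb1) hc'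
    have h3 := mul_le_mul_of_nonneg_right h2 (Real.exp_pos (adiabaticCoeff K x)).le
    linarith
  have ha1 := abs_le.1 (hc a (left_mem_Icc.2 hab))
  have hb1 := abs_le.1 (hc b (right_mem_Icc.2 hab))
  have hWa : 0 ≤ adiabatic K D q a := (abs_nonneg _).trans
    (adiabatic_bounds (by linarith) (by linarith) (hc a (left_mem_Icc.2 hab)) D q).1
  calc adiabatic K D q b = adiabatic K D q b * Real.exp (adiabaticCoeff K b) *
        Real.exp (-adiabaticCoeff K b) := by rw [mul_assoc, ← Real.exp_add]; simp
    _ ≤ adiabatic K D q a * Real.exp (adiabaticCoeff K a) * Real.exp (-adiabaticCoeff K b) := by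
        gcongr
    _ ≤ _ := by
        rw [mul_assoc, ← Real.exp_add]
        gcongr
        linarith

/-- The energy bound up to the turning region `4 K - x ≲ K^(1/3)`. -/
theorem adiabatic_le (h : DecayingSolution K E D D₁ q) {κ : ℝ} (hκ : K = κ ^ 3) (hK : 2 ≤ K)
    {x : ℝ} (hx : 2 * K ≤ x) (hx1 : x ≤ 4 * K - 2 * κ) :
    adiabatic K D q x ≤ Real.exp 4 * K := by
  have hκ0 : 0 < κ := by
    by_contra! hcon
    have : κ ^ 3 ≤ 0 := by nlinarith [sq_nonneg κ]
    linarith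
  have hK0 : 0 < K := by linarith
  have h0K : 2 / K ≤ K := by rw [div_le_iff₀ hK0]; nlinarith
  have h0pos : 0 < 2 / K := by positivity
  -- The ends 2/K and 4K - 2κ are chosen so that the lower bounds for y(4K - y)³ on the two halves,
  -- (2/K)(2K)³ and 2K(2κ)³, both equal 16K².
  have hc : ∀ y ∈ Icc (2 / K) x, |adiabaticCoeff K y| ≤ 1 := by
    rintro y ⟨hy1, hy2⟩
    refine abs_adiabaticCoeff_le_one hK0 (h0pos.trans_le hy1) (by linarith) ?_
    rcases le_total y (2 * K) with hy | hy
    · calc 16 * K ^ 2 = 2 / K * (2 * K) ^ 3 := by field_simp; ring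
        _ ≤ _ := by gcongr <;> linarith
    · calc 16 * K ^ 2 = 2 * K * (2 * κ) ^ 3 := by rw [hκ]; ring
        _ ≤ _ := by gcongr <;> linarith
  have h1 := h.adiabatic_le_left hK0 h0pos h0K le_rfl
    fun y hy => hc y ⟨hy.1, hy.2.trans (by linarith)⟩
  have h2 := h.adiabatic_le_right hK0 le_rfl (by linarith : K ≤ x) (by linarith)
    fun y hy => hc y ⟨h0K.trans hy.1, hy.2⟩
  -- At 2/K the invariant is at most twice the Sonin energy divided by ω, with energy at most K²/4
  -- and ω ≥ K/2.
  have h3 : adiabatic K D q (2 / K) ≤ K := by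
    have hlt : 2 / K < 4 * K := by linarith
    refine (adiabatic_bounds h0pos hlt (hc _ ⟨le_rfl, by linarith⟩) D q).2.2.trans ?_
    have he := h.energy_le hK0.le h0pos.le
    have hpos := Real.sqrt_pos.2 (freq_pos h0pos hlt)
    have hsq := Real.sq_sqrt (freq_pos h0pos hlt).le
    have hw : K / 2 ≤ √(K / (2 / K) - 1 / 4) := by
      refine Real.le_sqrt_of_sq_le ?_
      field_simp
      nlinarith
    set w := √(K / (2 / K) - 1 / 4)
    have e : w * (2 / K * D (2 / K)) ^ 2 + q (2 / K) ^ 2 / w =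
        ((K - 2 / K / 4) * (2 / K * D (2 / K) ^ 2) + q (2 / K) ^ 2) / w := by
      have : K - 2 / K / 4 = 2 / K * w ^ 2 := by rw [hsq]; field_simp
      rw [this]
      field_simp
    rw [e, ← mul_div_assoc, div_le_iff₀ hpos]
    nlinarith
  calc adiabatic K D q x ≤ adiabatic K D q K * Real.exp 2 := h2
    _ ≤ adiabatic K D q (2 / K) * Real.exp 2 * Real.exp 2 := by gcongr
    _ ≤ K * Real.exp 2 * Real.exp 2 := by gcongr
    _ = _ := by rw [mul_assoc, ← Real.exp_add]; norm_num; ring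

end DecayingSolution

end TurningPoint

/-! ### Uniform bounds for E up to, across and beyond the turning point -/

section TurningPoint

namespace DecayingSolution

variable {K κ : ℝ} {E D D₁ q : ℝ → ℝ}

theorem kappa_pos (hκ : K = κ ^ 3) (hK : 2 ≤ K) : 0 < κ := by
  by_contra! hcon
  have : κ ^ 3 ≤ 0 := by nlinarith [sq_nonneg κ]
  linarith

theorem sqrt_freq_sq {x : ℝ} (hx : 0 < x) (hx4 : x < 4 * K) :
    √(K / x - 1 / 4) ^ 2 = (4 * K - x) / (4 * x) := by
  rw [Real.sq_sqrt (freq_pos hx hx4).le]; field_simp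

theorem adiabatic_terms_le (h : DecayingSolution K E D D₁ q) (hκ : K = κ ^ 3) (hK : 2 ≤ K)
    {x : ℝ} (hx : 2 * K ≤ x) (hx1 : x ≤ 4 * K - 2 * κ) :
    √(K / x - 1 / 4) * (x * D x) ^ 2 + q x ^ 2 / √(K / x - 1 / 4) ≤ 2 * (Real.exp 4 * K) := by
  have hκ0 := kappa_pos hκ hK
  have hc : |adiabaticCoeff K x| ≤ 1 := by
    refine abs_adiabaticCoeff_le_one (by linarith) (by linarith) (by linarith) ?_
    calc 16 * K ^ 2 = 2 * K * (2 * κ) ^ 3 := by rw [hκ]; ring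
      _ ≤ _ := by gcongr <;> linarith
  refine (adiabatic_bounds (by linarith) (by linarith) hc D q).2.1.trans ?_
  have := h.adiabatic_le hκ hK hx hx1
  linarith

/-- The invariant gives q² ≤ 2e⁴Kω, and 2Kω ≤ κ(4K - x) as long as 4K - x ≥ 2κ. -/
theorem abs_q_le_sqrt (h : DecayingSolution K E D D₁ q) (hκ : K = κ ^ 3) (hK : 2 ≤ K)
    {x : ℝ} (hx : 2 * K ≤ x) (hx1 : x ≤ 4 * K - 2 * κ) :
    |q x| ≤ Real.exp 2 * √κ * √(4 * K - x) := by
  have hκ0 := kappa_pos hκ hK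
  have hx0 : 0 < x := by linarith
  have hx4 : x < 4 * K := by linarith
  have h1 := h.adiabatic_terms_le hκ hK hx hx1
  have hpos := Real.sqrt_pos.2 (freq_pos hx0 hx4)
  have hsq := sqrt_freq_sq hx0 hx4
  set w := √(K / x - 1 / 4)
  have h2 : q x ^ 2 ≤ 2 * (Real.exp 4 * K) * w := by
    rw [← div_le_iff₀ hpos]
    have : 0 ≤ w * (x * D x) ^ 2 := by positivity
    linarith
  set δ := 4 * K - x with hδ
  have hδ2 : 2 * κ ≤ δ := by linarith
  have h3 : 2 * K * w ≤ κ * δ := by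
    refine abs_le_of_sq_le_sq' ?_ (by positivity) |>.2
    have hw : w ^ 2 ≤ δ / (8 * K) := by
      rw [hsq]
      exact div_le_div_of_nonneg_left (by linarith) (by linarith) (by linarith)
    calc (2 * K * w) ^ 2 = 4 * K ^ 2 * w ^ 2 := by ring
      _ ≤ 4 * K ^ 2 * (δ / (8 * K)) := by gcongr
      _ = κ ^ 2 * (κ * δ / 2) := by rw [hκ]; field_simp; ring
      _ ≤ κ ^ 2 * (δ * δ) := by gcongr; nlinarith
      _ = _ := by ring
  refine abs_le_of_sq_le_sq ?_ (by positivity)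
  rw [mul_pow, mul_pow, Real.sq_sqrt hκ0.le, Real.sq_sqrt (by linarith), ← Real.exp_nat_mul]
  calc q x ^ 2 ≤ Real.exp 4 * (2 * K * w) := by linarith
    _ ≤ Real.exp 4 * (κ * δ) := by gcongr
    _ = _ := by rw [← mul_assoc]; norm_num

/-- At the edge 4K - 2κ the frequency ω is at least 1/(3κ), so the invariant yields p² = O(κ³ · κ).
-/
theorem abs_p_le (h : DecayingSolution K E D D₁ q) (hκ : K = κ ^ 3) (hK : 2 ≤ K)
    (hκ1 : 1 ≤ κ) :
    |(4 * K - 2 * κ) * D (4 * K - 2 * κ)| ≤ 3 * Real.exp 2 * κ ^ 2 := by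
  have hκ0 := kappa_pos hκ hK
  have hκK : κ ≤ K := by rw [hκ]; exact le_self_pow₀ hκ1 (by norm_num)
  set x := 4 * K - 2 * κ with hx
  have hx0 : 0 < x := by linarith
  have hx4 : x < 4 * K := by linarith
  have h1 := h.adiabatic_terms_le hκ hK (x := x) (by linarith) le_rfl
  have hpos := Real.sqrt_pos.2 (freq_pos hx0 hx4)
  have hsq := sqrt_freq_sq hx0 hx4
  set w := √(K / x - 1 / 4)
  have h2 : w * (x * D x) ^ 2 ≤ 2 * (Real.exp 4 * K) := by
    have : 0 ≤ q x ^ 2 / w := by positivity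
    linarith
  have h3 : 1 ≤ 3 * κ * w := by
    refine abs_le_of_sq_le_sq' ?_ (by positivity) |>.2
    rw [one_pow, mul_pow, hsq, ← mul_div_assoc, le_div_iff₀ (by positivity)]
    have e : 4 * K - x = 2 * κ := by linarith
    rw [e]
    have e2 : (3 * κ) ^ 2 * (2 * κ) = 18 * K := by rw [hκ]; ring
    rw [e2]
    linarith
  refine abs_le_of_sq_le_sq ?_ (by positivity)
  calc (x * D x) ^ 2 = 1 * (x * D x) ^ 2 := (one_mul _).symm
    _ ≤ 3 * κ * w * (x * D x) ^ 2 := by gcongr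
    _ = 3 * κ * (w * (x * D x) ^ 2) := by ring
    _ ≤ 3 * κ * (2 * (Real.exp 4 * K)) := by gcongr
    _ = 6 * (Real.exp 2 * κ ^ 2) ^ 2 := by
        rw [mul_pow, ← Real.exp_nat_mul, hκ]; norm_num; ring
    _ ≤ 9 * (Real.exp 2 * κ ^ 2) ^ 2 := by gcongr; norm_num
    _ = _ := by ring

theorem G_div_le (h : DecayingSolution K E D D₁ q) (hκ : K = κ ^ 3) (hK : 2 ≤ K)
    {x : ℝ} (hx : 2 * K ≤ x) (hx1 : x ≤ 4 * K - 2 * κ) :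
    (4 * q x + (4 * K - x) * E x) / (4 * K - x) ≤ 3 + 8 * Real.exp 2 := by
  have hκ0 := kappa_pos hκ hK
  set b := Real.exp 2 with hb
  have hb0 : 0 < b := Real.exp_pos 2
  have h1 : (4 * q x + (4 * K - x) * E x) / (4 * K - x) - 8 * b * √κ * (√(4 * K - x))⁻¹ ≤
      (4 * q (2 * K) + (4 * K - 2 * K) * E (2 * K)) / (4 * K - 2 * K) -
        8 * b * √κ * (√(4 * K - 2 * K))⁻¹ := by
    -- (G/(4K - x))' = 4q/(4K - x)², in which E has disappeared. The subtracted term is a primitive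
    -- of the bound for the right side obtained from `abs_q_le_sqrt`; it stays below 8e² because 4K
    -- - x ≥ κ.
    refine le_of_hasDerivAt_nonpos (f := fun x => (4 * q x + (4 * K - x) * E x) / (4 * K - x) -
      8 * b * √κ * (√(4 * K - x))⁻¹) (f' := fun y => 4 / (4 * K - y) ^ 2 *
        (q y - b * √κ * √(4 * K - y))) hx (fun y hy => ?_) fun y hy => ?_
    · have hδ : 0 < 4 * K - y := by linarith [hy.2]
      have hd := (hasDerivAt_id y).const_sub (4 * K)
      have hs := hd.sqrt hδ.ne'
      have hspos := Real.sqrt_pos.2 hδ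
      have h2 := ((h.hasDerivAt_G y).div hd hδ.ne').sub
        ((hs.inv hspos.ne').const_mul (8 * b * √κ))
      refine h2.congr_deriv ?_
      simp only [id]
      have hss := Real.sq_sqrt hδ.le
      set s := √(4 * K - y)
      rw [← hss]
      field_simp
      ring
    · have := (le_abs_self _).trans (h.abs_q_le_sqrt hκ hK hy.1 (hy.2.trans hx1))
      exact mul_nonpos_of_nonneg_of_nonpos (by positivity) (by linarith)
  have hδ2 : 2 * κ ≤ 4 * K - x := by linarith
  have h2 : 8 * b * √κ * (√(4 * K - x))⁻¹ ≤ 8 * b := by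
    rw [← div_eq_mul_inv, div_le_iff₀ (Real.sqrt_pos.2 (by linarith))]
    gcongr
    linarith
  have h3 : (4 * q (2 * K) + (4 * K - 2 * K) * E (2 * K)) / (4 * K - 2 * K) ≤ 3 := by
    rw [div_le_iff₀ (by linarith)]
    have := h.G_le (by linarith) (x := 2 * K) (by linarith)
    linarith
  have h4 : 0 ≤ 8 * b * √κ * (√(4 * K - 2 * K))⁻¹ := by positivity
  linarith

theorem E_le_middle (h : DecayingSolution K E D D₁ q) (hκ : K = κ ^ 3) (hK : 2 ≤ K)
    {x : ℝ} (hx : 2 * K ≤ x) (hx1 : x ≤ 4 * K - 2 * κ) : E x ≤ 3 + 12 * Real.exp 2 := by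
  have hκ0 := kappa_pos hκ hK
  have h1 := h.G_div_le hκ hK hx hx1
  have h2 := neg_le_of_abs_le (h.abs_q_le_sqrt hκ hK hx hx1)
  have hδ2 : 2 * κ ≤ 4 * K - x := by linarith
  have h3 : √κ * √(4 * K - x) ≤ 4 * K - x := by
    calc _ ≤ √(4 * K - x) * √(4 * K - x) := by gcongr; linarith
      _ = _ := Real.mul_self_sqrt (by linarith)
  rw [div_le_iff₀ (by linarith)] at h1
  have h4 := mul_le_mul_of_nonneg_left h3 (Real.exp_pos 2).le
  by_contra! hcon
  have h5 := mul_lt_mul_of_pos_left hcon (by linarith : 0 < 4 * K - x)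
  nlinarith

/-- Over a window of length 2κ nothing can grow much. Monotonicity of G and E ≥ 0 give q = O(κ) from
above; integrating, p = O(κ²), hence D = O(1/κ) since x is of order κ³, and integrating again, E =
O(1). Only upper bounds are needed. -/
theorem E_le_turning (h : DecayingSolution K E D D₁ q) (hκ : K = κ ^ 3) (hK : 2 ≤ K)
    {x : ℝ} (hx : 4 * K - 2 * κ ≤ x) (hx4 : x ≤ 4 * K) : E x ≤ 6 + 23 * Real.exp 2 := by
  have hκ0 := kappa_pos hκ hK
  have hκ1 : 1 ≤ κ := by
    by_contra! hcon
    have : κ ^ 3 ≤ 1 := pow_le_one₀ hκ0.le hcon.le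
    linarith
  have hκK : κ ≤ K := by rw [hκ]; exact le_self_pow₀ hκ1 (by norm_num)
  set b := Real.exp 2 with hb
  have hb0 : 0 < b := Real.exp_pos 2
  set y := 4 * K - 2 * κ with hy
  have hG : 4 * q y + (4 * K - y) * E y ≤ (3 + 8 * b) * (2 * κ) := by
    have h1 := h.G_div_le hκ hK (x := y) (by linarith) le_rfl
    have e : 4 * K - y = 2 * κ := by linarith
    rw [div_le_iff₀ (by linarith), ← hb] at h1
    rw [e] at h1 ⊢
    exact h1
  have hq : ∀ z, y ≤ z → z ≤ 4 * K → q z ≤ (3 + 8 * b) * κ / 2 := by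
    intro z hz1 hz2
    have h1 := h.G_antitone (by linarith : 0 ≤ y) hz1
    have h2 : 0 ≤ (4 * K - z) * E z := mul_nonneg (by linarith) (h.nonneg z (by linarith))
    linarith
  have hp : ∀ z, y ≤ z → z ≤ 4 * K → z * D z ≤ (3 + 11 * b) * κ ^ 2 := by
    intro z hz1 hz2
    have h1 : z * D z - (3 + 8 * b) * κ / 2 * z ≤ y * D y - (3 + 8 * b) * κ / 2 * y :=
      le_of_hasDerivAt_nonpos (f := fun z => z * D z - (3 + 8 * b) * κ / 2 * z) hz1
        (fun t _ => (h.hasDerivAt_p t).sub ((hasDerivAt_id t).const_mul ((3 + 8 * b) * κ / 2)))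
        fun t ht => by
          have := hq t ht.1 (ht.2.trans hz2)
          linarith
    have h2 := (le_abs_self _).trans (h.abs_p_le hκ hK hκ1)
    have h3 : (3 + 8 * b) * κ / 2 * (z - y) ≤ (3 + 8 * b) * κ / 2 * (2 * κ) := by
      gcongr; linarith
    rw [← hy, ← hb] at h2
    linarith
  have hD : ∀ z, y ≤ z → z ≤ 4 * K → D z ≤ (3 + 11 * b) / (2 * κ) := by
    intro z hz1 hz2
    have hz0 : 2 * K ≤ z := by linarith
    have h1 := hp z hz1 hz2
    rw [le_div_iff₀ (by linarith)]
    by_contra! hcon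
    have hDz : 0 < D z := by
      by_contra! hcon2
      nlinarith
    have h2 : 2 * K * D z ≤ z * D z := mul_le_mul_of_nonneg_right hz0 hDz.le
    have h3 : 2 * K * D z = κ ^ 2 * (D z * (2 * κ)) := by rw [hκ]; ring
    have h4 := mul_lt_mul_of_pos_left hcon (by positivity : 0 < κ ^ 2)
    linarith
  have hE : E x - (3 + 11 * b) / (2 * κ) * x ≤ E y - (3 + 11 * b) / (2 * κ) * y :=
    le_of_hasDerivAt_nonpos (f := fun z => E z - (3 + 11 * b) / (2 * κ) * z) hx
      (fun t _ => (h.hasDerivAt_E t).sub ((hasDerivAt_id t).const_mul _))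
      fun t ht => by
        have := hD t ht.1 (ht.2.trans hx4)
        linarith
  have hEy := h.E_le_middle hκ hK (x := y) (by linarith) le_rfl
  have h5 : (3 + 11 * b) / (2 * κ) * (x - y) ≤ (3 + 11 * b) / (2 * κ) * (2 * κ) := by
    gcongr; linarith
  rw [div_mul_cancel₀ _ (by positivity)] at h5
  rw [← hb] at hEy
  linarith

/-- Beyond 4K the term (4K - x)E is nonpositive, so G ≥ 0 forces q ≥ 0. Thus p = xD increases to its
limit 0, hence p ≤ 0 and D ≤ 0. -/
theorem E_antitone_of_le (h : DecayingSolution K E D D₁ q) (hK : 0 < K) {x : ℝ}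
    (hx : 4 * K ≤ x) : E x ≤ E (4 * K) := by
  have hq : ∀ z, 4 * K ≤ z → 0 ≤ q z := by
    intro z hz
    have h1 := h.G_nonneg (by linarith : 0 ≤ z)
    have h2 : (4 * K - z) * E z ≤ 0 :=
      mul_nonpos_of_nonpos_of_nonneg (by linarith) (h.nonneg z (by linarith))
    linarith
  have hp : ∀ z, 4 * K ≤ z → z * D z ≤ 0 := by
    intro z hz
    refine ge_of_tendsto h.tendsto_p ((Filter.eventually_ge_atTop z).mono fun t ht => ?_)
    have := le_of_hasDerivAt_nonpos (f := fun z => -(z * D z)) ht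
      (fun s _ => (h.hasDerivAt_p s).neg) fun s hs => neg_nonpos.2 (hq s (hz.trans hs.1))
    linarith
  refine le_of_hasDerivAt_nonpos hx (fun t _ => h.hasDerivAt_E t) fun t ht => ?_
  have := hp t ht.1
  by_contra! hcon
  have : 0 < t * D t := mul_pos (by linarith [ht.1]) hcon
  linarith

theorem E_le (h : DecayingSolution K E D D₁ q) (hK : 2 ≤ K) {x : ℝ} (hx : 0 ≤ x) :
    E x ≤ 6 + 23 * Real.exp 2 := by
  have hK0 : 0 ≤ K := by linarith
  set κ := K ^ (1 / 3 : ℝ) with hκdef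
  have hκ : K = κ ^ 3 := by
    rw [hκdef, ← Real.rpow_natCast, ← Real.rpow_mul hK0]; norm_num
  have hκ0 := kappa_pos hκ hK
  have he := Real.exp_pos 2
  have h4 : ∀ y, 0 ≤ y → y ≤ 4 * K → E y ≤ 6 + 23 * Real.exp 2 := by
    intro y hy0 hy
    rcases le_total y (2 * K) with h1 | h1
    · linarith [h.E_le_of_le (by linarith) hy0 h1, Real.add_one_le_exp 2]
    rcases le_total y (4 * K - 2 * κ) with h2 | h2
    · linarith [h.E_le_middle hκ hK h1 h2]
    · linarith [h.E_le_turning hκ hK h2 hy]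
  rcases le_total x (4 * K) with h1 | h1
  · exact h4 x hx h1
  · exact (h.E_antitone_of_le (by linarith) h1).trans (h4 _ (by linarith) le_rfl)

end DecayingSolution

end TurningPoint

/-! ### Uniform bound for the planar density -/

section PlanarDensity

open Polynomial

theorem hasDerivAt_exp_mul_eval (P : ℝ[X]) (x : ℝ) :
    HasDerivAt (fun x => Real.exp (-x / 2) * P.eval x)
      (Real.exp (-x / 2) * ((derivative P).eval x - P.eval x / 2)) x := by
  have h1 := ((hasDerivAt_id x).neg.div_const 2).exp.mul (P.hasDerivAt x)
  refine h1.congr_deriv ?_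
  simp only [Pi.neg_apply, id]
  ring

theorem tendsto_exp_mul_eval (P : ℝ[X]) :
    Filter.Tendsto (fun x => Real.exp (-x / 2) * P.eval x) Filter.atTop (nhds 0) := by
  have h := (P.comp (C 2 * X)).tendsto_div_exp_atTop.comp
    (Filter.tendsto_id.atTop_div_const (two_pos : (0 : ℝ) < 2))
  refine h.congr fun x => ?_
  simp only [Function.comp_apply, id, eval_comp, eval_mul, eval_C, eval_X]
  rw [mul_div_cancel₀ x two_ne_zero, neg_div, Real.exp_neg, div_eq_inv_mul]

/-- D is -(1/2)e^{-x/2}(-1)^k L_k^{(1)}, so its equation is the Laguerre equation conjugated by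
e^{-x/2}, and polynomial times exponential decays. -/
theorem decayingSolution_laguerreSum (k : ℕ) : ∃ D D₁ q : ℝ → ℝ,
    DecayingSolution ((k : ℝ) + 1) (fun x => Real.exp (-x / 2) * (laguerreSum k).eval x) D D₁ q := by
  set S := laguerreSum k with hS
  set N : ℝ[X] := C ((-1) ^ k) * laguerreOne k with hN
  have hSN : derivative S = C (1 / 2) * S - C (1 / 2) * N := by
    have h2 : C (1 / 2 : ℝ) * 2 = 1 := by
      rw [show (2 : ℝ[X]) = C 2 from rfl, ← C_mul]; norm_num
    calc derivative S = C (1 / 2 : ℝ) * (2 * derivative S) := by rw [← mul_assoc, h2, one_mul]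
      _ = _ := by rw [derivative_laguerreSum, mul_sub]
  set N₁ := derivative N with hN₁
  have hode : X * derivative N₁ = -((2 - X) * N₁ + (k : ℝ[X]) * N) := by
    have h := laguerreOne_ode k
    rw [hN₁, hN, derivative_C_mul, derivative_C_mul]
    linear_combination C ((-1) ^ k) * h
  set R : ℝ[X] := C (-1 / 2) * N + X * (C (1 / 4) * N - C (1 / 2) * N₁) with hR
  refine ⟨fun x => Real.exp (-x / 2) * (C (-1 / 2) * N).eval x,
    fun x => Real.exp (-x / 2) * (C (1 / 4) * N - C (1 / 2) * N₁).eval x,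
    fun x => Real.exp (-x / 2) * R.eval x, fun x => ?_, fun x => ?_, fun x => ?_, fun x => ?_,
    fun x hx => ?_, ?_, ?_, ?_, ?_⟩
  · refine (hasDerivAt_exp_mul_eval S x).congr_deriv ?_
    rw [hSN]
    simp only [eval_sub, eval_mul, eval_C]
    ring
  · refine (hasDerivAt_exp_mul_eval _ x).congr_deriv ?_
    rw [derivative_C_mul, ← hN₁]
    simp only [eval_sub, eval_mul, eval_C]
    ring
  · rw [hR]
    simp only [eval_add, eval_sub, eval_mul, eval_C, eval_X]
    ring
  · refine (hasDerivAt_exp_mul_eval R x).congr_deriv ?_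
    have h1 : (derivative R).eval x = -N₁.eval x / 2 + N.eval x / 4 - N₁.eval x / 2 +
        x * N₁.eval x / 4 - (X * derivative N₁).eval x / 2 := by
      rw [hR]
      simp only [derivative_sub, derivative_mul, derivative_C, derivative_X,
        eval_add, eval_sub, eval_mul, eval_C, eval_X, ← hN₁, zero_mul, zero_add, one_mul, map_add]
      ring
    rw [h1, hode, hR]
    simp only [eval_add, eval_sub, eval_mul, eval_C, eval_X, eval_neg, eval_natCast, eval_ofNat]
    ring
  -- Positivity is inherited from the sum of squares, at a planar point with 2|y|² = x.
  · have h := hermiteDensity_nonneg k (!₂[√(x / 2), 0] : EuclideanSpace ℝ (Fin 2))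
    rw [hermiteDensity_eq] at h
    have e : (!₂[√(x / 2), 0] : EuclideanSpace ℝ (Fin 2)) 0 ^ 2 +
        (!₂[√(x / 2), 0] : EuclideanSpace ℝ (Fin 2)) 1 ^ 2 = x / 2 := by
      change √(x / 2) ^ 2 + (0 : ℝ) ^ 2 = x / 2
      rw [Real.sq_sqrt (by linarith)]
      ring
    rw [e, mul_div_cancel₀ x two_ne_zero, ← neg_div] at h
    exact nonneg_of_mul_nonneg_right h (inv_pos.2 Real.pi_pos)
  · simp only [hS, eval_zero_laguerreSum, neg_zero, zero_div, Real.exp_zero, one_mul]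
    rcases neg_one_pow_eq_or ℝ k with h | h <;> rw [h] <;> norm_num
  · simp only [hN, eval_mul, eval_C, eval_zero_laguerreOne, neg_zero, zero_div, Real.exp_zero,
      one_mul, abs_mul, abs_pow, abs_neg, abs_one, one_pow]
    rw [abs_of_nonneg (by positivity : (0 : ℝ) ≤ (k : ℝ) + 1), abs_div]
    norm_num
    linarith
  · refine (tendsto_exp_mul_eval (X * (C (-1 / 2) * N))).congr fun x => ?_
    simp only [eval_mul, eval_X]
    ring
  · refine (tendsto_exp_mul_eval (C 4 * R + (C (4 * ((k : ℝ) + 1)) - X) * S)).congr fun x => ?_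
    simp only [eval_add, eval_sub, eval_mul, eval_C, eval_X]
    ring

/-- In dimension two the kernels of the spectral projections are uniformly bounded. -/
theorem hermiteDensity_le (k : ℕ) (x : EuclideanSpace ℝ (Fin 2)) :
    hermiteDensity k x ≤ Real.pi⁻¹ * (6 + 23 * Real.exp 2) := by
  rw [hermiteDensity_eq]
  gcongr
  set s := x 0 ^ 2 + x 1 ^ 2 with hs
  have hs0 : 0 ≤ s := by positivity
  have e : -s = -(2 * s) / 2 := by ring
  -- The asymptotic argument needs K = k + 1 ≥ 2; for k = 0 the function is a plain exponential.
  rcases Nat.eq_zero_or_pos k with rfl | hk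
  · rw [laguerreSum_zero, eval_one, mul_one]
    have h1 := Real.exp_le_one_iff.2 (by linarith : -s ≤ 0)
    linarith [Real.exp_pos 2]
  · obtain ⟨D, D₁, q, h⟩ := decayingSolution_laguerreSum k
    rw [e]
    refine h.E_le ?_ (by positivity)
    have : (1 : ℝ) ≤ k := by exact_mod_cast hk
    linarith

end PlanarDensity

/-! ### Dimension two: from the diagonal bound to the operator norms -/

section Planar

variable {d : ℕ}

theorem norm_hermiteProj_sq_le (k : ℕ) (f : EuclideanSpace ℝ (Fin d) → ℂ)
    (x : EuclideanSpace ℝ (Fin d)) : ‖hermiteProj d (2 * k + d) f x‖ ^ 2 ≤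
      (∑ α ∈ hermiteIndex d (2 * k + d), ‖hermiteCoeff f α‖ ^ 2) * hermiteDensity k x := by
  rw [hermiteProj_eq]
  calc _ ≤ (∑ α ∈ hermiteIndex d (2 * k + d), ‖hermiteCoeff f α‖ * |hermitePhi α x|) ^ 2 := by
        refine pow_le_pow_left₀ (norm_nonneg _) ((norm_sum_le _ _).trans_eq ?_) 2
        exact Finset.sum_congr rfl fun α _ => by rw [norm_mul, Complex.norm_real, Real.norm_eq_abs]
    _ ≤ _ := by
        refine (Finset.sum_mul_sq_le_sq_mul_sq _ _ _).trans_eq ?_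
        simp only [sq_abs]
        rfl

theorem hermiteCoeff_hermiteProj (k : ℕ) (f : EuclideanSpace ℝ (Fin d) → ℂ) {α : Fin d → ℕ}
    (hα : α ∈ hermiteIndex d (2 * k + d)) :
    hermiteCoeff (hermiteProj d (2 * k + d) f) α = hermiteCoeff f α := by
  have e : ∀ x, hermiteProj d (2 * k + d) f x * (hermitePhi α x : ℂ) =
      ∑ β ∈ hermiteIndex d (2 * k + d),
        hermiteCoeff f β * ((hermitePhi β x * hermitePhi α x : ℝ) : ℂ) := by
    intro x
    rw [hermiteProj_eq, Finset.sum_mul]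
    exact Finset.sum_congr rfl fun β _ => by push_cast; ring
  have hi : ∀ β : Fin d → ℕ, Integrable fun x => hermitePhi β x * hermitePhi α x := by
    intro β
    obtain ⟨C, _, hC⟩ := exists_abs_hermitePhi_le β
    exact (integrable_hermitePhi α).bdd_mul (continuous_hermitePhi β).aestronglyMeasurable
      (Filter.Eventually.of_forall hC)
  rw [hermiteCoeff, integral_congr_ae (Filter.Eventually.of_forall e),
    integral_finsetSum _ fun β _ => (hi β).ofReal.const_mul _]
  simp_rw [integral_const_mul, integral_complex_ofReal, integral_hermitePhi_mul]
  rw [Finset.sum_eq_single_of_mem α hα fun β _ hβ => by simp [hβ]]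
  simp

theorem lintegral_enorm_hermiteProj_sq (k : ℕ) (f : EuclideanSpace ℝ (Fin d) → ℂ) :
    ∫⁻ x, ‖hermiteProj d (2 * k + d) f x‖ₑ ^ (2 : ℝ) =
      ENNReal.ofReal (∑ α ∈ hermiteIndex d (2 * k + d), ‖hermiteCoeff f α‖ ^ 2) := by
  set F := hermiteProj d (2 * k + d) f with hF
  have hFc : Continuous F := continuous_hermiteProj k f
  obtain ⟨M, hM⟩ := exists_norm_hermiteProj_le k f
  have hpair : hermitePairing k f (fun x => (starRingEnd ℂ) (F x)) =
      ((∑ α ∈ hermiteIndex d (2 * k + d), ‖hermiteCoeff f α‖ ^ 2 : ℝ) : ℂ) := by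
    rw [← hermitePairing_conj_self]
    refine Finset.sum_congr rfl fun α hα => ?_
    rw [hermiteCoeff_conj, hermiteCoeff_conj, hF, hermiteCoeff_hermiteProj k f hα]
  have hcm : Measurable fun x => (starRingEnd ℂ) (F x) :=
    (Complex.continuous_conj.comp hFc).measurable
  rw [hermitePairing_eq_integral (M := M) k f hcm
    fun x => by rw [RCLike.norm_conj]; exact hM x] at hpair
  have e : ∀ x, F x * (starRingEnd ℂ) (F x) = ((‖F x‖ ^ 2 : ℝ) : ℂ) := fun x => by
    rw [Complex.mul_conj, Complex.normSq_eq_norm_sq]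
  rw [← hF, integral_congr_ae (Filter.Eventually.of_forall e), integral_complex_ofReal] at hpair
  have hpair' : ∫ x, ‖F x‖ ^ 2 = ∑ α ∈ hermiteIndex d (2 * k + d), ‖hermiteCoeff f α‖ ^ 2 := by
    exact_mod_cast hpair
  rw [← hpair', ofReal_integral_eq_lintegral_ofReal
    ((memLp_two_iff_integrable_sq_norm hFc.aestronglyMeasurable).1
      (memLp_hermiteProj k f (by norm_num))) (Filter.Eventually.of_forall fun _ => sq_nonneg _)]
  refine lintegral_congr fun x => ?_
  rw [ENNReal.ofReal_pow (norm_nonneg _), ofReal_norm, ENNReal.rpow_ofNat]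

/-- If the kernel is bounded on the diagonal, `‖Π f‖_q ≲ ‖Π f‖_2` for `q ≥ 2`. -/
theorem eLpNorm_hermiteProj_le {B : ℝ} (hB1 : 1 ≤ B) (k : ℕ)
    (hB : ∀ x : EuclideanSpace ℝ (Fin d), hermiteDensity k x ≤ B)
    (f : EuclideanSpace ℝ (Fin d) → ℂ) {q : ℝ≥0∞} (hq : 2 ≤ q) :
    eLpNorm (hermiteProj d (2 * k + d) f) q volume ≤ ENNReal.ofReal (√B *
      √(∑ α ∈ hermiteIndex d (2 * k + d), ‖hermiteCoeff f α‖ ^ 2)) := by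
  have h2 := lintegral_enorm_hermiteProj_sq k f
  have hpt : ∀ x, ‖hermiteProj d (2 * k + d) f x‖ ≤
      √B * √(∑ α ∈ hermiteIndex d (2 * k + d), ‖hermiteCoeff f α‖ ^ 2) := by
    intro x
    refine abs_le_of_sq_le_sq' ?_ (by positivity) |>.2
    rw [mul_pow, Real.sq_sqrt (by linarith),
      Real.sq_sqrt (Finset.sum_nonneg fun _ _ => sq_nonneg _), mul_comm B]
    refine (norm_hermiteProj_sq_le k f x).trans ?_
    exact mul_le_mul_of_nonneg_left (hB x) (Finset.sum_nonneg fun _ _ => sq_nonneg _)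
  set F := hermiteProj d (2 * k + d) f
  set N2 := ∑ α ∈ hermiteIndex d (2 * k + d), ‖hermiteCoeff f α‖ ^ 2
  have hN2 : 0 ≤ N2 := Finset.sum_nonneg fun _ _ => sq_nonneg _
  set M := √B * √N2 with hM
  rcases eq_or_ne q ∞ with rfl | hqt
  · rw [eLpNorm_exponent_top]
    exact eLpNormEssSup_le_of_ae_bound (Filter.Eventually.of_forall hpt)
  have hq0 : q ≠ 0 := (lt_of_lt_of_le two_pos hq).ne'
  have hq2 : 2 ≤ q.toReal := by
    rw [← ENNReal.toReal_ofNat 2]; exact ENNReal.toReal_mono hqt hq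
  rw [eLpNorm_eq_lintegral_rpow_enorm_toReal hq0 hqt, one_div,
    ENNReal.rpow_inv_le_iff (by linarith)]
  refine (lintegral_enorm_rpow_le_of_bounded (M := ENNReal.ofReal M) ENNReal.ofReal_ne_top
    (fun x => by rw [← ofReal_norm]; exact ENNReal.ofReal_le_ofReal (hpt x))
    (by norm_num) hq2).trans ?_
  rw [h2]
  -- Here B ≥ 1 is used, so that M dominates the L² norm as well as the sup norm and the powers q -
  -- 2 and 2 recombine to M^q.
  have h3 : ENNReal.ofReal N2 ≤ ENNReal.ofReal M ^ (2 : ℝ) := by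
    rw [ENNReal.ofReal_rpow_of_nonneg (by positivity) (by norm_num)]
    refine ENNReal.ofReal_le_ofReal ?_
    rw [Real.rpow_two, hM, mul_pow, Real.sq_sqrt (by linarith), Real.sq_sqrt hN2]
    exact le_mul_of_one_le_left hN2 hB1
  calc _ ≤ ENNReal.ofReal M ^ (q.toReal - 2) * ENNReal.ofReal M ^ (2 : ℝ) := by gcongr
    _ = _ := by
        rw [← ENNReal.rpow_add_of_nonneg _ _ (by linarith) (by norm_num), sub_add_cancel]

theorem sum_norm_hermiteCoeff_conj (s : Finset (Fin d → ℕ)) (f : EuclideanSpace ℝ (Fin d) → ℂ) :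
    ∑ α ∈ s, ‖hermiteCoeff (fun x => (starRingEnd ℂ) (f x)) α‖ ^ 2 =
      ∑ α ∈ s, ‖hermiteCoeff f α‖ ^ 2 := by
  simp only [hermiteCoeff_conj, RCLike.norm_conj]

/-- The dual bound: `‖Π f‖_2 ≲ ‖f‖_p` for `1 ≤ p ≤ 2`. -/
theorem sqrt_sum_norm_hermiteCoeff_sq_le {B : ℝ} (hB1 : 1 ≤ B) (k : ℕ)
    (hB : ∀ x : EuclideanSpace ℝ (Fin d), hermiteDensity k x ≤ B)
    {f : EuclideanSpace ℝ (Fin d) → ℂ} (hf : Measurable f) {M : ℝ} (hM : ∀ x, ‖f x‖ ≤ M)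
    {p : ℝ≥0∞} (hp1 : 1 ≤ p) (hp2 : p ≤ 2) :
    ENNReal.ofReal √(∑ α ∈ hermiteIndex d (2 * k + d), ‖hermiteCoeff f α‖ ^ 2) ≤
      ENNReal.ofReal √B * eLpNorm f p volume := by
  set N2 := ∑ α ∈ hermiteIndex d (2 * k + d), ‖hermiteCoeff f α‖ ^ 2 with hN2def
  have hN2 : 0 ≤ N2 := Finset.sum_nonneg fun _ _ => sq_nonneg _
  set G := hermiteProj d (2 * k + d) fun x => (starRingEnd ℂ) (f x) with hG
  -- The Hölder conjugate in extended form: p = 1 gives p' = ∞.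
  set p' : ℝ≥0∞ := (1 - p⁻¹)⁻¹ with hp'
  have hpinv : p⁻¹ ≤ 1 := ENNReal.inv_le_one.2 hp1
  have hp'2 : 2 ≤ p' := by
    rw [hp', ENNReal.le_inv_iff_le_inv, tsub_le_iff_right]
    calc (1 : ℝ≥0∞) = 2⁻¹ + 2⁻¹ := (ENNReal.inv_two_add_inv_two).symm
      _ ≤ _ := by gcongr
  have hconj : ENNReal.HolderTriple p' p 1 := ⟨by
    rw [hp', inv_inv, inv_one, tsub_add_cancel_of_le hpinv]⟩
  have h1 : ENNReal.ofReal N2 ≤ eLpNorm G p' volume * eLpNorm f p volume := by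
    have h2 := enorm_hermitePairing_conj_self k f
    rw [hermitePairing_comm, hermitePairing_eq_integral k _ hf hM, ← hG, ← hN2def] at h2
    rw [← h2]
    refine (enorm_integral_le_lintegral_enorm _).trans ?_
    rw [← eLpNorm_one_eq_lintegral_enorm]
    exact eLpNorm_smul_le_mul_eLpNorm (φ := G) hf.aestronglyMeasurable
      (continuous_hermiteProj k _).aestronglyMeasurable
  have h2 := eLpNorm_hermiteProj_le hB1 k hB (fun x => (starRingEnd ℂ) (f x)) hp'2
  rw [sum_norm_hermiteCoeff_conj, ← hN2def, ENNReal.ofReal_mul (Real.sqrt_nonneg _)] at h2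
  rcases hN2.eq_or_lt with h0 | h0
  · rw [← h0, Real.sqrt_zero, ENNReal.ofReal_zero]; exact zero_le
  have hs0 : ENNReal.ofReal √N2 ≠ 0 := by simpa using Real.sqrt_pos.2 h0
  -- Hölder's inequality and the L^{p'} bound give N2 ≤ √B √N2 ‖f‖_p; one factor √N2, nonzero here,
  -- is cancelled.
  rw [← ENNReal.mul_le_mul_iff_right hs0 ENNReal.ofReal_ne_top,
    ← ENNReal.ofReal_mul (Real.sqrt_nonneg _), Real.mul_self_sqrt hN2]
  calc _ ≤ _ := h1
    _ ≤ ENNReal.ofReal √B * ENNReal.ofReal √N2 * eLpNorm f p volume := by gcongr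
    _ = _ := by ring

theorem exists_opNormLp_planar_le {p q : ℝ≥0∞} (hp1 : 1 ≤ p) (hp2 : p ≤ 2) (hq : 2 ≤ q) :
    ∃ C : ℝ≥0, ∀ lam ∈ hermiteSpectrum 2, opNormLp (hermiteProj 2 lam) p q ≤ C := by
  set B := max 1 (Real.pi⁻¹ * (6 + 23 * Real.exp 2)) with hBdef
  have hB1 : 1 ≤ B := le_max_left _ _
  have hB : ∀ (k : ℕ) (x : EuclideanSpace ℝ (Fin 2)), hermiteDensity k x ≤ B :=
    fun k x => (hermiteDensity_le k x).trans (le_max_right _ _)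
  refine ⟨(√B * √B).toNNReal, ?_⟩
  rintro _ ⟨k, rfl⟩
  refine iSup₂_le fun f hf => ?_
  obtain ⟨M, hM⟩ := exists_norm_schwartzMap_le f
  refine (eLpNorm_hermiteProj_le hB1 k (hB k) f hq).trans ?_
  have h1 := sqrt_sum_norm_hermiteCoeff_sq_le hB1 k (hB k) f.continuous.measurable hM hp1 hp2
  rw [ENNReal.ofReal_mul (Real.sqrt_nonneg _)]
  change _ ≤ ENNReal.ofReal (√B * √B)
  rw [ENNReal.ofReal_mul (Real.sqrt_nonneg _)]
  exact mul_le_mul' le_rfl (h1.trans (mul_le_of_le_one_right' hf))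

end Planar

theorem theorem1p2 :
    (∀ d : ℕ, 3 ≤ d →
      (∀ p q : ℝ≥0∞, exponentPoint p q ∈ pentagon d →
        ∃ C : ℝ≥0, ∀ lam ∈ hermiteSpectrum d, opNormLp (hermiteProj d lam) p q ≤ C) ∧
      (∃ C : ℝ≥0, ∀ p q : ℝ≥0∞,
        (exponentPoint p q = pointF d ∨ exponentPoint p q = dualPoint (pointF d)) →
        ∀ lam ∈ hermiteSpectrum d, ∀ f : EuclideanSpace ℝ (Fin d) → ℂ,
          AEStronglyMeasurable f volume → lorentzNorm f p 1 < ∞ →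
          lorentzNorm (hermiteProj d lam f) q ∞ ≤ C * lorentzNorm f p 1)) ∧
    (∀ p q : ℝ≥0∞, 1 ≤ p → p ≤ 2 → 2 ≤ q →
      ∃ C : ℝ≥0, ∀ lam ∈ hermiteSpectrum 2, opNormLp (hermiteProj 2 lam) p q ≤ C) :=
  ⟨fun _ hd => ⟨fun _ _ hpq => exists_opNormLp_le_of_mem_pentagon hd hpq,
    exists_lorentzNorm_hermiteProj_le hd⟩,
    fun _ _ hp1 hp2 hq => exists_opNormLp_planar_le hp1 hp2 hq⟩
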